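/- \textbf{Setting.} A multigraph is recorded by the sequence of its edge ends $(L_1,L_2),(L_3,L_4),\dots$, $L_n\in\mathbb N$ being the vertex to which the $n$-th edge end is attached. For arrival times $1=T_1<T_2<\cdots<\infty$ and $\alpha<1$, an $(\alpha,T)$-graph is generated, conditionally on the whole sequence $T$, by $L_n=k$ if $n=T_k$, and otherwise \[ \mathbb P[L_n=k\mid T,L_1,\dots,L_{n-1}]=\frac{\#\{i\le n-1: L_i=k\}-\alpha}{\,n-1-\alpha\max_{i\le n-1}L_i\,},\qquad 1\le k\le \max_{i\le n-1}L_i . \] Let $D_j(n)=\#\{i\le n: L_i=j\}$ be the degree of vertex $j$ after $n$ edge ends have been inserted, and $\Delta_k=T_k-T_{k-1}$ for $k\ge 2$. \textbf{Notation.} $\mathcal G_a$ is a $\mathrm{Gamma}(a,1)$ variable, and $\mathcal B_{a,b}$ a $\mathrm{Beta}(a,b)$ variable ($\mathcal B_{a,0}:=1$). For $\sigma\in(0,1)$ let $f_\sigma$ be the density of the positive $\sigma$-stable variable $\mathcal Z_\sigma$ with $\mathbb E[e^{-\lambda \mathcal Z_\sigma}]=e^{-\lambda^\sigma}$, $\lambda\ge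 0$. Put $\mathcal M_\sigma=\mathcal Z_\sigma^{-\sigma}$, and for $\theta\ge 0$ put $\mathcal M_{\sigma,\theta}=\mathcal Z_{\sigma,\theta}^{-\sigma}$, where $\mathcal Z_{\sigma,\theta}$ has density proportional to $z^{-\theta}f_\sigma(z)$; the law of $\mathcal M_{\sigma,\theta}$ is $\mathrm{ML}(\sigma,\theta)$. All variables multiplied with each other on one side of an identity in law below are independent, except for the coordinates of $(\xi_j)_{j\le r}$, which are taken with their joint law, and the $\Psi_j$ within the stick-breaking vector. \textbf{Proposition.} Let $\beta\in(0,1)$, and let $(L_n)$ be an $(\alpha,T)$-graph with $\alpha=0$, $T_1=1$ and $\Delta_2,\Delta_3,\dots$ i.i.d.\ with $\mathbb P[\Delta_k=m]=\beta(1-\beta)^{m-1}$, $m\ge1$. There are random variables $\xi_1,\xi_2,\dots$ such that almost surely $n^{-(1-\beta)}D_j(n)\to\xi_j$ for every $j\ge1$ (so also $(2n)^{-(1-\beta)}D_j(2n)\to\xi_j$ for the degrees in the graph with $n$ edges), and for every $r\ge1$, conditionally on $T_1,\dots,T_r$, \[ (\xi_j)_{1\le j\le r}\overset{d}{=}\mathcal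 M_{1-\beta,T_r-1}\,\mathcal B_{T_r,(T_r-1)\frac{\beta}{1-\beta}}\cdot\Bigl(\Psi_j\prod_{i=j+1}^r(1-\Psi_i)\Bigr)_{1\le j\le r}, \] where $\Psi_1=1$, $\Psi_j\sim\mathrm{Beta}(1,T_j-1)$ for $j\ge2$, and all the variables on the right are independent. Moreover, conditionally on $T_1,\dots,T_r$, \[ \mathcal G_{T_r}^{1-\beta}\cdot(\xi_j)_{1\le j\le r}\overset{d}{=}\mathcal G_{T_r}\cdot\Bigl(\Psi_j\prod_{i=j+1}^r(1-\Psi_i)\Bigr)_{1\le j\le r}. \] For $j>1$, conditionally on $T_1,\dots,T_j$, \[ \xi_j\overset{d}{=}\mathcal M_{1-\beta}\mathcal B_{1,T_j-1}^{1-\beta} \overset{d}{=}\mathcal M_{1-\beta,T_j-1}\mathcal B_{T_j,(T_j-1)\frac{\beta}{1-\beta}}\Psi_j \overset{d}{=}\mathcal M_{1-\beta,T_j-1}\mathcal B_{1,\frac{T_j-1}{1-\beta}} \overset{d}{=}\mathcal M_{1-\beta,T_j}\mathcal B_{1,\frac{T_j-1+\beta}{1-\beta}}, \qquad \xi_j\,\mathcal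 G_{T_j}^{1-\beta}\overset{d}{=}\mathcal G_1 . \] Finally, for $j>1$, let $\xi_{j+1}$ have its conditional law given $T_1,\dots,T_{j+1}$, and let $\xi_j$ have its conditional law given $T_1,\dots,T_j$. Then \[ \xi_{j+1}\overset{d}{=}\xi_j\,\mathcal B_{T_j,\Delta_{j+1}}^{1-\beta}, \] \[ \xi_{j+1}\prod_{i=1}^{\Delta_{j+1}}\mathcal B_{\frac{T_j+i-\beta}{1-\beta},\frac{\beta}{1-\beta}}\overset{d}{=}\xi_j\,\mathcal B_{\frac{T_j}{1-\beta},\frac{\Delta_{j+1}}{1-\beta}}, \qquad \xi_{j+1}\prod_{i=1}^{\Delta_{j+1}}\mathcal B_{\frac{T_j-1+i-\beta}{1-\beta},\frac{\beta}{1-\beta}}\overset{d}{=}\xi_j\,\mathcal B_{\frac{T_j-\beta}{1-\beta},\frac{\Delta_{j+1}}{1-\beta}} . \] -/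

import Mathlib

open MeasureTheory ProbabilityTheory Filter Topology

noncomputable section

namespace YuleSimon

/-! ### Degree-biased random graphs

A multigraph is recorded by the sequence of labels `l 1, l 2, l 3, …` of its edge ends, the `i`-th
edge being `{l (2 * i - 1), l (2 * i)}`; vertices are numbered `1, 2, 3, …` in order of appearance.
Values at index `0` are never used. -/

/-- Number of the first `n` edge ends that are attached to vertex `k`, i.e. the degree of `k` after
`n` edge ends have been inserted. -/
def degree (l : ℕ → ℕ) (k n : ℕ) : ℕ :=
  ((Finset.Icc 1 n).filter (fun i => l i = k)).card

/-- Number of vertices after `n` edge ends have been inserted: `max {l 1, …, l n}`. -/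
def numVertices (l : ℕ → ℕ) (n : ℕ) : ℕ :=
  (Finset.Icc 1 n).sup l

/-- The `α`-degree biased distribution on the vertices `1, …, max {l 1, …, l n}`. -/
def biasedProb (α : ℝ) (l : ℕ → ℕ) (n k : ℕ) : ℝ :=
  if 1 ≤ k ∧ k ≤ numVertices l n then
    ((degree l k n : ℝ) - α) / ((n : ℝ) - α * (numVertices l n : ℝ))
  else 0

/-- The σ-algebra generated by all arrival times `T 1, T 2, …` and the labels `L 1, …, L n`. -/
abbrev history {Ω : Type*} (T L : ℕ → Ω → ℕ) (n : ℕ) : MeasurableSpace Ω :=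
  MeasurableSpace.comap
    (fun ω => ((fun i : ℕ => T (i + 1) ω), (fun i : Fin n => L (i.val + 1) ω)))
    (inferInstance : MeasurableSpace ((ℕ → ℕ) × (Fin n → ℕ)))

variable {Ω : Type*} [MeasurableSpace Ω]

/-- The random labels `L` are those of an `(α, T)`-graph with random vertex arrival times
`1 = T 1 < T 2 < ⋯ < ∞`: conditionally on the whole sequence `T`, the `n`-th edge end is attached to
vertex `k` if `n = T k`, and otherwise to a vertex drawn from the `α`-degree biased distribution
given the first `n - 1` edge ends. -/
structure IsGraph (α : ℝ) (T L : ℕ → Ω → ℕ) (P : Measure Ω) : Prop where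
  measurable_T : ∀ k, Measurable (T k)
  measurable_L : ∀ n, Measurable (L n)
  first_arrival : ∀ᵐ ω ∂P, T 1 ω = 1
  arrival_lt : ∀ᵐ ω ∂P, ∀ k, 1 ≤ k → T k ω < T (k + 1) ω
  label_arrival : ∀ᵐ ω ∂P, ∀ k, 1 ≤ k → L (T k ω) ω = k
  label_other : ∀ n, 1 ≤ n → ∀ k : ℕ, ∀ᵐ ω ∂P, (∀ i, 1 ≤ i → T i ω ≠ n) →
    (P[(L n ⁻¹' {k}).indicator (fun _ => (1 : ℝ)) | history T L (n - 1)]) ω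
      = biasedProb α (fun i => L i ω) (n - 1) k

/-- The interarrival times `Δ k = T k - T (k - 1)`, `k ≥ 2`, are i.i.d. geometric on `{1, 2, …}`
with success probability `β`. -/
structure GeometricInterarrivals (β : ℝ) (T : ℕ → Ω → ℕ) (P : Measure Ω) : Prop where
  indep : iIndepFun (fun k : ℕ => fun ω => T (k + 2) ω - T (k + 1) ω) P
  law : ∀ k m : ℕ, P {ω | T (k + 2) ω - T (k + 1) ω = m + 1}
    = ENNReal.ofReal (β * (1 - β) ^ m)

/-- `t 1, …, t r` are possible values of the first `r` arrival times: `1 = t 1 < ⋯ < t r`. -/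
def IsArrivalPrefix (r : ℕ) (t : ℕ → ℕ) : Prop :=
  t 1 = 1 ∧ StrictMonoOn t (Set.Icc 1 r)

/-- Conditional law of `X` given `T 1 = t 1, …, T r = t r`. -/
def lawGiven {E : Type*} [MeasurableSpace E] (P : Measure Ω) (T : ℕ → Ω → ℕ) (r : ℕ) (t : ℕ → ℕ)
    (X : Ω → E) : Measure E :=
  (ProbabilityTheory.cond P {ω | ∀ k, 1 ≤ k → k ≤ r → T k ω = t k}).map X

/-! ### Laws on the real line

For independent real random variables with laws `μ` and `ν`, the law of their product is the
multiplicative convolution `μ ∗ₘ ν`. -/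

/-- The law of `X ^ p` when `X` has law `μ`. -/
def powLaw (μ : Measure ℝ) (p : ℝ) : Measure ℝ :=
  μ.map (fun x => x ^ p)

/-- The `Gamma (a, 1)` law. -/
def gammaLaw (a : ℝ) : Measure ℝ :=
  gammaMeasure a 1

/-- The `Beta (a, b)` law for `a > 0`, `b ≥ 0`, with `Beta (a, 0)` the point mass at `1`. -/
def betaLaw (a b : ℝ) : Measure ℝ :=
  if b = 0 then Measure.dirac 1 else betaMeasure a b

/-- `ν` is the positive `σ`-stable law, with Laplace transform `exp (-s ^ σ)`. -/
structure IsPositiveStable (σ : ℝ) (ν : Measure ℝ) : Prop where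
  prob : IsProbabilityMeasure ν
  pos : ∀ᵐ z ∂ν, 0 < z
  laplace : ∀ s : ℝ, 0 ≤ s → ∫ z, Real.exp (-(s * z)) ∂ν = Real.exp (-(s ^ σ))

open Classical in
/-- The positive `σ`-stable law, `0 < σ < 1`: the unique law with the above Laplace transform.
The value `0` is only a default; it is not a probability measure. -/
def stableLaw (σ : ℝ) : Measure ℝ :=
  if h : ∃ ν, IsPositiveStable σ ν then h.choose else 0

/-- The law of `Z_{σ,θ}`: the positive `σ`-stable law reweighted by the density `z ^ (-θ)` and
normalised to a probability measure. -/
def tiltedStableLaw (σ θ : ℝ) : Measure ℝ :=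
  (∫⁻ z, ENNReal.ofReal (z ^ (-θ)) ∂(stableLaw σ))⁻¹ •
    (stableLaw σ).withDensity (fun z => ENNReal.ofReal (z ^ (-θ)))

/-- The Mittag-Leffler law with parameter `σ`. -/
def mittagLeffler (σ : ℝ) : Measure ℝ :=
  powLaw (stableLaw σ) (-σ)

/-- The generalized Mittag-Leffler law `ML (σ, θ)`. -/
def genMittagLeffler (σ θ : ℝ) : Measure ℝ :=
  powLaw (tiltedStableLaw σ θ) (-σ)

/-- The law of the product of independent variables with laws `μ 0, …, μ (d - 1)`. -/
def prodLaw {d : ℕ} (μ : Fin d → Measure ℝ) : Measure ℝ :=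
  (Measure.pi μ).map (fun x => ∏ i, x i)

/-! ### The stick-breaking vector (coordinate `j` of the vector has index `j - 1` in `Fin r`) -/

/-- The vector `(ψ_j ∏_{i = j + 1}^r (1 - ψ_i))_{1 ≤ j ≤ r}`. -/
def stick {r : ℕ} (ψ : Fin r → ℝ) : Fin r → ℝ :=
  fun j => ψ j * ∏ i ∈ Finset.Ioi j, (1 - ψ i)

/-- The law of the stick-breaking vector for independent `Ψ_j ∼ Beta (1, t_j - 1)`, `1 ≤ j ≤ r`
(with `t_1 = 1`, so that `Ψ_1 = 1`). -/
def stickLaw (r : ℕ) (t : ℕ → ℕ) : Measure (Fin r → ℝ) :=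
  (Measure.pi (fun j : Fin r => betaLaw 1 ((t (j.val + 1) : ℝ) - 1))).map stick

/-- The law of `C • V` when the real variable `C ∼ μ` and the vector `V ∼ ν` are independent. -/
def scaleLaw {r : ℕ} (μ : Measure ℝ) (ν : Measure (Fin r → ℝ)) : Measure (Fin r → ℝ) :=
  (μ.prod ν).map (fun x => x.1 • x.2)

end YuleSimon

end

noncomputable section

namespace YuleSimon

open scoped ENNReal Nat

section

/-! ### Determination of measures by their moments -/

/-! For α = 0 an edge end that is not an arrival chooses vertex j with probability D_j(m) / m, where
m is the number of edge ends already present. Rising factorials are adapted to this rule: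
conditionally on all arrival times, the product of the rising factorials of the degrees of the first
r vertices, of total order q, grows in mean by the factor 1 + q / m at a step without arrival, and
stays fixed at an arrival later than T_r (`IsGraph.lintegral_risingDegree`).

Between the first r arrivals these factors are deterministic and telescope into Gamma quotients. At
time T_r the mixed factorial moment is therefore Γ(T_r + q) / Γ(T_r) times the mixed moment of the
stick-breaking vector (`arrivalMoment_succ`, `IsGraph.lintegral_risingDegree_arrival`). After T_r,
geometric gaps make every time an arrival independently with probability β
(`GeometricInterarrivals.lintegral_prod_arrival`), so the growth averages to the product of the
factors 1 + (1 - β) q / m, asymptotic to n ^ ((1 - β) q) Γ(T_r) / Γ(T_r + (1 - β) q). The limits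
thus have mixed moments `totalMellin` at q times the stick-breaking moments. The passage to the
limit rests on an L² bound: the square of such a product is at most the product with doubled orders.

Almost sure convergence comes from two nonnegative supermartingales: the degree divided by the
random growth product, and the growth product divided by its mean, a product of independent factors
of mean one. The mean itself is of exact order n ^ (1 - β).

The moments grow no faster than C K ^ p p!, so they determine the laws (`ext_of_moments`,
`ext_of_mixed_moments`). Every identity in law then reduces to an identity of Gamma quotients, once
the Mellin transform of each factor is known (`HasMellin`). The positive stable law is not assumed
to exist: given T_1 = 1 the limit ξ_1 has moments p! / Γ(1 + (1 - β) p), and ξ_1 ^ (-1 / (1 - β)) is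
stable. -/

theorem integrable_exp_mul_of_moment_bound {μ : Measure ℝ} {C K t : ℝ}
    (hμ : ∀ p : ℕ, ∫⁻ x, ENNReal.ofReal (|x| ^ p) ∂μ ≤ ENNReal.ofReal (C * K ^ p * p !))
    (hC : 0 ≤ C) (hK : 0 ≤ K) (ht : |t| * K < 1) :
    Integrable (fun x => Real.exp (t * x)) μ := by
  refine ⟨by fun_prop, ?_⟩
  -- The exponential series, integrated term by term, is dominated by the geometric series C ∑ (|t|
  -- K) ^ p, since the p! of the moment bound cancels the one of the series.
  have hexp : ∀ x : ℝ, ‖Real.exp (t * x)‖ₑ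
      ≤ ∑' p : ℕ, ENNReal.ofReal (|t| ^ p / p !) * ENNReal.ofReal (|x| ^ p) := by
    intro x
    have h1 : Real.exp |t * x| = ∑' p : ℕ, |t * x| ^ p / p ! := by
      rw [Real.exp_eq_exp_ℝ, NormedSpace.exp_eq_tsum_div]
    calc ‖Real.exp (t * x)‖ₑ = ENNReal.ofReal (Real.exp (t * x)) :=
          Real.enorm_of_nonneg (Real.exp_nonneg _)
      _ ≤ ENNReal.ofReal (Real.exp |t * x|) := by gcongr; exact le_abs_self _
      _ = ∑' p : ℕ, ENNReal.ofReal (|t * x| ^ p / p !) := by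
          rw [h1, ENNReal.ofReal_tsum_of_nonneg (fun _ => by positivity)
            (Real.summable_pow_div_factorial _)]
      _ = _ := by
          refine tsum_congr fun p => ?_
          rw [← ENNReal.ofReal_mul (by positivity), abs_mul, mul_pow]
          ring_nf
  have hs : Summable fun p : ℕ => C * (|t| * K) ^ p :=
    (summable_geometric_of_lt_one (by positivity) ht).mul_left C
  calc ∫⁻ x, ‖Real.exp (t * x)‖ₑ ∂μ
      ≤ ∫⁻ x, ∑' p : ℕ, ENNReal.ofReal (|t| ^ p / p !) * ENNReal.ofReal (|x| ^ p) ∂μ :=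
        lintegral_mono hexp
    _ = ∑' p : ℕ, ENNReal.ofReal (|t| ^ p / p !) * ∫⁻ x, ENNReal.ofReal (|x| ^ p) ∂μ := by
        rw [lintegral_tsum (fun _ => by fun_prop)]
        exact tsum_congr fun p => lintegral_const_mul _ (by fun_prop)
    _ ≤ ∑' p : ℕ, ENNReal.ofReal (C * (|t| * K) ^ p) := by
        refine ENNReal.tsum_le_tsum fun p => ?_
        calc _ ≤ ENNReal.ofReal (|t| ^ p / p !) * ENNReal.ofReal (C * K ^ p * p !) := by
              gcongr; exact hμ p
          _ = _ := by
              rw [← ENNReal.ofReal_mul (by positivity)]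
              congr 1
              have : (p ! : ℝ) ≠ 0 := by positivity
              field_simp
              ring
    _ = ENNReal.ofReal (∑' p : ℕ, C * (|t| * K) ^ p) := by
        rw [ENNReal.ofReal_tsum_of_nonneg (fun _ => by positivity) hs]
    _ < ⊤ := ENNReal.ofReal_lt_top

/-- Two probability measures on the line with the same moments coincide, if their absolute moments
grow at most like those of an exponential law. -/
theorem ext_of_moments {μ ν : Measure ℝ} [IsProbabilityMeasure μ] [IsProbabilityMeasure ν]
    {C K : ℝ} (hC : 0 ≤ C) (hK : 0 < K)
    (hμ : ∀ p : ℕ, ∫⁻ x, ENNReal.ofReal (|x| ^ p) ∂μ ≤ ENNReal.ofReal (C * K ^ p * p !))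
    (hν : ∀ p : ℕ, ∫⁻ x, ENNReal.ofReal (|x| ^ p) ∂ν ≤ ENNReal.ofReal (C * K ^ p * p !))
    (h : ∀ p : ℕ, ∫ x, x ^ p ∂μ = ∫ x, x ^ p ∂ν) : μ = ν := by
  -- On the strip |Re z| < 1 / K both complex moment generating functions are analytic. Their
  -- derivatives at 0 are the moments, so they agree near 0, hence on the strip by the identity
  -- theorem, in particular on the imaginary axis, where they are the characteristic functions.
  set S : Set ℝ := Set.Ioo (-K⁻¹) K⁻¹ with hS
  have hmem : ∀ t ∈ S, |t| * K < 1 := fun t ht => by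
    have h1 : |t| < K⁻¹ := abs_lt.2 ht
    calc |t| * K < K⁻¹ * K := by gcongr
      _ = 1 := inv_mul_cancel₀ hK.ne'
  have hSμ : S ⊆ interior (integrableExpSet id μ) := interior_maximal
    (fun t ht => integrable_exp_mul_of_moment_bound hμ hC hK.le (hmem t ht)) isOpen_Ioo
  have hSν : S ⊆ interior (integrableExpSet id ν) := interior_maximal
    (fun t ht => integrable_exp_mul_of_moment_bound hν hC hK.le (hmem t ht)) isOpen_Ioo
  have h0 : (0 : ℝ) ∈ S := by simp [hS, hK]
  have hp : ∀ n : ℕ, iteratedDeriv n (complexMGF id μ) 0 = iteratedDeriv n (complexMGF id ν) 0 := by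
    intro n
    rw [iteratedDeriv_complexMGF (by simpa using hSμ h0),
      iteratedDeriv_complexMGF (by simpa using hSν h0)]
    have key : ∀ ρ : Measure ℝ, ρ[fun ω : ℝ => ((id ω : ℝ) : ℂ) ^ n * Complex.exp (0 * (id ω : ℝ))]
        = ((∫ x, x ^ n ∂ρ : ℝ) : ℂ) := by
      intro ρ
      rw [← integral_complex_ofReal]
      simp
    rw [key, key, h n]
  have hev : complexMGF id μ =ᶠ[𝓝 0] complexMGF id ν := by
    have a1 := (analyticAt_complexMGF (X := id) (μ := μ) (z := 0)
      (by simpa using hSμ h0)).hasFPowerSeriesAt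
    have a2 := (analyticAt_complexMGF (X := id) (μ := ν) (z := 0)
      (by simpa using hSν h0)).hasFPowerSeriesAt
    simp only [hp] at a1
    filter_upwards [a1.eventually_hasSum_sub, a2.eventually_hasSum_sub] with z h1 h2
    exact h1.unique h2
  have hconn : IsPreconnected {z : ℂ | z.re ∈ S} :=
    ((convex_Ioo _ _).linear_preimage Complex.reLm).isPreconnected
  have heq : Set.EqOn (complexMGF id μ) (complexMGF id ν) {z : ℂ | z.re ∈ S} :=
    AnalyticOnNhd.eqOn_of_preconnected_of_eventuallyEq
      (fun z hz => analyticAt_complexMGF (hSμ hz)) (fun z hz => analyticAt_complexMGF (hSν hz))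
      hconn (z₀ := 0) (by simpa using h0) hev
  refine Measure.ext_of_charFun (funext fun t => ?_)
  rw [← complexMGF_id_mul_I, ← complexMGF_id_mul_I]
  exact heq (by simpa using h0)

/-- On the half-line absolute moments are moments, so the growth bound is needed for one of the two
laws only. -/
theorem ext_of_moments_of_nonneg {μ ν : Measure ℝ} [IsProbabilityMeasure μ]
    [IsProbabilityMeasure ν] {C K : ℝ} (hC : 0 ≤ C) (hK : 0 < K)
    (hμ0 : ∀ᵐ x ∂μ, 0 ≤ x) (hν0 : ∀ᵐ x ∂ν, 0 ≤ x)
    (hν : ∀ p : ℕ, ∫⁻ x, ENNReal.ofReal (x ^ p) ∂ν ≤ ENNReal.ofReal (C * K ^ p * p !))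
    (h : ∀ p : ℕ, ∫⁻ x, ENNReal.ofReal (x ^ p) ∂μ = ∫⁻ x, ENNReal.ofReal (x ^ p) ∂ν) : μ = ν := by
  have habs : ∀ ρ : Measure ℝ, (∀ᵐ x ∂ρ, 0 ≤ x) → ∀ p : ℕ,
      ∫⁻ x, ENNReal.ofReal (|x| ^ p) ∂ρ = ∫⁻ x, ENNReal.ofReal (x ^ p) ∂ρ := fun ρ hρ p =>
    lintegral_congr_ae (hρ.mono fun x hx => by simp only [abs_of_nonneg hx])
  refine ext_of_moments hC hK (fun p => ?_) (fun p => ?_) fun p => ?_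
  · rw [habs _ hμ0, h]; exact hν p
  · rw [habs _ hν0]; exact hν p
  · rw [integral_eq_lintegral_of_nonneg_ae (hμ0.mono fun x hx => pow_nonneg hx p) (by fun_prop),
      integral_eq_lintegral_of_nonneg_ae (hν0.mono fun x hx => pow_nonneg hx p) (by fun_prop), h]

/-- Two laws on the positive orthant with the same mixed moments coincide, if the moments of the
sum of the coordinates grow at most like those of an exponential law. -/
theorem ext_of_mixed_moments {r : ℕ} {μ ν : Measure (Fin r → ℝ)} [IsProbabilityMeasure μ]
    [IsProbabilityMeasure ν] {C K : ℝ} (hC : 0 ≤ C) (hK : 0 < K)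
    (hμ0 : ∀ᵐ x ∂μ, ∀ i, 0 ≤ x i) (hν0 : ∀ᵐ x ∂ν, ∀ i, 0 ≤ x i)
    (hν : ∀ q : ℕ, ∫⁻ x, ENNReal.ofReal ((∑ i, x i) ^ q) ∂ν ≤ ENNReal.ofReal (C * K ^ q * q !))
    (h : ∀ p : Fin r → ℕ, ∫⁻ x, ENNReal.ofReal (∏ i, x i ^ p i) ∂μ
      = ∫⁻ x, ENNReal.ofReal (∏ i, x i ^ p i) ∂ν) : μ = ν := by
  -- By the multinomial theorem the moments of the coordinate sum are combinations of mixed moments;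
  -- this transfers the growth bound from ν to μ.
  have hsum : ∀ ρ : Measure (Fin r → ℝ), (∀ᵐ x ∂ρ, ∀ i, 0 ≤ x i) → ∀ q : ℕ,
      ∫⁻ x, ENNReal.ofReal ((∑ i, x i) ^ q) ∂ρ
        = ∑ k ∈ Finset.univ.piAntidiag q, (Nat.multinomial Finset.univ k : ℝ≥0∞)
            * ∫⁻ x, ENNReal.ofReal (∏ i, x i ^ k i) ∂ρ := by
    intro ρ hρ q
    have hm : ∀ k : Fin r → ℕ, Measurable fun x : Fin r → ℝ => ENNReal.ofReal (∏ i, x i ^ k i) :=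
      fun k => by fun_prop
    simp_rw [← lintegral_const_mul _ (hm _)]
    rw [← lintegral_finsetSum _ (fun k _ => (hm k).const_mul _)]
    refine lintegral_congr_ae (hρ.mono fun x hx => ?_)
    simp only
    rw [Finset.sum_pow_eq_sum_piAntidiag, ENNReal.ofReal_sum_of_nonneg]
    · refine Finset.sum_congr rfl fun k _ => ?_
      rw [ENNReal.ofReal_mul (by positivity), ENNReal.ofReal_natCast]
    · intro k _
      have : 0 ≤ ∏ i, x i ^ k i := Finset.prod_nonneg fun i _ => pow_nonneg (hx i) _
      positivity
  have hμ : ∀ q : ℕ, ∫⁻ x, ENNReal.ofReal ((∑ i, x i) ^ q) ∂μ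
      ≤ ENNReal.ofReal (C * K ^ q * q !) := by
    intro q
    rw [hsum μ hμ0]
    simp_rw [h]
    rw [← hsum ν hν0]
    exact hν q
  have hint : ∀ ρ : Measure (Fin r → ℝ), (∀ᵐ x ∂ρ, ∀ i, 0 ≤ x i) →
      (∀ q : ℕ, ∫⁻ x, ENNReal.ofReal ((∑ i, x i) ^ q) ∂ρ ≤ ENNReal.ofReal (C * K ^ q * q !)) →
      ∀ k : Fin r → ℕ, Integrable (fun x : Fin r → ℝ => ∏ i, x i ^ k i) ρ := by
    intro ρ hρ hb k
    refine ⟨Measurable.aestronglyMeasurable (by fun_prop), lt_of_le_of_lt ?_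
      ((hb (∑ i, k i)).trans_lt ENNReal.ofReal_lt_top)⟩
    refine lintegral_mono_ae (hρ.mono fun x hx => ?_)
    rw [Real.enorm_of_nonneg (Finset.prod_nonneg fun i _ => pow_nonneg (hx i) _)]
    gcongr
    rw [← Finset.prod_pow_eq_pow_sum]
    refine Finset.prod_le_prod (fun i _ => pow_nonneg (hx i) _) fun i _ => ?_
    exact pow_le_pow_left₀ (hx i) (Finset.single_le_sum (fun j _ => hx j) (Finset.mem_univ i)) _
  -- Cramér–Wold: it suffices to compare the images under linear functionals, whose moments are
  -- again combinations of mixed moments. On the positive orthant |L x| ≤ A ∑ x i, so K is replaced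
  -- by A * K; the summand 1 in A keeps this positive when L = 0.
  have hL : ∀ L : StrongDual ℝ (Fin r → ℝ), μ.map L = ν.map L := by
    intro L
    set a : Fin r → ℝ := fun i => L (Pi.single i 1)
    set A : ℝ := ∑ i, |a i| + 1
    have hA : 0 < A := by positivity
    have hLa : ∀ x, L x = ∑ i, a i * x i := by
      intro x
      conv_lhs => rw [pi_eq_sum_univ' x]
      rw [map_sum]
      refine Finset.sum_congr rfl fun i _ => ?_
      rw [map_smul, smul_eq_mul, mul_comm]
    have hLm : Measurable L := L.continuous.measurable
    have hbd : ∀ ρ : Measure (Fin r → ℝ), (∀ᵐ x ∂ρ, ∀ i, 0 ≤ x i) →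
        (∀ q : ℕ, ∫⁻ x, ENNReal.ofReal ((∑ i, x i) ^ q) ∂ρ ≤ ENNReal.ofReal (C * K ^ q * q !)) →
        ∀ q : ℕ, ∫⁻ y, ENNReal.ofReal (|y| ^ q) ∂(ρ.map L)
          ≤ ENNReal.ofReal (C * (A * K) ^ q * q !) := by
      intro ρ hρ hb q
      rw [lintegral_map (by fun_prop) hLm]
      calc ∫⁻ x, ENNReal.ofReal (|L x| ^ q) ∂ρ
          ≤ ∫⁻ x, ENNReal.ofReal (A ^ q) * ENNReal.ofReal ((∑ i, x i) ^ q) ∂ρ := by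
            refine lintegral_mono_ae (hρ.mono fun x hx => ?_)
            rw [← ENNReal.ofReal_mul (by positivity), ← mul_pow]
            gcongr
            rw [hLa, Finset.mul_sum]
            refine (Finset.abs_sum_le_sum_abs _ _).trans (Finset.sum_le_sum fun i _ => ?_)
            rw [abs_mul, abs_of_nonneg (hx i)]
            refine mul_le_mul_of_nonneg_right ?_ (hx i)
            have := Finset.single_le_sum (f := fun i => |a i|) (fun j _ => abs_nonneg _)
              (Finset.mem_univ i)
            simp only [A]
            linarith
        _ = ENNReal.ofReal (A ^ q) * ∫⁻ x, ENNReal.ofReal ((∑ i, x i) ^ q) ∂ρ :=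
            lintegral_const_mul _ (by fun_prop)
        _ ≤ ENNReal.ofReal (A ^ q) * ENNReal.ofReal (C * K ^ q * q !) := by gcongr; exact hb q
        _ = _ := by
            rw [← ENNReal.ofReal_mul (by positivity)]
            ring_nf
    have hmom : ∀ ρ : Measure (Fin r → ℝ), (∀ᵐ x ∂ρ, ∀ i, 0 ≤ x i) →
        (∀ q : ℕ, ∫⁻ x, ENNReal.ofReal ((∑ i, x i) ^ q) ∂ρ ≤ ENNReal.ofReal (C * K ^ q * q !)) →
        ∀ q : ℕ, ∫ y, y ^ q ∂(ρ.map L) = ∑ k ∈ Finset.univ.piAntidiag q,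
          (Nat.multinomial Finset.univ k * ∏ i, a i ^ k i)
            * (∫⁻ x, ENNReal.ofReal (∏ i, x i ^ k i) ∂ρ).toReal := by
      intro ρ hρ hb q
      rw [integral_map hLm.aemeasurable (by fun_prop)]
      have : ∀ x, L x ^ q = ∑ k ∈ Finset.univ.piAntidiag q,
          (Nat.multinomial Finset.univ k * ∏ i, a i ^ k i) * ∏ i, x i ^ k i := by
        intro x
        rw [hLa, Finset.sum_pow_eq_sum_piAntidiag]
        refine Finset.sum_congr rfl fun k _ => ?_
        simp_rw [mul_pow, Finset.prod_mul_distrib, mul_assoc]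
      simp_rw [this]
      rw [integral_finsetSum _ fun k _ => (hint ρ hρ hb k).const_mul _]
      refine Finset.sum_congr rfl fun k _ => ?_
      rw [integral_const_mul, integral_eq_lintegral_of_nonneg_ae
        (hρ.mono fun x hx => Finset.prod_nonneg fun i _ => pow_nonneg (hx i) _)
        (Measurable.aestronglyMeasurable (by fun_prop))]
    have := Measure.isProbabilityMeasure_map (μ := μ) hLm.aemeasurable
    have := Measure.isProbabilityMeasure_map (μ := ν) hLm.aemeasurable
    refine ext_of_moments hC (mul_pos hA hK) (hbd μ hμ0 hμ) (hbd ν hν0 hν) fun q => ?_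
    rw [hmom μ hμ0 hμ, hmom ν hν0 hν]
    simp_rw [h]
  refine Measure.ext_of_charFunDual (funext fun L => ?_)
  rw [charFunDual_eq_charFun_map_one, charFunDual_eq_charFun_map_one, hL]

end

section

/-! ### Mellin transforms of laws on the half-line -/

/-- The probability law `μ` on `[0, ∞)` has real moments `∫ x ^ s ∂μ = m s`, `s ≥ 0`. -/
structure HasMellin (μ : Measure ℝ) (m : ℝ → ℝ) : Prop where
  prob : IsProbabilityMeasure μ
  ae_nonneg : ∀ᵐ x ∂μ, 0 ≤ x
  nonneg : ∀ s, 0 ≤ s → 0 ≤ m s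
  moment : ∀ s, 0 ≤ s → ∫⁻ x, ENNReal.ofReal (x ^ s) ∂μ = ENNReal.ofReal (m s)

namespace HasMellin

variable {μ ν : Measure ℝ} {m m' : ℝ → ℝ}

theorem congr (h : HasMellin μ m) (hm : ∀ s, 0 ≤ s → m s = m' s) : HasMellin μ m' where
  prob := h.prob
  ae_nonneg := h.ae_nonneg
  nonneg s hs := hm s hs ▸ h.nonneg s hs
  moment s hs := hm s hs ▸ h.moment s hs

theorem moment_nat (h : HasMellin μ m) (p : ℕ) :
    ∫⁻ x, ENNReal.ofReal (x ^ p) ∂μ = ENNReal.ofReal (m p) := by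
  rw [← h.moment p p.cast_nonneg]
  simp

/-- Moments of natural order decide. Real orders are carried along because `powLaw` evaluates m at p
* s, which need not be natural when s is. -/
theorem ext (h : HasMellin μ m) (h' : HasMellin ν m') {C K : ℝ} (hC : 0 ≤ C) (hK : 0 < K)
    (hb : ∀ p : ℕ, m' p ≤ C * K ^ p * p !) (hm : ∀ p : ℕ, m p = m' p) : μ = ν := by
  have := h.prob
  have := h'.prob
  refine ext_of_moments_of_nonneg hC hK h.ae_nonneg h'.ae_nonneg (fun p => ?_) fun p => ?_
  · rw [h'.moment_nat]
    exact ENNReal.ofReal_le_ofReal (hb p)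
  · rw [h.moment_nat, h'.moment_nat, hm]

theorem powLaw (h : HasMellin μ m) {p : ℝ} (hp : 0 ≤ p) :
    HasMellin (powLaw μ p) (fun s => m (p * s)) where
  prob := by
    have := h.prob
    exact Measure.isProbabilityMeasure_map (by fun_prop)
  ae_nonneg := by
    rw [YuleSimon.powLaw, ae_map_iff (by fun_prop) measurableSet_Ici]
    exact h.ae_nonneg.mono fun x hx => Real.rpow_nonneg hx p
  nonneg s hs := h.nonneg _ (mul_nonneg hp hs)
  moment s hs := by
    rw [YuleSimon.powLaw, lintegral_map (by fun_prop) (by fun_prop), ← h.moment _ (by positivity)]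
    refine lintegral_congr_ae (h.ae_nonneg.mono fun x hx => ?_)
    simp only [Real.rpow_mul hx]

theorem mconv (h : HasMellin μ m) (h' : HasMellin ν m') :
    HasMellin (μ ∗ₘ ν) (fun s => m s * m' s) := by
  have := h.prob
  have := h'.prob
  have h1 : ∀ᵐ z ∂(μ.prod ν), 0 ≤ z.1 := Measure.quasiMeasurePreserving_fst.ae h.ae_nonneg
  have h2 : ∀ᵐ z ∂(μ.prod ν), 0 ≤ z.2 := Measure.quasiMeasurePreserving_snd.ae h'.ae_nonneg
  refine ⟨inferInstance, ?_, fun s hs => mul_nonneg (h.nonneg s hs) (h'.nonneg s hs),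
    fun s hs => ?_⟩
  · rw [Measure.mconv, ae_map_iff (by fun_prop) measurableSet_Ici]
    filter_upwards [h1, h2] with z hz1 hz2 using mul_nonneg hz1 hz2
  · rw [Measure.mconv, lintegral_map (by fun_prop) (by fun_prop),
      ENNReal.ofReal_mul (h.nonneg s hs), ← h.moment s hs, ← h'.moment s hs,
      ← lintegral_prod_mul (by fun_prop) (by fun_prop)]
    refine lintegral_congr_ae ?_
    filter_upwards [h1, h2] with z hz1 hz2
    rw [Real.mul_rpow hz1 hz2, ENNReal.ofReal_mul (Real.rpow_nonneg hz1 s)]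

theorem dirac_one : HasMellin (Measure.dirac 1) (fun _ => 1) where
  prob := inferInstance
  ae_nonneg := by simp
  nonneg _ _ := zero_le_one
  moment s _ := by
    rw [lintegral_dirac' _ (by fun_prop)]
    simp

end HasMellin

/-- Tilting the Gamma (a, 1) density by x ^ s gives the Gamma (a + s, 1) density up to a constant.
Densities have integral one, so that constant is the moment. -/
theorem hasMellin_gammaLaw {a : ℝ} (ha : 0 < a) :
    HasMellin (gammaLaw a) (fun s => Real.Gamma (a + s) / Real.Gamma a) where
  prob := isProbabilityMeasure_gammaMeasure ha one_pos
  ae_nonneg := by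
    rw [gammaLaw, gammaMeasure, ae_withDensity_iff (by unfold gammaPDF; fun_prop)]
    refine Eventually.of_forall fun x hx => ?_
    by_contra h
    exact hx (gammaPDF_of_neg (not_le.1 h))
  nonneg s hs := div_nonneg (Real.Gamma_nonneg_of_nonneg (by positivity))
    (Real.Gamma_nonneg_of_nonneg ha.le)
  moment s hs := by
    have hm : ∀ b, Measurable (gammaPDF b 1) := fun b => by unfold gammaPDF; fun_prop
    rw [gammaLaw, gammaMeasure, lintegral_withDensity_eq_lintegral_mul _ (hm a) (by fun_prop)]
    have hint := lintegral_gammaPDF_eq_one (a := a + s) (r := 1) (by positivity) one_pos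
    rw [← mul_one (ENNReal.ofReal _), ← hint, ← lintegral_const_mul _ (hm _)]
    refine lintegral_congr_ae ?_
    filter_upwards [Measure.ae_ne volume (0 : ℝ)] with x hx0
    rw [Pi.mul_apply]
    rcases lt_or_gt_of_ne hx0 with hx | hx
    · rw [gammaPDF_of_neg hx, gammaPDF_of_neg hx]
      simp
    · rw [gammaPDF_of_nonneg hx.le, gammaPDF_of_nonneg hx.le]
      have h1 := Real.Gamma_pos_of_pos ha
      have h2 := Real.Gamma_pos_of_pos (add_pos_of_pos_of_nonneg ha hs)
      rw [← ENNReal.ofReal_mul (by positivity), ← ENNReal.ofReal_mul (by positivity)]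
      congr 1
      rw [show a + s - 1 = (a - 1) + s by ring, Real.rpow_add hx]
      simp only [Real.one_rpow]
      field_simp

/-- The same tilting argument for beta densities. The second exponent u serves the factors 1 - Ψ in
the mixed moments of the stick-breaking vector. -/
theorem lintegral_betaMeasure {a b s u : ℝ} (ha : 0 < a) (hb : 0 < b) (hs : 0 ≤ s) (hu : 0 ≤ u) :
    ∫⁻ x, ENNReal.ofReal (x ^ s * (1 - x) ^ u) ∂(betaMeasure a b)
      = ENNReal.ofReal (beta (a + s) (b + u) / beta a b) := by
  have hm : ∀ c d, Measurable (betaPDF c d) := fun c d => by unfold betaPDF; fun_prop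
  rw [betaMeasure, lintegral_withDensity_eq_lintegral_mul _ (hm a b) (by fun_prop)]
  have hint := lintegral_betaPDF_eq_one (α := a + s) (β := b + u) (by positivity) (by positivity)
  rw [← mul_one (ENNReal.ofReal _), ← hint, ← lintegral_const_mul _ (hm _ _)]
  refine lintegral_congr fun x => ?_
  rw [Pi.mul_apply]
  rcases le_or_gt x 0 with hx | hx
  · simp [betaPDF_eq_zero_of_nonpos hx]
  rcases le_or_gt 1 x with hx1 | hx1
  · simp [betaPDF_eq_zero_of_one_le hx1]
  have h1 := beta_pos ha hb
  have h2 := beta_pos (add_pos_of_pos_of_nonneg ha hs) (add_pos_of_pos_of_nonneg hb hu)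
  have h3 : 0 < 1 - x := sub_pos.2 hx1
  rw [betaPDF_of_pos_lt_one hx hx1, betaPDF_of_pos_lt_one hx hx1,
    ← ENNReal.ofReal_mul (by positivity), ← ENNReal.ofReal_mul (by positivity)]
  congr 1
  rw [show a + s - 1 = (a - 1) + s by ring, Real.rpow_add hx,
    show b + u - 1 = (b - 1) + u by ring, Real.rpow_add h3]
  field_simp

theorem ae_betaLaw_mem {a b : ℝ} : ∀ᵐ x ∂(betaLaw a b), 0 ≤ x ∧ x ≤ 1 := by
  unfold betaLaw
  split_ifs with hb
  · rw [ae_dirac_iff (measurableSet_Icc (a := (0 : ℝ)) (b := 1))]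
    simp
  · rw [betaMeasure, ae_withDensity_iff (by unfold betaPDF; fun_prop)]
    refine Eventually.of_forall fun x hx => ⟨?_, ?_⟩
    · by_contra h
      exact hx (betaPDF_eq_zero_of_nonpos (not_le.1 h).le)
    · by_contra h
      exact hx (betaPDF_eq_zero_of_one_le (not_le.1 h).le)

theorem isProbabilityMeasure_betaLaw {a b : ℝ} (ha : 0 < a) (hb : 0 ≤ b) :
    IsProbabilityMeasure (betaLaw a b) := by
  unfold betaLaw
  split_ifs with h
  · infer_instance
  · exact isProbabilityMeasureBeta ha (lt_of_le_of_ne hb (Ne.symm h))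

/-- The Mellin transform of the `Beta (a, b)` law. -/
def betaMellin (a b s : ℝ) : ℝ :=
  Real.Gamma (a + s) * Real.Gamma (a + b) / (Real.Gamma a * Real.Gamma (a + b + s))

theorem hasMellin_betaLaw {a b : ℝ} (ha : 0 < a) (hb : 0 ≤ b) :
    HasMellin (betaLaw a b) (betaMellin a b) where
  prob := isProbabilityMeasure_betaLaw ha hb
  ae_nonneg := ae_betaLaw_mem.mono fun _ h => h.1
  nonneg s hs := div_nonneg
    (mul_nonneg (Real.Gamma_nonneg_of_nonneg (by positivity))
      (Real.Gamma_nonneg_of_nonneg (by positivity)))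
    (mul_nonneg (Real.Gamma_nonneg_of_nonneg (by positivity))
      (Real.Gamma_nonneg_of_nonneg (by positivity)))
  moment s hs := by
    have h1 := Real.Gamma_pos_of_pos ha
    have h2 := Real.Gamma_pos_of_pos (add_pos_of_pos_of_nonneg ha hs)
    have h3 := Real.Gamma_pos_of_pos (add_pos_of_pos_of_nonneg ha hb)
    -- At b = 0 the Gamma quotient cancels to 1, which is the moment of the point mass.
    rcases hb.eq_or_lt with rfl | hb
    · rw [betaLaw, if_pos rfl, HasMellin.dirac_one.moment s hs, betaMellin, add_zero]
      field_simp
    · rw [betaLaw, if_neg hb.ne']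
      have := lintegral_betaMeasure ha hb hs le_rfl
      simp only [Real.rpow_zero, mul_one, add_zero] at this
      rw [this, betaMellin, beta, beta, show a + s + b = a + b + s by ring]
      have h4 := Real.Gamma_pos_of_pos hb
      have h5 := Real.Gamma_pos_of_pos (add_pos_of_pos_of_nonneg (add_pos ha hb) hs)
      congr 1
      field_simp

/-- Ensures that multiplication by an independent beta variable preserves the growth bound on
moments. -/
theorem betaMellin_le_one {a b s : ℝ} (ha : 0 < a) (hb : 0 ≤ b) (hs : 0 ≤ s) :
    betaMellin a b s ≤ 1 := by
  have h := hasMellin_betaLaw ha hb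
  have := h.prob
  have h1 : ENNReal.ofReal (betaMellin a b s) ≤ 1 := by
    rw [← h.moment s hs]
    calc _ ≤ ∫⁻ _, 1 ∂(betaLaw a b) := lintegral_mono_ae (ae_betaLaw_mem.mono fun x hx => by
            rw [← ENNReal.ofReal_one]
            exact ENNReal.ofReal_le_ofReal (Real.rpow_le_one hx.1 hx.2 hs))
      _ = 1 := by simp
  simpa using h1

theorem lintegral_pi_prod {d : ℕ} (μ : Fin d → Measure ℝ) [∀ i, SigmaFinite (μ i)]
    {f : Fin d → ℝ → ℝ≥0∞} (hf : ∀ i, Measurable (f i)) :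
    ∫⁻ x, ∏ i, f i (x i) ∂(Measure.pi μ) = ∏ i, ∫⁻ x, f i x ∂(μ i) := by
  induction d with
  | zero => simp
  | succ d ih =>
    have hmp := (measurePreserving_piFinSuccAbove μ 0).symm
    rw [← hmp.lintegral_comp_emb (MeasurableEquiv.measurableEmbedding _)]
    simp only [MeasurableEquiv.piFinSuccAbove_symm_apply, Fin.insertNthEquiv, Fin.prod_univ_succ,
      Fin.insertNth_zero', Fin.zero_succAbove, Equiv.coe_fn_mk, Fin.cons_succ, Fin.cons_zero]
    rw [← ih (fun i : Fin d => μ i.succ) (fun i : Fin d => hf i.succ)]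
    exact lintegral_prod_mul (hf 0).aemeasurable
      (Finset.measurable_fun_prod _ fun (i : Fin d) _ =>
        (hf i.succ).comp (measurable_pi_apply i)).aemeasurable

theorem hasMellin_prodLaw {d : ℕ} {μ : Fin d → Measure ℝ} {m : Fin d → ℝ → ℝ}
    (h : ∀ i, HasMellin (μ i) (m i)) : HasMellin (prodLaw μ) (fun s => ∏ i, m i s) := by
  have := fun i => (h i).prob
  have h0 : ∀ᵐ x ∂(Measure.pi μ), ∀ i, 0 ≤ x i := by
    rw [ae_all_iff]
    exact fun i => (Measure.quasiMeasurePreserving_eval (μ := μ) i).ae (h i).ae_nonneg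
  refine ⟨Measure.isProbabilityMeasure_map (by fun_prop), ?_,
    fun s hs => Finset.prod_nonneg fun i _ => (h i).nonneg s hs, fun s hs => ?_⟩
  · rw [prodLaw, ae_map_iff (by fun_prop) measurableSet_Ici]
    exact h0.mono fun x hx => Finset.prod_nonneg fun i _ => hx i
  · rw [prodLaw, lintegral_map (by fun_prop) (by fun_prop),
      ENNReal.ofReal_prod_of_nonneg fun i _ => (h i).nonneg s hs]
    simp_rw [← fun i => (h i).moment s hs]
    rw [← lintegral_pi_prod μ (fun _ => by fun_prop)]
    refine lintegral_congr_ae (h0.mono fun x hx => ?_)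
    simp only
    rw [← Real.finsetProd_rpow _ _ fun i _ => hx i,
      ENNReal.ofReal_prod_of_nonneg fun i _ => Real.rpow_nonneg (hx i) s]

end

section

/-! ### The positive stable law -/

/-- Writes a negative power as a mixture of exponentials, so that a Laplace transform yields
negative moments. -/
theorem lintegral_rpow_mul_exp_neg_mul {s z : ℝ} (hs : 0 < s) (hz : 0 < z) :
    ∫⁻ l in Set.Ioi (0 : ℝ), ENNReal.ofReal (l ^ (s - 1) * Real.exp (-(l * z)))
      = ENNReal.ofReal (Real.Gamma s) * ENNReal.ofReal (z ^ (-s)) := by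
  have h := Real.integral_rpow_mul_exp_neg_mul_Ioi hs hz
  have hG := Real.Gamma_pos_of_pos hs
  rw [← ENNReal.ofReal_mul hG.le, Real.rpow_neg hz.le, ← Real.inv_rpow hz.le, ← one_div, mul_comm,
    ← h]
  simp_rw [mul_comm z]
  simp_rw [mul_comm z] at h
  rw [ofReal_integral_eq_lintegral_ofReal]
  · refine Integrable.of_integral_ne_zero ?_
    rw [h]
    positivity
  · refine (ae_restrict_mem measurableSet_Ioi).mono fun x hx => ?_
    have : (0 : ℝ) < x := hx
    positivity

theorem lintegral_rpow_mul_exp_neg_rpow {s σ : ℝ} (hs : 0 < s) (hσ : 0 < σ) :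
    ∫⁻ l in Set.Ioi (0 : ℝ), ENNReal.ofReal (l ^ (s - 1) * Real.exp (-(l ^ σ)))
      = ENNReal.ofReal (Real.Gamma (s / σ) / σ) := by
  have h := integral_rpow_mul_exp_neg_rpow (p := σ) (q := s - 1) hσ (by linarith)
  have hG := Real.Gamma_pos_of_pos (div_pos hs hσ)
  rw [sub_add_cancel, one_div_mul_eq_div] at h
  rw [← h, ofReal_integral_eq_lintegral_ofReal]
  · refine Integrable.of_integral_ne_zero ?_
    rw [h]
    positivity
  · refine (ae_restrict_mem measurableSet_Ioi).mono fun x hx => ?_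
    have : (0 : ℝ) < x := hx
    positivity

/-- The moment of order `-s` of the positive `σ`-stable law. -/
def stableMellin (σ s : ℝ) : ℝ := Real.Gamma (s / σ + 1) / Real.Gamma (s + 1)

theorem stableMellin_pos {σ s : ℝ} (hσ : 0 < σ) (hs : 0 ≤ s) : 0 < stableMellin σ s :=
  div_pos (Real.Gamma_pos_of_pos (by positivity)) (Real.Gamma_pos_of_pos (by positivity))

/-- Integrating the mixture representation of z ^ (-s) against ν and swapping the integrals produces
the Laplace transform inside, leaving the integral of l ^ (s - 1) exp(-l ^ σ), which is Γ(s / σ) /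
σ. The order s = 0 is separate because the representation needs s > 0. -/
theorem IsPositiveStable.lintegral_rpow_neg {σ s : ℝ} {ν : Measure ℝ} (h : IsPositiveStable σ ν)
    (hσ : 0 < σ) (hs : 0 ≤ s) :
    ∫⁻ z, ENNReal.ofReal (z ^ (-s)) ∂ν = ENNReal.ofReal (stableMellin σ s) := by
  have := h.prob
  rcases hs.eq_or_lt with rfl | hs
  · simp [stableMellin]
  have hG := Real.Gamma_pos_of_pos hs
  have hG0 : ENNReal.ofReal (Real.Gamma s) ≠ 0 := by simpa using hG
  have key : ENNReal.ofReal (Real.Gamma s) * ∫⁻ z, ENNReal.ofReal (z ^ (-s)) ∂ν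
      = ENNReal.ofReal (Real.Gamma (s / σ) / σ) := by
    rw [← lintegral_const_mul _ (by fun_prop), ← lintegral_rpow_mul_exp_neg_rpow hs hσ]
    calc ∫⁻ z, ENNReal.ofReal (Real.Gamma s) * ENNReal.ofReal (z ^ (-s)) ∂ν
        = ∫⁻ z, (∫⁻ l in Set.Ioi (0 : ℝ), ENNReal.ofReal (l ^ (s - 1) * Real.exp (-(l * z)))) ∂ν :=
          lintegral_congr_ae (h.pos.mono fun z hz =>
            (lintegral_rpow_mul_exp_neg_mul hs hz).symm)
      _ = ∫⁻ l in Set.Ioi (0 : ℝ), (∫⁻ z, ENNReal.ofReal (l ^ (s - 1) * Real.exp (-(l * z))) ∂ν) :=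
          lintegral_lintegral_swap (Measurable.aemeasurable (by fun_prop))
      _ = _ := by
          refine setLIntegral_congr_fun measurableSet_Ioi fun l hl => ?_
          have hl : (0 : ℝ) < l := hl
          have hint : Integrable (fun z => Real.exp (-(l * z))) ν :=
            (integrable_const (1 : ℝ)).mono' (by fun_prop) (h.pos.mono fun z hz => by
              rw [Real.norm_of_nonneg (Real.exp_nonneg _), Real.exp_le_one_iff]
              have := mul_pos hl hz
              linarith)
          simp_rw [ENNReal.ofReal_mul (Real.rpow_nonneg hl.le (s - 1))]
          rw [lintegral_const_mul _ (by fun_prop), ← ofReal_integral_eq_lintegral_ofReal hint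
            (Eventually.of_forall fun z => Real.exp_nonneg _), h.laplace l hl.le]
  rw [← ENNReal.mul_right_inj hG0 ENNReal.ofReal_ne_top, key, ← ENNReal.ofReal_mul hG.le,
    stableMellin, Real.Gamma_add_one hs.ne', Real.Gamma_add_one (div_pos hs hσ).ne']
  congr 1
  field_simp

theorem isPositiveStable_stableLaw {σ : ℝ} (h : ∃ ν, IsPositiveStable σ ν) :
    IsPositiveStable σ (stableLaw σ) := by
  rw [stableLaw, dif_pos h]
  exact h.choose_spec

/-- The tilt by z ^ (-θ) and the power -σ turn the moment of order s into the stable moment of order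
-(θ + σ s), normalised by the one of order -θ. Existence of a stable law is required because
`stableLaw` is 0 otherwise. -/
theorem hasMellin_genMittagLeffler {σ θ : ℝ} (hσ : 0 < σ) (hθ : 0 ≤ θ)
    (h : ∃ ν, IsPositiveStable σ ν) :
    HasMellin (genMittagLeffler σ θ)
      (fun s => stableMellin σ (θ + σ * s) / stableMellin σ θ) := by
  have hs := isPositiveStable_stableLaw h
  have := hs.prob
  have hpos := stableMellin_pos hσ hθ
  have hint : ∀ f : ℝ → ℝ≥0∞, Measurable f → ∫⁻ z, f z ∂(tiltedStableLaw σ θ)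
      = (ENNReal.ofReal (stableMellin σ θ))⁻¹
        * ∫⁻ z, ENNReal.ofReal (z ^ (-θ)) * f z ∂(stableLaw σ) := by
    intro f hf
    rw [tiltedStableLaw, lintegral_smul_measure, hs.lintegral_rpow_neg hσ hθ, smul_eq_mul,
      lintegral_withDensity_eq_lintegral_mul _ (by fun_prop) hf]
    rfl
  have hprob : IsProbabilityMeasure (tiltedStableLaw σ θ) := by
    constructor
    rw [← lintegral_one, hint _ measurable_const]
    simp_rw [mul_one]
    rw [hs.lintegral_rpow_neg hσ hθ]
    exact ENNReal.inv_mul_cancel (by simpa using hpos) ENNReal.ofReal_ne_top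
  have hpos' : ∀ᵐ z ∂(tiltedStableLaw σ θ), 0 < z := by
    refine Measure.ae_smul_measure ?_ _
    exact (withDensity_absolutelyContinuous _ _).ae_le hs.pos
  refine ⟨Measure.isProbabilityMeasure_map (by fun_prop), ?_,
    fun s hs => div_nonneg (stableMellin_pos hσ (by positivity)).le hpos.le, fun s hs' => ?_⟩
  · rw [genMittagLeffler, powLaw, ae_map_iff (by fun_prop) measurableSet_Ici]
    exact hpos'.mono fun z hz => Real.rpow_nonneg hz.le _
  · rw [genMittagLeffler, powLaw, lintegral_map (by fun_prop) (by fun_prop),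
      hint _ (by fun_prop), ENNReal.ofReal_div_of_pos hpos, ENNReal.div_eq_inv_mul,
      ← hs.lintegral_rpow_neg hσ (s := θ + σ * s) (by positivity)]
    congr 1
    refine lintegral_congr_ae (hs.pos.mono fun z hz => ?_)
    simp only
    rw [← ENNReal.ofReal_mul (by positivity), ← Real.rpow_mul hz.le, ← Real.rpow_add hz]
    ring_nf

theorem mittagLeffler_eq {σ : ℝ} (h : ∃ ν, IsPositiveStable σ ν) :
    mittagLeffler σ = genMittagLeffler σ 0 := by
  have := (isPositiveStable_stableLaw h).prob
  simp [mittagLeffler, genMittagLeffler, tiltedStableLaw]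

/-- A version of `HasMellin.mconv` for laws of which only the natural moments are known. -/
theorem lintegral_pow_mconv {μ ν : Measure ℝ} [SFinite μ] [SFinite ν] (hμ : ∀ᵐ x ∂μ, 0 ≤ x)
    (p : ℕ) :
    ∫⁻ x, ENNReal.ofReal (x ^ p) ∂(μ ∗ₘ ν)
      = (∫⁻ x, ENNReal.ofReal (x ^ p) ∂μ) * ∫⁻ x, ENNReal.ofReal (x ^ p) ∂ν := by
  rw [Measure.mconv, lintegral_map (by fun_prop) (by fun_prop),
    ← lintegral_prod_mul (by fun_prop) (by fun_prop)]
  have h1 : ∀ᵐ z ∂(μ.prod ν), 0 ≤ z.1 := Measure.quasiMeasurePreserving_fst.ae hμ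
  refine lintegral_congr_ae (h1.mono fun z hz => ?_)
  simp only
  rw [mul_pow, ENNReal.ofReal_mul (pow_nonneg hz p)]

theorem gammaLaw_one_Ioi {u : ℝ} (hu : 0 ≤ u) :
    gammaLaw 1 (Set.Ioi u) = ENNReal.ofReal (Real.exp (-u)) := by
  have := (hasMellin_gammaLaw one_pos).prob
  have : IsProbabilityMeasure (expMeasure 1) := this
  have h := cdf_expMeasure_eq one_pos u
  rw [cdf_eq_real, if_pos hu, one_mul] at h
  change (gammaLaw 1).real _ = _ at h
  rw [← Set.compl_Iic, ← ofReal_measureReal, probReal_compl_eq_one_sub measurableSet_Iic, h]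
  ring_nf

/-- The law with moments `p! / Γ (1 + σ p)` is that of `Z ^ (-σ)` for a positive `σ`-stable `Z`. -/
theorem exists_isPositiveStable {σ : ℝ} (hσ : 0 < σ) {μ : Measure ℝ} [IsProbabilityMeasure μ]
    (hμ0 : ∀ᵐ x ∂μ, 0 ≤ x)
    (hμ : ∀ p : ℕ, ∫⁻ x, ENNReal.ofReal (x ^ p) ∂μ
      = ENNReal.ofReal (p ! / Real.Gamma (1 + σ * p))) :
    ∃ ν, IsPositiveStable σ ν := by
  have hE := hasMellin_gammaLaw one_pos
  have hEσ := hE.powLaw hσ.le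
  have := hE.prob
  have := hEσ.prob
  -- For E exponential and X ∼ μ independent, E ^ σ X has moments Γ(1 + σ p) · p! / Γ(1 + σ p) = p!,
  -- so it is again exponential.
  have hconv : powLaw (gammaLaw 1) σ ∗ₘ μ = gammaLaw 1 := by
    refine ext_of_moments_of_nonneg (C := 1) (K := 1) zero_le_one one_pos ?_ hE.ae_nonneg
      (fun p => ?_) fun p => ?_
    · rw [Measure.mconv, ae_map_iff (by fun_prop) measurableSet_Ici]
      have h1 : ∀ᵐ z ∂((powLaw (gammaLaw 1) σ).prod μ), 0 ≤ z.1 :=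
        Measure.quasiMeasurePreserving_fst.ae hEσ.ae_nonneg
      have h2 : ∀ᵐ z ∂((powLaw (gammaLaw 1) σ).prod μ), 0 ≤ z.2 :=
        Measure.quasiMeasurePreserving_snd.ae hμ0
      filter_upwards [h1, h2] with z hz1 hz2 using mul_nonneg hz1 hz2
    · rw [hE.moment_nat, add_comm, Real.Gamma_nat_eq_factorial]
      simp
    · rw [lintegral_pow_mconv hEσ.ae_nonneg, hEσ.moment_nat, hμ, hE.moment_nat,
        ← ENNReal.ofReal_mul (hEσ.nonneg _ p.cast_nonneg), add_comm (1 : ℝ) p,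
        Real.Gamma_nat_eq_factorial]
      have := Real.Gamma_pos_of_pos (show 0 < 1 + σ * p by positivity)
      congr 1
      simp only [Real.Gamma_one]
      field_simp
  -- An atom of μ at 0 would give the exponential law an atom at 0.
  have hpos : ∀ᵐ x ∂μ, 0 < x := by
    have h1 : ∀ᵐ x ∂(gammaLaw 1), x ≠ 0 :=
      (withDensity_absolutelyContinuous _ _).ae_le (Measure.ae_ne volume (0 : ℝ))
    rw [← hconv, Measure.mconv] at h1
    replace h1 := ae_of_ae_map (by fun_prop) h1
    obtain ⟨y, hy⟩ := (Measure.ae_ae_of_ae_prod h1).exists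
    filter_upwards [hy, hμ0] with x hx hx0
    exact lt_of_le_of_ne hx0 (right_ne_zero_of_mul hx).symm
  have hm : Measurable fun x : ℝ => x ^ (-σ⁻¹) := by fun_prop
  refine ⟨μ.map fun x => x ^ (-σ⁻¹), Measure.isProbabilityMeasure_map hm.aemeasurable, ?_, ?_⟩
  · rw [ae_map_iff hm.aemeasurable measurableSet_Ioi]
    exact hpos.mono fun x hx => Real.rpow_pos_of_pos hx _
  · intro s hs
    rw [integral_map hm.aemeasurable (by fun_prop),
      integral_eq_lintegral_of_nonneg_ae (Eventually.of_forall fun _ => Real.exp_nonneg _)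
        (by fun_prop)]
    have hsσ : 0 ≤ s ^ σ := Real.rpow_nonneg hs σ
    -- With Z = X ^ (-1 / σ), the Laplace transform at s is ℙ[E > s Z] = ℙ[E ^ σ X > s ^ σ] = exp(-s
    -- ^ σ), the last step because E ^ σ X is exponential.
    have key : ∫⁻ x, ENNReal.ofReal (Real.exp (-(s * x ^ (-σ⁻¹)))) ∂μ
        = ENNReal.ofReal (Real.exp (-(s ^ σ))) := by
      rw [← gammaLaw_one_Ioi hsσ]
      conv_rhs => rw [← hconv]
      rw [Measure.mconv_comm, Measure.mconv, Measure.map_apply (by fun_prop) measurableSet_Ioi,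
        Measure.prod_apply (by measurability)]
      refine lintegral_congr_ae (hpos.mono fun x hx => ?_)
      simp only
      have hx' : 0 < x ^ (-σ⁻¹) := Real.rpow_pos_of_pos hx _
      rw [← gammaLaw_one_Ioi (by positivity), powLaw,
        Measure.map_apply (by fun_prop) (by measurability)]
      refine measure_congr (hE.ae_nonneg.mono fun e he => ?_)
      change (s * x ^ (-σ⁻¹) < e) = (s ^ σ < x * e ^ σ)
      rw [Real.rpow_neg hx.le, ← div_eq_mul_inv, div_lt_iff₀ (by positivity), eq_iff_iff]
      have : x * e ^ σ = (e * x ^ σ⁻¹) ^ σ := by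
        rw [Real.mul_rpow he (by positivity), Real.rpow_inv_rpow hx.le hσ.ne', mul_comm]
      rw [this, Real.rpow_lt_rpow_iff hs (by positivity) hσ]
    rw [key, ENNReal.toReal_ofReal (Real.exp_nonneg _)]

end

section

/-! ### Limit laws of the degrees -/

/-- The Mellin transform of the limiting total degree of the first vertices, the last of which
arrived at time `t`. -/
def totalMellin (β t s : ℝ) : ℝ := Real.Gamma (t + s) / Real.Gamma (t + (1 - β) * s)

/-- The Mellin transform of the limiting degree of a vertex arrived at time `t`. -/
def degreeMellin (β t s : ℝ) : ℝ :=
  Real.Gamma (1 + s) * Real.Gamma t / Real.Gamma (t + (1 - β) * s)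

/-- Follows from x Γ(x) = Γ(x + 1) and Γ ≥ 1 on [2, ∞). It controls the Gamma denominators of the
Mellin transforms in the growth bounds. -/
theorem inv_Gamma_le {x : ℝ} (hx : 1 ≤ x) : (Real.Gamma x)⁻¹ ≤ x := by
  have h0 : 0 < x := by linarith
  have h1 : 1 ≤ Real.Gamma (x + 1) := by
    refine Real.Gamma_two.symm.le.trans ?_
    exact Real.Gamma_strictMonoOn_Ici.monotoneOn (by simp) (by simp; linarith) (by linarith)
  rw [Real.Gamma_add_one h0.ne'] at h1
  rw [inv_le_iff_one_le_mul₀ (Real.Gamma_pos_of_pos h0)]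
  exact h1

theorem succ_le_two_pow (p : ℕ) : (p : ℝ) + 1 ≤ 2 ^ p := by
  exact_mod_cast Nat.lt_two_pow_self

theorem inv_Gamma_add_le {t c : ℝ} (ht : 1 ≤ t) (hc0 : 0 ≤ c) (hc1 : c ≤ 1) (p : ℕ) :
    (Real.Gamma (t + c * p))⁻¹ ≤ t * 2 ^ p := by
  have hp : (0 : ℝ) ≤ p := p.cast_nonneg
  have h1 : c * p ≤ p := mul_le_of_le_one_left hp hc1
  have h0 : 0 ≤ c * p := by positivity
  calc _ ≤ t + c * p := inv_Gamma_le (by linarith)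
    _ ≤ t * (p + 1) := by nlinarith
    _ ≤ t * 2 ^ p := by gcongr; exact succ_le_two_pow p

variable {β : ℝ}

theorem degreeMellin_le (h0 : 0 < β) (h1 : β < 1) {t : ℝ} (ht : 1 ≤ t) (p : ℕ) :
    degreeMellin β t p ≤ Real.Gamma t * t * 2 ^ p * p ! := by
  have hG : 0 < Real.Gamma t := Real.Gamma_pos_of_pos (by linarith)
  have := inv_Gamma_add_le ht (c := 1 - β) (by linarith) (by linarith) p
  rw [degreeMellin, add_comm (1 : ℝ) p, Real.Gamma_nat_eq_factorial, div_eq_mul_inv]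
  calc _ ≤ p ! * Real.Gamma t * (t * 2 ^ p) := by gcongr
    _ = _ := by ring

theorem Gamma_nat_add_le {t : ℕ} (ht : 1 ≤ t) (p : ℕ) :
    Real.Gamma (t + p) ≤ 2 ^ t * t ! * 2 ^ p * p ! := by
  have e : (t : ℝ) + p = ((t + p - 1 : ℕ) : ℝ) + 1 := by
    have : 1 ≤ t + p := by omega
    push_cast [Nat.cast_sub this]
    ring
  rw [e, Real.Gamma_nat_eq_factorial]
  have h2 : (t + p - 1)! ≤ 2 ^ t * t ! * 2 ^ p * p ! := by
    calc (t + p - 1)! ≤ (t + p)! := Nat.factorial_le (by omega)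
      _ = (t + p).choose p * t ! * p ! := (Nat.add_choose_mul_factorial_mul_factorial t p).symm
      _ ≤ 2 ^ (t + p) * t ! * p ! := by gcongr; exact Nat.choose_le_two_pow _ _
      _ = _ := by ring
  exact_mod_cast h2

theorem totalMellin_le (h0 : 0 < β) (h1 : β < 1) {t : ℕ} (ht : 1 ≤ t) (p : ℕ) :
    totalMellin β t p ≤ (2 ^ t * t ! * t) * 4 ^ p * p ! := by
  have ht' : (1 : ℝ) ≤ t := by exact_mod_cast ht
  have := inv_Gamma_add_le ht' (c := 1 - β) (by linarith) (by linarith) p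
  have hfac := Gamma_nat_add_le ht p
  rw [totalMellin, div_eq_mul_inv]
  calc _ ≤ (2 ^ t * (t ! : ℝ) * 2 ^ p * p !) * (t * 2 ^ p) := by
        gcongr
    _ = (2 ^ t * (t ! : ℝ) * t) * 4 ^ p * p ! := by
        rw [show (4 : ℝ) = 2 * 2 by norm_num, mul_pow]
        ring

theorem hasMellin_total (h0 : 0 < β) (h1 : β < 1) (hst : ∃ ν, IsPositiveStable (1 - β) ν)
    {t : ℝ} (ht : 1 ≤ t) :
    HasMellin (genMittagLeffler (1 - β) (t - 1) ∗ₘ betaLaw t ((t - 1) * (β / (1 - β))))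
      (totalMellin β t) := by
  have hσ : 0 < 1 - β := sub_pos.2 h1
  have ht1 : 0 ≤ t - 1 := sub_nonneg.2 ht
  have ht0 : 0 < t := by linarith
  refine ((hasMellin_genMittagLeffler hσ ht1 hst).mconv
    (hasMellin_betaLaw ht0 (by positivity))).congr fun s hs => ?_
  have e1 : (t - 1 + (1 - β) * s) / (1 - β) + 1 = (t - 1) / (1 - β) + 1 + s := by field_simp; ring
  have e2 : t - 1 + (1 - β) * s + 1 = t + (1 - β) * s := by ring
  have e3 : t + (t - 1) * (β / (1 - β)) = (t - 1) / (1 - β) + 1 := by field_simp; ring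
  simp only [totalMellin, stableMellin, betaMellin, e1, e2, e3, sub_add_cancel]
  have g1 := Real.Gamma_pos_of_pos (show 0 < (t - 1) / (1 - β) + 1 by positivity)
  have g2 := Real.Gamma_pos_of_pos (show 0 < (t - 1) / (1 - β) + 1 + s by positivity)
  have g3 := Real.Gamma_pos_of_pos ht0
  have g4 := Real.Gamma_pos_of_pos (show 0 < t + (1 - β) * s by positivity)
  field_simp

theorem hasMellin_total_mconv_beta (h0 : 0 < β) (h1 : β < 1)
    (hst : ∃ ν, IsPositiveStable (1 - β) ν) {t : ℝ} (ht : 1 ≤ t) :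
    HasMellin ((genMittagLeffler (1 - β) (t - 1) ∗ₘ betaLaw t ((t - 1) * (β / (1 - β))))
      ∗ₘ betaLaw 1 (t - 1)) (degreeMellin β t) := by
  have hσ : 0 < 1 - β := sub_pos.2 h1
  have ht1 : 0 ≤ t - 1 := sub_nonneg.2 ht
  have ht0 : 0 < t := by linarith
  refine ((hasMellin_total h0 h1 hst ht).mconv
    (hasMellin_betaLaw one_pos ht1)).congr fun s hs => ?_
  simp only [totalMellin, degreeMellin, betaMellin, add_sub_cancel, Real.Gamma_one]
  have g3 := Real.Gamma_pos_of_pos (show 0 < t + s by positivity)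
  field_simp

theorem hasMellin_mittagLeffler_mconv (h1 : β < 1)
    (hst : ∃ ν, IsPositiveStable (1 - β) ν) {t : ℝ} (ht : 1 ≤ t) :
    HasMellin (mittagLeffler (1 - β) ∗ₘ powLaw (betaLaw 1 (t - 1)) (1 - β))
      (degreeMellin β t) := by
  have hσ : 0 < 1 - β := sub_pos.2 h1
  have ht1 : 0 ≤ t - 1 := sub_nonneg.2 ht
  rw [mittagLeffler_eq hst]
  refine ((hasMellin_genMittagLeffler hσ le_rfl hst).mconv
    ((hasMellin_betaLaw one_pos ht1).powLaw hσ.le)).congr fun s hs => ?_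
  have e1 : (1 - β) * s / (1 - β) + 1 = 1 + s := by field_simp; ring
  have e2 : (1 - β) * s + 1 = 1 + (1 - β) * s := by ring
  simp only [degreeMellin, stableMellin, betaMellin, add_sub_cancel, Real.Gamma_one, zero_div,
    zero_add, e1, e2]
  have g3 := Real.Gamma_pos_of_pos (show 0 < 1 + (1 - β) * s by positivity)
  field_simp

theorem hasMellin_genMittagLeffler_mconv (h1 : β < 1)
    (hst : ∃ ν, IsPositiveStable (1 - β) ν) {t : ℝ} (ht : 1 ≤ t) :
    HasMellin (genMittagLeffler (1 - β) (t - 1) ∗ₘ betaLaw 1 ((t - 1) / (1 - β)))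
      (degreeMellin β t) := by
  have hσ : 0 < 1 - β := sub_pos.2 h1
  have ht1 : 0 ≤ t - 1 := sub_nonneg.2 ht
  have ht0 : 0 < t := by linarith
  refine ((hasMellin_genMittagLeffler hσ ht1 hst).mconv
    (hasMellin_betaLaw one_pos (by positivity))).congr fun s hs => ?_
  have e1 : (t - 1 + (1 - β) * s) / (1 - β) + 1 = (t - 1) / (1 - β) + 1 + s := by field_simp; ring
  have e2 : t - 1 + (1 - β) * s + 1 = t + (1 - β) * s := by ring
  have e3 : 1 + (t - 1) / (1 - β) = (t - 1) / (1 - β) + 1 := by ring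
  simp only [degreeMellin, stableMellin, betaMellin, e1, e2, e3, sub_add_cancel, Real.Gamma_one]
  have g1 := Real.Gamma_pos_of_pos (show 0 < (t - 1) / (1 - β) + 1 by positivity)
  have g2 := Real.Gamma_pos_of_pos (show 0 < (t - 1) / (1 - β) + 1 + s by positivity)
  have g3 := Real.Gamma_pos_of_pos ht0
  have g4 := Real.Gamma_pos_of_pos (show 0 < t + (1 - β) * s by positivity)
  field_simp

theorem hasMellin_genMittagLeffler_mconv' (h0 : 0 < β) (h1 : β < 1)
    (hst : ∃ ν, IsPositiveStable (1 - β) ν) {t : ℝ} (ht : 1 ≤ t) :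
    HasMellin (genMittagLeffler (1 - β) t ∗ₘ betaLaw 1 ((t - 1 + β) / (1 - β)))
      (degreeMellin β t) := by
  have hσ : 0 < 1 - β := sub_pos.2 h1
  have ht1 : 0 ≤ t - 1 := sub_nonneg.2 ht
  have ht0 : 0 < t := by linarith
  refine ((hasMellin_genMittagLeffler hσ ht0.le hst).mconv
    (hasMellin_betaLaw one_pos (by positivity))).congr fun s hs => ?_
  have e1 : (t + (1 - β) * s) / (1 - β) + 1 = (t / (1 - β) + s) + 1 := by field_simp
  have e3 : 1 + (t - 1 + β) / (1 - β) = t / (1 - β) := by field_simp; ring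
  simp only [degreeMellin, stableMellin, betaMellin, e1, e3, Real.Gamma_one]
  have g1 := Real.Gamma_pos_of_pos (show 0 < t / (1 - β) by positivity)
  have g2 := Real.Gamma_pos_of_pos (show 0 < t / (1 - β) + s by positivity)
  have g3 := Real.Gamma_pos_of_pos ht0
  have g4 := Real.Gamma_pos_of_pos (show 0 < t + (1 - β) * s by positivity)
  -- The stable moments have Gamma arguments one too large for the cancellation. The recursion
  -- leaves (t / (1 - β) + s) / (t + (1 - β) s), equal to 1 / (1 - β) for every s, so it cancels
  -- against its value at s = 0.
  rw [Real.Gamma_add_one (show t / (1 - β) + s ≠ 0 by positivity),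
    Real.Gamma_add_one (show t / (1 - β) ≠ 0 by positivity),
    Real.Gamma_add_one (show t + (1 - β) * s ≠ 0 by positivity), Real.Gamma_add_one ht0.ne']
  have : t + (1 - β) * s ≠ 0 := by positivity
  field_simp

theorem degreeMellin_mul_gamma (h1 : β < 1) {t s : ℝ} (ht : 1 ≤ t) (hs : 0 ≤ s) :
    degreeMellin β t s * (Real.Gamma (t + (1 - β) * s) / Real.Gamma t) = Real.Gamma (1 + s) := by
  have hσ : 0 < 1 - β := sub_pos.2 h1
  have ht0 : 0 < t := by linarith
  have g3 := Real.Gamma_pos_of_pos ht0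
  have g4 := Real.Gamma_pos_of_pos (show 0 < t + (1 - β) * s by positivity)
  rw [degreeMellin]
  field_simp

theorem totalMellin_mul_gamma (h1 : β < 1) {t s : ℝ} (ht : 1 ≤ t) (hs : 0 ≤ s) :
    Real.Gamma (t + (1 - β) * s) / Real.Gamma t * totalMellin β t s
      = Real.Gamma (t + s) / Real.Gamma t := by
  have hσ : 0 < 1 - β := sub_pos.2 h1
  have g4 := Real.Gamma_pos_of_pos (show 0 < t + (1 - β) * s by positivity)
  rw [totalMellin]
  field_simp

theorem degreeMellin_add (h1 : β < 1) {t d s : ℝ} (ht : 1 ≤ t) (hd : 0 ≤ d) (hs : 0 ≤ s) :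
    degreeMellin β (t + d) s = degreeMellin β t s * betaMellin t d ((1 - β) * s) := by
  have hσ : 0 < 1 - β := sub_pos.2 h1
  have g3 := Real.Gamma_pos_of_pos (show 0 < t by linarith)
  have g4 := Real.Gamma_pos_of_pos (show 0 < t + (1 - β) * s by positivity)
  rw [degreeMellin, degreeMellin, betaMellin]
  field_simp

/-- With x_i = (u + i) / (1 - β), the i-th factor is (x_i + s) / x_i times Γ(x_i + s) Γ(x_{i+1}) /
(Γ(x_i) Γ(x_{i+1} + s)). The latter quotients telescope to the beta moment on the right; the former
are (u + i + (1 - β) s) / (u + i) and give the leading Gamma quotient. The cases u = t and u = t - 1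
yield the two recursions with beta products. -/
theorem prod_betaMellin (h1 : β < 1) {u s : ℝ} (hu : 0 < u) (hs : 0 ≤ s) (d : ℕ) :
    ∏ i : Fin d, betaMellin ((u + ((i.val : ℝ) + 1) - β) / (1 - β)) (β / (1 - β)) s
      = Real.Gamma (u + d + (1 - β) * s) * Real.Gamma u
          / (Real.Gamma (u + (1 - β) * s) * Real.Gamma (u + d))
        * betaMellin (u / (1 - β)) (d / (1 - β)) s := by
  have hσ : 0 < 1 - β := sub_pos.2 h1
  have g1 := Real.Gamma_pos_of_pos hu
  have g2 := Real.Gamma_pos_of_pos (show 0 < u + (1 - β) * s by positivity)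
  have g3 := Real.Gamma_pos_of_pos (show 0 < u / (1 - β) by positivity)
  have g4 := Real.Gamma_pos_of_pos (show 0 < u / (1 - β) + s by positivity)
  induction d with
  | zero =>
    simp only [Finset.univ_eq_empty, Finset.prod_empty, betaMellin, Nat.cast_zero, zero_div,
      add_zero]
    field_simp
  | succ d ih =>
    rw [Fin.prod_univ_castSucc]
    simp only [Fin.val_castSucc, Fin.val_last]
    rw [ih]
    have e1 : (u + ((d : ℝ) + 1) - β) / (1 - β) = (u + d) / (1 - β) + 1 := by field_simp; ring
    have e2 : (u + d) / (1 - β) + 1 + β / (1 - β) = (u + d + 1) / (1 - β) := by field_simp; ring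
    have e3 : u / (1 - β) + d / (1 - β) = (u + d) / (1 - β) := by ring
    have e4 : u / (1 - β) + ((d + 1 : ℕ) : ℝ) / (1 - β) = (u + d + 1) / (1 - β) := by
      push_cast; ring
    have e5 : (u + d) / (1 - β) + 1 + s = (u + d) / (1 - β) + s + 1 := by ring
    have e6 : u + ((d + 1 : ℕ) : ℝ) + (1 - β) * s = u + d + (1 - β) * s + 1 := by push_cast; ring
    have e7 : u + ((d + 1 : ℕ) : ℝ) = u + d + 1 := by push_cast; ring
    have p1 : 0 < u + d := by positivity
    have p2 : 0 < (u + d) / (1 - β) := by positivity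
    have p3 : 0 < u + d + (1 - β) * s := by positivity
    have p4 : 0 < (u + d) / (1 - β) + s := by positivity
    simp only [betaMellin, e1, e2, e3, e4, e5, e6]
    rw [e7, Real.Gamma_add_one p1.ne', Real.Gamma_add_one p2.ne', Real.Gamma_add_one p3.ne',
      Real.Gamma_add_one p4.ne']
    have := Real.Gamma_pos_of_pos p1
    have := Real.Gamma_pos_of_pos p2
    have := Real.Gamma_pos_of_pos p3
    have := Real.Gamma_pos_of_pos p4
    have := Real.Gamma_pos_of_pos (show 0 < (u + d + 1) / (1 - β) by positivity)
    have := Real.Gamma_pos_of_pos (show 0 < (u + d + 1) / (1 - β) + s by positivity)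
    field_simp

/-- The leading quotient in `prod_betaMellin` at u = t is exactly the ratio of the degree moments
for the arrival times t and t + d. -/
theorem degreeMellin_mul_prod (h1 : β < 1) {t s : ℝ} (ht : 1 ≤ t) (hs : 0 ≤ s) (d : ℕ) :
    degreeMellin β (t + d) s
        * ∏ i : Fin d, betaMellin ((t + ((i.val : ℝ) + 1) - β) / (1 - β)) (β / (1 - β)) s
      = degreeMellin β t s * betaMellin (t / (1 - β)) (d / (1 - β)) s := by
  have hσ : 0 < 1 - β := sub_pos.2 h1
  have ht0 : 0 < t := by linarith
  rw [prod_betaMellin h1 ht0 hs, degreeMellin, degreeMellin]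
  have := Real.Gamma_pos_of_pos (show 0 < t + d by positivity)
  have := Real.Gamma_pos_of_pos (show 0 < t + (1 - β) * s by positivity)
  have := Real.Gamma_pos_of_pos (show 0 < t + d + (1 - β) * s by positivity)
  field_simp

/-- Here `prod_betaMellin` is used at u = t - 1, which must be positive. Relative to the ratio of
degree moments there are leftover linear factors, and these shift the first beta parameter from u /
(1 - β) to u / (1 - β) + 1 = (t - β) / (1 - β). -/
theorem degreeMellin_mul_prod' (h1 : β < 1) {t s : ℝ} (ht : 1 < t) (hs : 0 ≤ s) (d : ℕ) :
    degreeMellin β (t + d) s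
        * ∏ i : Fin d, betaMellin ((t - 1 + ((i.val : ℝ) + 1) - β) / (1 - β)) (β / (1 - β)) s
      = degreeMellin β t s * betaMellin ((t - β) / (1 - β)) (d / (1 - β)) s := by
  have hσ : 0 < 1 - β := sub_pos.2 h1
  obtain ⟨u, rfl⟩ : ∃ u, t = u + 1 := ⟨t - 1, by ring⟩
  have hu : 0 < u := by linarith
  rw [add_sub_cancel_right, prod_betaMellin h1 hu hs]
  have e1 : u + 1 + (1 - β) * s = u + (1 - β) * s + 1 := by ring
  have e2 : u + d + 1 + (1 - β) * s = u + d + (1 - β) * s + 1 := by ring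
  have e3 : u + 1 + (d : ℝ) = u + d + 1 := by ring
  have e4 : (u + 1 - β) / (1 - β) = u / (1 - β) + 1 := by field_simp; ring
  have e5 : u / (1 - β) + 1 + d / (1 - β) = (u + d) / (1 - β) + 1 := by ring
  have e6 : u / (1 - β) + d / (1 - β) = (u + d) / (1 - β) := by ring
  have e7 : (u + d) / (1 - β) + 1 + s = (u + d) / (1 - β) + s + 1 := by ring
  have e8 : u / (1 - β) + 1 + s = u / (1 - β) + s + 1 := by ring
  simp only [degreeMellin, betaMellin, e1, e2, e3, e4, e5, e6, e7, e8]
  have p1 : 0 < u + d := by positivity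
  have p2 : 0 < (u + d) / (1 - β) := by positivity
  have p3 : 0 < u + d + (1 - β) * s := by positivity
  have p4 : 0 < (u + d) / (1 - β) + s := by positivity
  have p5 : 0 < u + (1 - β) * s := by positivity
  have p6 : 0 < u / (1 - β) := by positivity
  have p7 : 0 < u / (1 - β) + s := by positivity
  rw [Real.Gamma_add_one p1.ne', Real.Gamma_add_one p2.ne', Real.Gamma_add_one p3.ne',
    Real.Gamma_add_one p4.ne', Real.Gamma_add_one p5.ne', Real.Gamma_add_one p6.ne',
    Real.Gamma_add_one p7.ne', Real.Gamma_add_one hu.ne']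
  have := Real.Gamma_pos_of_pos hu
  have := Real.Gamma_pos_of_pos p1
  have := Real.Gamma_pos_of_pos p2
  have := Real.Gamma_pos_of_pos p3
  have := Real.Gamma_pos_of_pos p4
  have := Real.Gamma_pos_of_pos p5
  have := Real.Gamma_pos_of_pos p6
  have := Real.Gamma_pos_of_pos p7
  field_simp

end

section

/-! ### The stick-breaking vector and its mixed moments -/

/-- The moment `𝔼[Ψ ^ p (1 - Ψ) ^ q]` for `Ψ ∼ Beta (1, b)`; for `b = 0` only `q = 0` is used. -/
def stickFactor (b : ℝ) (p q : ℕ) : ℝ :=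
  if b = 0 then 1 else beta (1 + p) (b + q) / beta 1 b

theorem stickFactor_nonneg {b : ℝ} (hb : 0 ≤ b) (p q : ℕ) : 0 ≤ stickFactor b p q := by
  unfold stickFactor
  split_ifs with h
  · exact zero_le_one
  · have hb' : 0 < b := lt_of_le_of_ne hb (Ne.symm h)
    exact div_nonneg (beta_pos (by positivity) (by positivity)).le (beta_pos one_pos hb').le

theorem lintegral_betaLaw_one {b : ℝ} (hb : 0 ≤ b) {p q : ℕ} (hq : b = 0 → q = 0) :
    ∫⁻ x, ENNReal.ofReal (x ^ p * (1 - x) ^ q) ∂(betaLaw 1 b)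
      = ENNReal.ofReal (stickFactor b p q) := by
  unfold betaLaw stickFactor
  split_ifs with h
  · rw [lintegral_dirac' _ (by fun_prop), hq h]
    simp
  · have hb' : 0 < b := lt_of_le_of_ne hb (Ne.symm h)
    rw [← lintegral_betaMeasure one_pos hb' p.cast_nonneg q.cast_nonneg]
    simp

/-- Exchanging the two products, 1 - ψ i occurs in every coordinate of smaller index and collects
their exponents. Mixed moments then factorise over the independent Ψ's. -/
theorem prod_stick_pow {r : ℕ} (ψ : Fin r → ℝ) (p : ℕ → ℕ) :
    ∏ j : Fin r, stick ψ j ^ p j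
      = ∏ i : Fin r, ψ i ^ p i * (1 - ψ i) ^ (∑ k ∈ Finset.range i, p k) := by
  simp_rw [stick, mul_pow, Finset.prod_mul_distrib]
  congr 1
  simp_rw [← Finset.prod_pow]
  rw [Finset.prod_comm' (t' := Finset.univ) (s' := fun i => Finset.Iio i) (by simp)]
  refine Finset.prod_congr rfl fun i _ => ?_
  rw [Finset.prod_pow_eq_pow_sum]
  congr 1
  rw [← Nat.Iio_eq_range, ← Fin.map_valEmbedding_Iio, Finset.sum_map]
  rfl

theorem measurable_stick {r : ℕ} : Measurable (stick : (Fin r → ℝ) → Fin r → ℝ) := by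
  unfold stick
  fun_prop

theorem IsArrivalPrefix.one_le {r : ℕ} {t : ℕ → ℕ} (ht : IsArrivalPrefix r t) {i : ℕ}
    (h1 : 1 ≤ i) (hi : i ≤ r) : 1 ≤ t i := by
  rw [← ht.1]
  exact ht.2.monotoneOn ⟨le_rfl, h1.trans hi⟩ ⟨h1, hi⟩ h1

theorem IsArrivalPrefix.mono {r r' : ℕ} {t : ℕ → ℕ} (ht : IsArrivalPrefix r t) (h : r' ≤ r) :
    IsArrivalPrefix r' t :=
  ⟨ht.1, ht.2.mono (Set.Icc_subset_Icc_right h)⟩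

theorem IsArrivalPrefix.one_lt {r : ℕ} {t : ℕ → ℕ} (ht : IsArrivalPrefix r t) {i : ℕ}
    (h1 : 1 < i) (hi : i ≤ r) : 1 < t i := by
  calc 1 = t 1 := ht.1.symm
    _ < t i := ht.2 ⟨le_rfl, h1.le.trans hi⟩ ⟨h1.le, hi⟩ h1

variable {r : ℕ} {t : ℕ → ℕ}

theorem isProbabilityMeasure_stick_betaLaw (ht : IsArrivalPrefix r t) (i : Fin r) :
    IsProbabilityMeasure (betaLaw 1 ((t (i.val + 1) : ℝ) - 1)) :=
  isProbabilityMeasure_betaLaw one_pos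
    (sub_nonneg.2 (by exact_mod_cast ht.one_le (Nat.le_add_left _ _) i.2))

theorem isProbabilityMeasure_stickLaw (ht : IsArrivalPrefix r t) :
    IsProbabilityMeasure (stickLaw r t) := by
  have := isProbabilityMeasure_stick_betaLaw ht
  exact Measure.isProbabilityMeasure_map measurable_stick.aemeasurable

theorem ae_stickLaw_mem (ht : IsArrivalPrefix r t) :
    ∀ᵐ x ∂(stickLaw r t), ∀ i, 0 ≤ x i ∧ x i ≤ 1 := by
  have := isProbabilityMeasure_stick_betaLaw ht
  have hm : MeasurableSet {x : Fin r → ℝ | ∀ i, 0 ≤ x i ∧ x i ≤ 1} := by measurability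
  rw [stickLaw, ae_map_iff measurable_stick.aemeasurable hm]
  have h : ∀ᵐ ψ ∂(Measure.pi fun j : Fin r => betaLaw 1 ((t (j.val + 1) : ℝ) - 1)),
      ∀ i, 0 ≤ ψ i ∧ ψ i ≤ 1 := by
    rw [ae_all_iff]
    exact fun i => (Measure.quasiMeasurePreserving_eval
      (μ := fun j : Fin r => betaLaw 1 ((t (j.val + 1) : ℝ) - 1)) i).ae ae_betaLaw_mem
  filter_upwards [h] with ψ hψ i
  have h0 : 0 ≤ ∏ k ∈ Finset.Ioi i, (1 - ψ k) :=
    Finset.prod_nonneg fun k _ => sub_nonneg.2 (hψ k).2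
  have h1 : ∏ k ∈ Finset.Ioi i, (1 - ψ k) ≤ 1 :=
    Finset.prod_le_one (fun k _ => sub_nonneg.2 (hψ k).2) fun k _ => by linarith [(hψ k).1]
  exact ⟨mul_nonneg (hψ i).1 h0, mul_le_one₀ (hψ i).2 h0 h1⟩

theorem lintegral_stickLaw (ht : IsArrivalPrefix r t) (p : ℕ → ℕ) :
    ∫⁻ x, ENNReal.ofReal (∏ i : Fin r, x i ^ p i) ∂(stickLaw r t)
      = ENNReal.ofReal (∏ i ∈ Finset.range r,
          stickFactor ((t (i + 1) : ℝ) - 1) (p i) (∑ k ∈ Finset.range i, p k)) := by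
  have := isProbabilityMeasure_stick_betaLaw ht
  have hb : ∀ i < r, (0 : ℝ) ≤ (t (i + 1) : ℝ) - 1 := fun i hi =>
    sub_nonneg.2 (by exact_mod_cast ht.one_le (Nat.le_add_left _ _) hi)
  rw [stickLaw, lintegral_map (by fun_prop) measurable_stick]
  simp_rw [prod_stick_pow]
  rw [Finset.prod_range, ENNReal.ofReal_prod_of_nonneg
    fun (i : Fin r) _ => stickFactor_nonneg (hb i i.2) _ _]
  have h : ∀ᵐ ψ ∂(Measure.pi fun j : Fin r => betaLaw 1 ((t (j.val + 1) : ℝ) - 1)),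
      ∀ i, 0 ≤ ψ i ∧ ψ i ≤ 1 := by
    rw [ae_all_iff]
    exact fun i => (Measure.quasiMeasurePreserving_eval
      (μ := fun j : Fin r => betaLaw 1 ((t (j.val + 1) : ℝ) - 1)) i).ae ae_betaLaw_mem
  rw [lintegral_congr_ae (h.mono fun ψ hψ => ENNReal.ofReal_prod_of_nonneg fun i _ =>
      mul_nonneg (pow_nonneg (hψ i).1 _) (pow_nonneg (sub_nonneg.2 (hψ i).2) _)),
    lintegral_pi_prod (fun j : Fin r => betaLaw 1 ((t (j.val + 1) : ℝ) - 1))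
      (f := fun i x => ENNReal.ofReal (x ^ p i * (1 - x) ^ (∑ k ∈ Finset.range i, p k)))
      (fun i => by fun_prop)]
  refine Finset.prod_congr rfl fun i _ => lintegral_betaLaw_one (hb i i.2) fun h0 => ?_
  -- A vanishing second beta parameter means t (i + 1) = 1, hence i = 0, where the exponent of 1 - Ψ
  -- is an empty sum.
  rcases Nat.eq_zero_or_pos (i : ℕ) with hi | hi
  · simp [hi]
  · have h1 := ht.one_lt (i := i + 1) (by omega) i.2
    have h2 : (1 : ℝ) < t (i + 1) := by exact_mod_cast h1
    linarith

/-! ### Scalings of random vectors -/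

theorem lintegral_scaleLaw_eq (μ : Measure ℝ) (ν : Measure (Fin r → ℝ)) [SFinite μ] [SFinite ν]
    {f : (Fin r → ℝ) → ℝ≥0∞} (hf : Measurable f) :
    ∫⁻ x, f x ∂(scaleLaw μ ν) = ∫⁻ c, ∫⁻ x, f (c • x) ∂ν ∂μ := by
  rw [scaleLaw, lintegral_map hf (by fun_prop), lintegral_prod _ (by fun_prop)]

theorem lintegral_scaleLaw {μ : Measure ℝ} {ν : Measure (Fin r → ℝ)} [SFinite μ] [SFinite ν]
    (hμ : ∀ᵐ x ∂μ, 0 ≤ x) (p : Fin r → ℕ) :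
    ∫⁻ x, ENNReal.ofReal (∏ i, x i ^ p i) ∂(scaleLaw μ ν)
      = (∫⁻ c, ENNReal.ofReal (c ^ ∑ i, p i) ∂μ) * ∫⁻ x, ENNReal.ofReal (∏ i, x i ^ p i) ∂ν := by
  rw [scaleLaw, lintegral_map (by fun_prop) (by fun_prop),
    ← lintegral_prod_mul (by fun_prop) (Measurable.aemeasurable (by fun_prop))]
  have h1 : ∀ᵐ z ∂(μ.prod ν), 0 ≤ z.1 := Measure.quasiMeasurePreserving_fst.ae hμ
  refine lintegral_congr_ae (h1.mono fun z hz => ?_)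
  simp only [Pi.smul_apply, smul_eq_mul, mul_pow, Finset.prod_mul_distrib,
    Finset.prod_pow_eq_pow_sum]
  rw [ENNReal.ofReal_mul (pow_nonneg hz _)]

theorem scaleLaw_scaleLaw (μ μ' : Measure ℝ) (ν : Measure (Fin r → ℝ)) [SFinite μ] [SFinite μ']
    [SFinite ν] : scaleLaw μ (scaleLaw μ' ν) = scaleLaw (μ ∗ₘ μ') ν := by
  refine Measure.ext_of_lintegral _ fun f hf => ?_
  have : SFinite (scaleLaw μ' ν) := by unfold scaleLaw; infer_instance
  rw [lintegral_scaleLaw_eq _ _ hf, lintegral_scaleLaw_eq _ _ hf,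
    Measure.lintegral_mconv (by fun_prop)]
  refine lintegral_congr fun x => ?_
  rw [lintegral_scaleLaw_eq _ _ (by fun_prop)]
  simp only [smul_smul]

theorem map_eval_scaleLaw (μ : Measure ℝ) (ν : Measure (Fin r → ℝ)) [SFinite μ] [SFinite ν]
    (i : Fin r) : (scaleLaw μ ν).map (fun x => x i) = μ ∗ₘ (ν.map fun x => x i) := by
  refine Measure.ext_of_lintegral _ fun f hf => ?_
  rw [lintegral_map hf (by fun_prop), scaleLaw, lintegral_map (by fun_prop) (by fun_prop),
    lintegral_prod _ (by fun_prop), Measure.lintegral_mconv (by fun_prop)]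
  refine lintegral_congr fun x => ?_
  rw [lintegral_map (by fun_prop) (by fun_prop)]
  simp

/-- The last coordinate carries no factor 1 - ψ, so the most recent vertex has a single beta share
of the total degree. -/
theorem map_last_stickLaw (ht : IsArrivalPrefix (r + 1) t) :
    (stickLaw (r + 1) t).map (fun x => x (Fin.last r)) = betaLaw 1 ((t (r + 1) : ℝ) - 1) := by
  have := isProbabilityMeasure_stick_betaLaw ht
  rw [stickLaw, Measure.map_map (by fun_prop) measurable_stick]
  have : (fun x : Fin (r + 1) → ℝ => x (Fin.last r)) ∘ stick = Function.eval (Fin.last r) := by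
    ext ψ
    have hI : Finset.Ioi (Fin.last r) = ∅ := by ext i; simpa using Fin.le_last i
    simp [stick, hI]
  rw [this, (measurePreserving_eval _ (Fin.last r)).map_eq]
  simp

variable {β : ℝ}

/-- A law on the positive orthant with the mixed moments of a scaled stick-breaking vector. -/
theorem eq_scaleLaw_stickLaw (h0 : 0 < β) (h1 : β < 1) (hst : ∃ ν, IsPositiveStable (1 - β) ν)
    (hr : 1 ≤ r) (ht : IsArrivalPrefix r t) {ρ : Measure (Fin r → ℝ)} [IsProbabilityMeasure ρ]
    (hρ0 : ∀ᵐ x ∂ρ, ∀ i, 0 ≤ x i)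
    (hρ : ∀ p : ℕ → ℕ, ∫⁻ x, ENNReal.ofReal (∏ i : Fin r, x i ^ p i) ∂ρ
      = ENNReal.ofReal (totalMellin β (t r) (∑ k ∈ Finset.range r, p k : ℕ)
        * ∏ i ∈ Finset.range r,
          stickFactor ((t (i + 1) : ℝ) - 1) (p i) (∑ k ∈ Finset.range i, p k))) :
    ρ = scaleLaw (genMittagLeffler (1 - β) ((t r : ℝ) - 1) ∗ₘ
      betaLaw (t r) (((t r : ℝ) - 1) * (β / (1 - β)))) (stickLaw r t) := by
  have htr : 1 ≤ t r := ht.one_le hr le_rfl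
  have htr' : (1 : ℝ) ≤ t r := by exact_mod_cast htr
  have hC := hasMellin_total h0 h1 hst htr'
  set μ := genMittagLeffler (1 - β) ((t r : ℝ) - 1) ∗ₘ
      betaLaw (t r) (((t r : ℝ) - 1) * (β / (1 - β)))
  have := hC.prob
  have := isProbabilityMeasure_stickLaw ht
  have : IsProbabilityMeasure (scaleLaw μ (stickLaw r t)) :=
    Measure.isProbabilityMeasure_map (by fun_prop)
  have a1 : ∀ᵐ z ∂(μ.prod (stickLaw r t)), 0 ≤ z.1 :=
    Measure.quasiMeasurePreserving_fst.ae hC.ae_nonneg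
  have a2 : ∀ᵐ z ∂(μ.prod (stickLaw r t)), ∀ i, 0 ≤ z.2 i ∧ z.2 i ≤ 1 :=
    Measure.quasiMeasurePreserving_snd.ae (ae_stickLaw_mem ht)
  -- Stick-breaking coordinates are at most 1, so the coordinate sum is at most r times the scalar
  -- factor. The remaining constants come from `totalMellin_le`.
  refine ext_of_mixed_moments (C := 2 ^ t r * (t r)! * t r) (K := r * 4) (by positivity)
    (by have : (0 : ℝ) < r := by exact_mod_cast hr
        positivity) hρ0 ?_ (fun q => ?_) fun p => ?_
  · have hm : MeasurableSet {x : Fin r → ℝ | ∀ i, 0 ≤ x i} := by measurability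
    rw [scaleLaw, ae_map_iff (by fun_prop) hm]
    filter_upwards [a1, a2] with z hz1 hz2 i using mul_nonneg hz1 (hz2 i).1
  · rw [scaleLaw, lintegral_map (by fun_prop) (by fun_prop)]
    calc ∫⁻ z, ENNReal.ofReal ((∑ i, (z.1 • z.2) i) ^ q) ∂(μ.prod (stickLaw r t))
        ≤ ∫⁻ z, ENNReal.ofReal (z.1 ^ q) * ENNReal.ofReal ((r : ℝ) ^ q)
            ∂(μ.prod (stickLaw r t)) := by
          refine lintegral_mono_ae ?_
          filter_upwards [a1, a2] with z hz1 hz2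
          rw [← ENNReal.ofReal_mul (pow_nonneg hz1 _), ← mul_pow]
          gcongr
          · exact Finset.sum_nonneg fun i _ => mul_nonneg hz1 (hz2 i).1
          · simp only [Pi.smul_apply, smul_eq_mul, ← Finset.mul_sum]
            gcongr
            calc ∑ i, z.2 i ≤ ∑ _i : Fin r, (1 : ℝ) := Finset.sum_le_sum fun i _ => (hz2 i).2
              _ = r := by simp
      _ = ENNReal.ofReal (totalMellin β (t r) q) * ENNReal.ofReal ((r : ℝ) ^ q) := by
          rw [lintegral_prod_mul (f := fun c => ENNReal.ofReal (c ^ q))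
            (g := fun _ => ENNReal.ofReal ((r : ℝ) ^ q)) (by fun_prop) (by fun_prop),
            hC.moment_nat]
          simp
      _ ≤ _ := by
          rw [← ENNReal.ofReal_mul (hC.nonneg _ q.cast_nonneg)]
          refine ENNReal.ofReal_le_ofReal ?_
          calc _ ≤ ((2 ^ t r * (t r)! * t r) * 4 ^ q * q ! : ℝ) * (r : ℝ) ^ q := by
                gcongr
                exact totalMellin_le h0 h1 htr q
            _ = _ := by ring
  · obtain ⟨p', hp'⟩ : ∃ p' : ℕ → ℕ, ∀ i : Fin r, p' i = p i :=
      ⟨fun k => if h : k < r then p ⟨k, h⟩ else 0, fun i => by simp⟩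
    have hsum : ∑ i : Fin r, p i = ∑ k ∈ Finset.range r, p' k := by
      rw [Finset.sum_range]
      exact Finset.sum_congr rfl fun i _ => (hp' i).symm
    rw [lintegral_scaleLaw hC.ae_nonneg, hsum, hC.moment_nat]
    simp_rw [← hp']
    rw [lintegral_stickLaw ht, hρ, ENNReal.ofReal_mul (hC.nonneg _ (Nat.cast_nonneg _))]

theorem powLaw_gammaLaw_mconv_total (h0 : 0 < β) (h1 : β < 1)
    (hst : ∃ ν, IsPositiveStable (1 - β) ν) {n : ℕ} (hn : 1 ≤ n) :
    powLaw (gammaLaw n) (1 - β) ∗ₘ (genMittagLeffler (1 - β) ((n : ℝ) - 1) ∗ₘ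
      betaLaw n (((n : ℝ) - 1) * (β / (1 - β)))) = gammaLaw n := by
  have hn' : (1 : ℝ) ≤ n := by exact_mod_cast hn
  have hG := hasMellin_gammaLaw (show (0 : ℝ) < n by linarith)
  have hpos := Real.Gamma_pos_of_pos (show (0 : ℝ) < n by linarith)
  refine ((hG.powLaw (sub_nonneg.2 h1.le)).mconv (hasMellin_total h0 h1 hst hn')).ext hG
    (C := 2 ^ n * n ! / Real.Gamma n) (K := 2) (by positivity) two_pos (fun p => ?_) fun p => ?_
  · calc _ ≤ (2 ^ n * n ! * 2 ^ p * p ! : ℝ) / Real.Gamma n := by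
          gcongr
          exact Gamma_nat_add_le hn p
      _ = _ := by ring
  · exact totalMellin_mul_gamma h1 hn' p.cast_nonneg

/-! ### The moments at the last arrival -/

/-- The factors (m + x) / m telescope through Γ(m + 1 + x) = (m + x) Γ(m + x). -/
theorem prod_one_add_div {x : ℝ} (hx : 0 ≤ x) {a b : ℕ} (ha : 1 ≤ a) (hab : a ≤ b) :
    ∏ m ∈ Finset.Ico a b, (1 + x / m)
      = Real.Gamma (b + x) * Real.Gamma a / (Real.Gamma b * Real.Gamma (a + x)) := by
  have ha' : (0 : ℝ) < a := by exact_mod_cast ha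
  have g1 := Real.Gamma_pos_of_pos ha'
  have g2 := Real.Gamma_pos_of_pos (add_pos_of_pos_of_nonneg ha' hx)
  induction b, hab using Nat.le_induction with
  | base => simp; field_simp
  | succ b hb ih =>
    have hb' : (0 : ℝ) < b := by exact_mod_cast ha.trans hb
    have g3 := Real.Gamma_pos_of_pos hb'
    have g4 := Real.Gamma_pos_of_pos (add_pos_of_pos_of_nonneg hb' hx)
    rw [Finset.prod_Ico_succ_top hb, ih, show ((b + 1 : ℕ) : ℝ) + x = b + x + 1 by push_cast; ring,
      Nat.cast_add_one, Real.Gamma_add_one hb'.ne',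
      Real.Gamma_add_one (add_pos_of_pos_of_nonneg hb' hx).ne']
    field_simp

/-- The mixed factorial moment, of orders `p 0, …, p (r - 1)`, of the degrees of the first `r`
vertices at time `t r` of the `r`-th arrival. -/
def arrivalMoment (t p : ℕ → ℕ) (r : ℕ) : ℝ :=
  Real.Gamma (t r + (∑ k ∈ Finset.range r, p k : ℕ)) / Real.Gamma (t r)
    * ∏ i ∈ Finset.range r,
        stickFactor ((t (i + 1) : ℝ) - 1) (p i) (∑ k ∈ Finset.range i, p k)

theorem arrivalMoment_nonneg (ht : IsArrivalPrefix r t) (p : ℕ → ℕ) : 0 ≤ arrivalMoment t p r :=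
  mul_nonneg (div_nonneg (Real.Gamma_nonneg_of_nonneg (by positivity))
      (Real.Gamma_nonneg_of_nonneg (by positivity)))
    (Finset.prod_nonneg fun i hi => stickFactor_nonneg (sub_nonneg.2 (by
      exact_mod_cast ht.one_le (Nat.le_add_left _ _) (Finset.mem_range.1 hi))) _ _)

theorem arrivalMoment_one (ht : t 1 = 1) (p : ℕ → ℕ) : arrivalMoment t p 1 = (p 0)! := by
  simp [arrivalMoment, ht, stickFactor, add_comm (1 : ℝ), Real.Gamma_nat_eq_factorial]

/-- This mirrors the dynamics. With t (r + 1) = N + 1, the first r degrees grow during the steps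
from t r to N, and the new vertex enters with degree 1, whose rising factorial is (p r)!. The new
stick factor has parameter N, and its beta quotient supplies precisely the missing Gamma terms. -/
theorem arrivalMoment_succ (hr : 1 ≤ r) (ht : IsArrivalPrefix (r + 1) t) (p : ℕ → ℕ) :
    arrivalMoment t p (r + 1) = (p r)! * (∏ m ∈ Finset.Ico (t r) (t (r + 1) - 1),
      (1 + ((∑ k ∈ Finset.range r, p k : ℕ) : ℝ) / m)) * arrivalMoment t p r := by
  have hlt : t r < t (r + 1) := ht.2 ⟨hr, by omega⟩ ⟨by omega, le_rfl⟩ (by omega)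
  have h1 : 1 ≤ t r := ht.one_le hr (by omega)
  obtain ⟨N, hN⟩ : ∃ N, t (r + 1) = N + 1 := ⟨t (r + 1) - 1, by omega⟩
  have hN1 : t r ≤ N := by omega
  rw [prod_one_add_div (Nat.cast_nonneg _) h1 (by omega), arrivalMoment, arrivalMoment,
    Finset.prod_range_succ, hN, Nat.add_sub_cancel, Finset.sum_range_succ]
  set q := ∑ k ∈ Finset.range r, p k
  have hN0 : (0 : ℝ) < N := by exact_mod_cast h1.trans hN1
  have ht0 : (0 : ℝ) < t r := by exact_mod_cast h1
  have hs : stickFactor (((N + 1 : ℕ) : ℝ) - 1) (p r) q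
      = (p r)! * Real.Gamma (N + q) * Real.Gamma (N + 1)
        / (Real.Gamma (N + 1 + (q + p r)) * Real.Gamma N) := by
    rw [Nat.cast_add_one, add_sub_cancel_right, stickFactor, if_neg hN0.ne', beta, beta,
      Real.Gamma_one, add_comm (1 : ℝ) (p r), Real.Gamma_nat_eq_factorial,
      show (p r : ℝ) + 1 + (N + q) = N + 1 + (q + p r) by ring, add_comm (1 : ℝ) N]
    have := Real.Gamma_pos_of_pos hN0
    field_simp
  rw [hs]
  push_cast
  have := Real.Gamma_pos_of_pos hN0
  have := Real.Gamma_pos_of_pos ht0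
  have := Real.Gamma_pos_of_pos (show (0 : ℝ) < t r + q by positivity)
  have := Real.Gamma_pos_of_pos (show (0 : ℝ) < N + 1 by positivity)
  have := Real.Gamma_pos_of_pos (show (0 : ℝ) < N + 1 + (q + p r) by positivity)
  field_simp

end

section

/-! ### Degrees along a sequence of labels -/

theorem degree_zero (l : ℕ → ℕ) (k : ℕ) : degree l k 0 = 0 := by simp [degree]

theorem degree_succ (l : ℕ → ℕ) (k n : ℕ) :
    degree l k (n + 1) = degree l k n + if l (n + 1) = k then 1 else 0 := by
  rw [degree, degree, ← Finset.insert_Icc_right_eq_Icc_add_one (by omega), Finset.filter_insert]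
  split_ifs with h
  · rw [Finset.card_insert_of_notMem (by simp)]
  · rfl

theorem degree_le (l : ℕ → ℕ) (k n : ℕ) : degree l k n ≤ n := by
  refine (Finset.card_filter_le _ _).trans ?_
  simp

/-- A vertex that has not appeared has degree 0, so for α = 0 the restriction to existing vertices
is automatic. -/
theorem biasedProb_zero (l : ℕ → ℕ) (n : ℕ) {k : ℕ} (hk : 1 ≤ k) :
    biasedProb 0 l n k = (degree l k n : ℝ) / n := by
  unfold biasedProb
  split_ifs with h
  · simp
  · have : degree l k n = 0 := by
      rw [degree, Finset.card_eq_zero, Finset.filter_eq_empty_iff]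
      intro i hi h'
      refine h ⟨hk, h' ▸ Finset.le_sup (f := l) hi⟩
    simp [this]

variable {Ω : Type*}

/-! ### The σ-algebras -/

/-- The σ-algebra generated by the arrival times. -/
abbrev arrivalSigma (T : ℕ → Ω → ℕ) : MeasurableSpace Ω :=
  MeasurableSpace.comap (fun ω => fun i : ℕ => T (i + 1) ω) inferInstance

theorem arrivalSigma_le_history (T L : ℕ → Ω → ℕ) (n : ℕ) :
    arrivalSigma T ≤ history T L n := by
  have h : Measurable[history T L n] (fun ω => ((fun i : ℕ => T (i + 1) ω),
      (fun i : Fin n => L (i.val + 1) ω))) := comap_measurable _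
  exact (measurable_fst.comp h).comap_le

theorem measurable_arrival (T : ℕ → Ω → ℕ) {k : ℕ} (hk : 1 ≤ k) :
    Measurable[arrivalSigma T] (T k) := by
  obtain ⟨i, rfl⟩ : ∃ i, k = i + 1 := ⟨k - 1, by omega⟩
  exact (measurable_pi_apply i).comp (comap_measurable (fun ω => fun i : ℕ => T (i + 1) ω))

theorem measurable_label (T L : ℕ → Ω → ℕ) {n i : ℕ} (hi : 1 ≤ i) (hin : i ≤ n) :
    Measurable[history T L n] (L i) := by
  have h : Measurable[history T L n] (fun ω => ((fun i : ℕ => T (i + 1) ω),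
      (fun i : Fin n => L (i.val + 1) ω))) := comap_measurable _
  obtain ⟨j, rfl⟩ : ∃ j, i = j + 1 := ⟨i - 1, by omega⟩
  exact (measurable_pi_apply (⟨j, by omega⟩ : Fin n)).comp (measurable_snd.comp h)

theorem measurable_degree (T L : ℕ → Ω → ℕ) (k n : ℕ) :
    Measurable[history T L n] (fun ω => degree (fun i => L i ω) k n) := by
  have h : (fun ω => degree (fun i => L i ω) k n)
      = fun ω => ∑ i ∈ Finset.Icc 1 n, if L i ω = k then 1 else 0 := by
    ext ω
    rw [degree, Finset.card_filter]
  rw [h]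
  refine Finset.measurable_fun_sum _ fun i hi => ?_
  have hi := Finset.mem_Icc.1 hi
  exact Measurable.ite ((measurable_label T L hi.1 hi.2) (measurableSet_singleton k))
    measurable_const measurable_const

theorem history_mono (T L : ℕ → Ω → ℕ) : Monotone (history T L) := by
  intro m n hmn
  refine Measurable.comap_le (Measurable.prodMk ?_ ?_)
  · refine @measurable_pi_lambda _ _ _ (history T L n) _ _ fun i => ?_
    exact (measurable_arrival T (by omega)).mono (arrivalSigma_le_history T L n) le_rfl
  · refine @measurable_pi_lambda _ _ _ (history T L n) _ _ fun i => ?_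
    exact measurable_label T L (by omega) (by omega)

/-- The event that no vertex arrives at time `n`. -/
def noArrival (T : ℕ → Ω → ℕ) (n : ℕ) : Set Ω := {ω | ∀ i, 1 ≤ i → T i ω ≠ n}

theorem measurableSet_noArrival (T : ℕ → Ω → ℕ) (n : ℕ) :
    MeasurableSet[arrivalSigma T] (noArrival T n) := by
  have : noArrival T n = ⋂ i : ℕ, (T (i + 1)) ⁻¹' {n}ᶜ := by
    ext ω
    simp only [noArrival, Set.mem_ofPred_eq, Set.mem_iInter, Set.mem_preimage, Set.mem_compl_iff,
      Set.mem_singleton_iff]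
    exact ⟨fun h i => h _ (by omega), fun h i hi => by
      obtain ⟨j, rfl⟩ : ∃ j, i = j + 1 := ⟨i - 1, by omega⟩
      exact h j⟩
  rw [this]
  exact MeasurableSet.iInter fun i =>
    measurable_arrival T (by omega) (measurableSet_singleton n).compl

/-- The event that the first `r` arrival times are `t 1, …, t r`. -/
def arrivalEvent (T : ℕ → Ω → ℕ) (r : ℕ) (t : ℕ → ℕ) : Set Ω :=
  {ω | ∀ k, 1 ≤ k → k ≤ r → T k ω = t k}

theorem measurableSet_arrivalEvent (T : ℕ → Ω → ℕ) (r : ℕ) (t : ℕ → ℕ) :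
    MeasurableSet[arrivalSigma T] (arrivalEvent T r t) := by
  have : arrivalEvent T r t = ⋂ k ∈ Finset.Icc 1 r, (T k) ⁻¹' {t k} := by
    ext ω
    simp [arrivalEvent]
  rw [this]
  exact Finset.measurableSet_biInter _ fun k hk =>
    measurable_arrival T (Finset.mem_Icc.1 hk).1 (measurableSet_singleton _)

variable [mΩ : MeasurableSpace Ω] {P : Measure Ω} {T L : ℕ → Ω → ℕ}

/-! ### Consequences of the attachment rule -/

namespace IsGraph

theorem history_le (hG : IsGraph 0 T L P) (n : ℕ) : history T L n ≤ mΩ :=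
  Measurable.comap_le (Measurable.prodMk (measurable_pi_lambda _ fun _ => hG.measurable_T _)
    (measurable_pi_lambda _ fun _ => hG.measurable_L _))

theorem arrivalSigma_le (hG : IsGraph 0 T L P) : arrivalSigma T ≤ mΩ :=
  (arrivalSigma_le_history T L 0).trans (hG.history_le 0)

theorem ae_strictMonoOn (hG : IsGraph 0 T L P) :
    ∀ᵐ ω ∂P, StrictMonoOn (fun k => T k ω) (Set.Ici 1) := by
  filter_upwards [hG.arrival_lt] with ω h
  have h' : StrictMono fun k => T (k + 1) ω :=
    strictMono_nat_of_lt_succ fun k => h (k + 1) (by omega)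
  intro i hi j hj hij
  obtain ⟨i, rfl⟩ : ∃ i', i = i' + 1 := ⟨i - 1, by have : 1 ≤ i := hi; omega⟩
  obtain ⟨j, rfl⟩ : ∃ j', j = j' + 1 := ⟨j - 1, by have : 1 ≤ j := hj; omega⟩
  exact h' (by omega)

variable [IsProbabilityMeasure P]

/-- Away from the arrival times, edge ends are attached proportionally to the degrees. -/
theorem lintegral_label (hG : IsGraph 0 T L P) (n : ℕ) {k : ℕ} (hk : 1 ≤ k) {f : Ω → ℝ≥0∞}
    (hf : Measurable[history T L n] f) :
    ∫⁻ ω in noArrival T (n + 1) ∩ L (n + 1) ⁻¹' {k}, f ω ∂P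
      = ∫⁻ ω in noArrival T (n + 1),
          ENNReal.ofReal ((degree (fun i => L i ω) k n : ℝ) / n) * f ω ∂P := by
  have hm := hG.history_le n
  have hgap' := arrivalSigma_le_history T L n _ (measurableSet_noArrival T (n + 1))
  have hgap := hm _ hgap'
  have hL : MeasurableSet (L (n + 1) ⁻¹' {k}) := hG.measurable_L _ (measurableSet_singleton k)
  have hD : Measurable[history T L n]
      (fun ω => ENNReal.ofReal ((degree (fun i => L i ω) k n : ℝ) / n)) := by
    have := measurable_degree T L k n
    exact (measurable_from_top (f := fun d : ℕ => ENNReal.ofReal ((d : ℝ) / n))).comp this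
  have hD' := hD.mono hm le_rfl
  have hf' := hf.mono hm le_rfl
  -- The absence of an arrival at n + 1 is an event of the history, which contains all arrival
  -- times; so the attachment rule can be integrated over its intersection with s.
  have hset : ∀ s, MeasurableSet[history T L n] s →
      P (s ∩ (noArrival T (n + 1) ∩ L (n + 1) ⁻¹' {k}))
        = ∫⁻ ω in s ∩ noArrival T (n + 1),
            ENNReal.ofReal ((degree (fun i => L i ω) k n : ℝ) / n) ∂P := by
    intro s hs
    have hsg := hs.inter hgap'
    have hint : Integrable ((L (n + 1) ⁻¹' {k}).indicator fun _ => (1 : ℝ)) P :=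
      (integrable_const _).indicator hL
    have h1 := setIntegral_condExp hm hint hsg
    have h2 : ∫ ω in s ∩ noArrival T (n + 1),
        (P[(L (n + 1) ⁻¹' {k}).indicator (fun _ => (1 : ℝ)) | history T L n]) ω ∂P
        = ∫ ω in s ∩ noArrival T (n + 1), (degree (fun i => L i ω) k n : ℝ) / n ∂P := by
      refine setIntegral_congr_ae (hm _ hsg) ?_
      filter_upwards [hG.label_other (n + 1) (by omega) k] with ω hω hs
      rw [← biasedProb_zero _ _ hk]
      exact hω hs.2
    rw [h2, setIntegral_indicator hL] at h1
    have hbd : Integrable (fun ω => (degree (fun i => L i ω) k n : ℝ) / n)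
        (P.restrict (s ∩ noArrival T (n + 1))) := by
      refine Integrable.of_bound (C := 1) ?_ (Eventually.of_forall fun ω => ?_)
      · have := (measurable_degree T L k n).mono hm le_rfl
        exact ((measurable_from_top (f := fun d : ℕ => (d : ℝ) / n)).comp this).aestronglyMeasurable
      · rw [Real.norm_of_nonneg (by positivity)]
        exact div_le_one_of_le₀ (by exact_mod_cast degree_le _ _ _) (Nat.cast_nonneg _)
    rw [← ofReal_integral_eq_lintegral_ofReal hbd (Eventually.of_forall fun ω => by positivity),
      h1, Set.inter_assoc]
    simp
  -- Two measures that agree on the history have equal trims, and this extends the identity from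
  -- sets to history-measurable integrands.
  have htrim : (P.restrict (noArrival T (n + 1) ∩ L (n + 1) ⁻¹' {k})).trim hm
      = ((P.restrict (noArrival T (n + 1))).withDensity
          (fun ω => ENNReal.ofReal ((degree (fun i => L i ω) k n : ℝ) / n))).trim hm := by
    refine @Measure.ext _ (history T L n) _ _ fun s hs => ?_
    rw [trim_measurableSet_eq hm hs, trim_measurableSet_eq hm hs,
      Measure.restrict_apply (hm _ hs), withDensity_apply _ (hm _ hs), hset s hs,
      Measure.restrict_restrict (hm _ hs)]
  rw [← lintegral_trim hm hf, htrim, lintegral_trim hm hf,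
    lintegral_withDensity_eq_lintegral_mul _ hD' hf']
  rfl

/-- A vertex has no edge ends before its arrival. -/
theorem ae_degree_eq_zero (hG : IsGraph 0 T L P) :
    ∀ᵐ ω ∂P, ∀ n k, 1 ≤ k → n < T k ω → degree (fun i => L i ω) k n = 0 := by
  -- A vertex of degree 0 is chosen with probability 0 at a time without arrival. Since an arrival
  -- of another vertex carries another label, the degree can leave 0 only at the vertex's own
  -- arrival.
  have h1 : ∀ᵐ ω ∂P, ∀ n k : ℕ, 1 ≤ k → ω ∈ noArrival T (n + 1) → L (n + 1) ω = k →
      degree (fun i => L i ω) k n ≠ 0 := by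
    rw [ae_all_iff]; intro n
    rw [ae_all_iff]; intro k
    by_cases hk : 1 ≤ k
    swap
    · exact Eventually.of_forall fun ω h => absurd h hk
    have hD := measurable_degree T L k n
    have hS : MeasurableSet[history T L n] {ω | degree (fun i => L i ω) k n = 0} :=
      hD (measurableSet_singleton 0)
    have hgap := hG.history_le n _
      (arrivalSigma_le_history T L n _ (measurableSet_noArrival T (n + 1)))
    have hL : MeasurableSet (L (n + 1) ⁻¹' {k}) := hG.measurable_L _ (measurableSet_singleton k)
    have h := hG.lintegral_label n hk (f := Set.indicator {ω | degree (fun i => L i ω) k n = 0} 1)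
      (measurable_const.indicator hS)
    have h0 : ∫⁻ ω in noArrival T (n + 1),
        ENNReal.ofReal ((degree (fun i => L i ω) k n : ℝ) / n)
          * Set.indicator {ω | degree (fun i => L i ω) k n = 0} 1 ω ∂P = 0 := by
      rw [lintegral_eq_zero_of_ae_eq_zero]
      refine Eventually.of_forall fun ω => ?_
      by_cases hω : degree (fun i => L i ω) k n = 0
      · simp [hω]
      · simp [hω]
    rw [h0, lintegral_indicator_one (hG.history_le n _ hS),
      Measure.restrict_apply (hG.history_le n _ hS), measure_eq_zero_iff_ae_notMem] at h
    filter_upwards [h] with ω hω _ hg hl h0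
    exact hω ⟨h0, hg, hl⟩
  filter_upwards [h1, hG.label_arrival] with ω hω hlab n
  induction n with
  | zero => intro k _ _; exact degree_zero _ _
  | succ n ih =>
    intro k hk hn
    rw [degree_succ, ih k hk (by omega), if_neg]
    intro hl
    by_cases hg : ω ∈ noArrival T (n + 1)
    · exact hω n k hk hg hl (ih k hk (by omega))
    · simp only [noArrival, Set.mem_ofPred_eq, not_forall, not_not] at hg
      obtain ⟨i, hi, hTi⟩ := hg
      have := hlab i hi
      rw [hTi, hl] at this
      subst this
      omega

end IsGraph

end

section

/-! ### Factorial moments of the degrees given the arrival times -/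

/-- The product of the rising factorials, of orders `p 0, …, p (r - 1)`, of the degrees of the first
`r` vertices after `n` edge ends. -/
def risingDegree (l : ℕ → ℕ) (p : ℕ → ℕ) (r n : ℕ) : ℕ :=
  ∏ i ∈ Finset.range r, (degree l (i + 1) n).ascFactorial (p i)

/-- The increment of `risingDegree` when an edge end is attached to vertex `k + 1`. -/
def risingIncrement (l : ℕ → ℕ) (p : ℕ → ℕ) (r n k : ℕ) : ℕ :=
  (p k * (degree l (k + 1) n + 1).ascFactorial (p k - 1))
    * ∏ i ∈ (Finset.range r).erase k, (degree l (i + 1) n).ascFactorial (p i)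

/-- The discrete derivative of the rising factorial: for p ≥ 1 the three terms are multiples of (d +
1).ascFactorial (p - 1), with coefficients d + p, d and p. -/
theorem ascFactorial_succ_left (d p : ℕ) :
    (d + 1).ascFactorial p = d.ascFactorial p + p * (d + 1).ascFactorial (p - 1) := by
  cases p with
  | zero => simp
  | succ p =>
    have h : d.ascFactorial (p + 1) = d * (d + 1).ascFactorial p := by
      rw [Nat.ascFactorial_succ, ← Nat.succ_ascFactorial]
    rw [Nat.add_sub_cancel, Nat.ascFactorial_succ, h]
    ring

theorem mul_ascFactorial_pred (d p : ℕ) :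
    d * (p * (d + 1).ascFactorial (p - 1)) = p * d.ascFactorial p := by
  cases p with
  | zero => simp
  | succ p =>
    rw [Nat.add_sub_cancel, Nat.ascFactorial_succ, ← Nat.succ_ascFactorial]
    ring

/-- This is the reason for using rising factorials: the increment weighted by the degree is a
multiple of the product itself, so the recursion for the mean closes. The truncated p k - 1 at p k =
0 is harmless because of the factor p k. -/
theorem degree_mul_risingIncrement (l p : ℕ → ℕ) (n : ℕ) {r k : ℕ} (hk : k < r) :
    degree l (k + 1) n * risingIncrement l p r n k = p k * risingDegree l p r n := by
  rw [risingIncrement, risingDegree, ← mul_assoc, mul_ascFactorial_pred,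
    ← Finset.mul_prod_erase _ _ (Finset.mem_range.2 hk), mul_assoc]

theorem risingDegree_succ (l p : ℕ → ℕ) (n : ℕ) {r : ℕ} :
    risingDegree l p r (n + 1) = risingDegree l p r n
      + ∑ k ∈ Finset.range r, if l (n + 1) = k + 1 then risingIncrement l p r n k else 0 := by
  by_cases h : ∃ k ∈ Finset.range r, l (n + 1) = k + 1
  · obtain ⟨k, hk, hlk⟩ := h
    have h0 : ∀ i ∈ Finset.range r, i ≠ k →
        (if l (n + 1) = i + 1 then risingIncrement l p r n i else 0) = 0 :=
      fun i _ hik => if_neg (by omega)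
    rw [Finset.sum_eq_single_of_mem k hk h0, if_pos hlk, risingDegree, risingDegree,
      ← Finset.mul_prod_erase _ _ hk, ← Finset.mul_prod_erase _ _ hk, degree_succ, if_pos hlk,
      ascFactorial_succ_left, risingIncrement, add_mul]
    have : ∏ i ∈ (Finset.range r).erase k, (degree l (i + 1) (n + 1)).ascFactorial (p i)
        = ∏ i ∈ (Finset.range r).erase k, (degree l (i + 1) n).ascFactorial (p i) := by
      refine Finset.prod_congr rfl fun i hi => ?_
      rw [degree_succ, if_neg (by have := Finset.ne_of_mem_erase hi; omega), add_zero]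
    rw [this]
  · push Not at h
    rw [Finset.sum_eq_zero fun k hk => if_neg (h k hk), add_zero]
    refine Finset.prod_congr rfl fun i hi => ?_
    rw [degree_succ, if_neg (h i hi), add_zero]

variable {Ω : Type*}

theorem measurable_risingDegree (T L : ℕ → Ω → ℕ) (p : ℕ → ℕ) (r n : ℕ) :
    Measurable[history T L n] fun ω => risingDegree (fun i => L i ω) p r n :=
  Finset.measurable_fun_prod _ fun i _ =>
    (measurable_from_top (f := fun d : ℕ => d.ascFactorial (p i))).comp
      (measurable_degree T L (i + 1) n)

theorem measurable_risingIncrement (T L : ℕ → Ω → ℕ) (p : ℕ → ℕ) (r n k : ℕ) :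
    Measurable[history T L n] fun ω => risingIncrement (fun i => L i ω) p r n k :=
  ((measurable_from_top (f := fun d : ℕ => p k * (d + 1).ascFactorial (p k - 1))).comp
    (measurable_degree T L (k + 1) n)).fun_mul (Finset.measurable_fun_prod _ fun i _ =>
    (measurable_from_top (f := fun d : ℕ => d.ascFactorial (p i))).comp
      (measurable_degree T L (i + 1) n))

/-- The growth factor `1 + q / m` of the mean of a rising factorial of total order `q` from time
`m` to `m + 1`; it is `1` if a vertex arrives at time `m + 1`. -/
def growth (T : ℕ → Ω → ℕ) (q m : ℕ) (ω : Ω) : ℝ≥0∞ :=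
  1 + (noArrival T (m + 1)).indicator (fun _ => (q : ℝ≥0∞) / m) ω

theorem measurable_growth (T : ℕ → Ω → ℕ) (q m : ℕ) : Measurable[arrivalSigma T] (growth T q m) :=
  measurable_const.fun_add (measurable_const.indicator (measurableSet_noArrival T (m + 1)))

variable [mΩ : MeasurableSpace Ω] {P : Measure Ω} {T L : ℕ → Ω → ℕ} {r : ℕ} {t : ℕ → ℕ}

namespace IsGraph

variable [IsProbabilityMeasure P]

/-- The weight g, an arbitrary function of the arrival times, expresses conditioning on all of them.
At a step without arrival, vertex k + 1 contributes the fraction p k / n of the product, and these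
fractions add up to q / n; a new arrival touches none of the first r vertices. -/
theorem lintegral_risingDegree_succ (hG : IsGraph 0 T L P) (ht : IsArrivalPrefix r t) (hr : 1 ≤ r)
    (p : ℕ → ℕ) {n : ℕ} (hn : t r ≤ n) {g : Ω → ℝ≥0∞} (hg : Measurable[arrivalSigma T] g)
    (hg0 : ∀ ω ∉ arrivalEvent T r t, g ω = 0) :
    ∫⁻ ω, g ω * risingDegree (fun i => L i ω) p r (n + 1) ∂P
      = ∫⁻ ω, (g ω * growth T (∑ k ∈ Finset.range r, p k) n ω)
          * risingDegree (fun i => L i ω) p r n ∂P := by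
  have hcast : Measurable fun d : ℕ => (d : ℝ≥0∞) := measurable_from_top
  have hgH : Measurable[history T L n] g := hg.mono (arrivalSigma_le_history T L n) le_rfl
  have hgm : Measurable g := hg.mono hG.arrivalSigma_le le_rfl
  have hXH : Measurable[history T L n]
      fun ω => (risingDegree (fun i => L i ω) p r n : ℝ≥0∞) :=
    hcast.comp (measurable_risingDegree T L p r n)
  have hXm := hXH.mono (hG.history_le n) le_rfl
  have hYH : ∀ k, Measurable[history T L n]
      fun ω => g ω * (risingIncrement (fun i => L i ω) p r n k : ℝ≥0∞) := fun k =>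
    hgH.fun_mul (hcast.comp (measurable_risingIncrement T L p r n k))
  have hYm := fun k => (hYH k).mono (hG.history_le n) le_rfl
  have hgap : MeasurableSet (noArrival T (n + 1)) :=
    hG.arrivalSigma_le _ (measurableSet_noArrival T (n + 1))
  have hset : ∀ k, MeasurableSet (noArrival T (n + 1) ∩ L (n + 1) ⁻¹' {k}) := fun k =>
    hgap.inter (hG.measurable_L _ (measurableSet_singleton k))
  have hpt : ∀ᵐ ω ∂P, g ω * (risingDegree (fun i => L i ω) p r (n + 1) : ℝ≥0∞)
      = g ω * risingDegree (fun i => L i ω) p r n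
        + ∑ k ∈ Finset.range r, (noArrival T (n + 1) ∩ L (n + 1) ⁻¹' {k + 1}).indicator
            (fun ω => g ω * (risingIncrement (fun i => L i ω) p r n k : ℝ≥0∞)) ω := by
    filter_upwards [hG.label_arrival, hG.ae_strictMonoOn] with ω hlab hmono
    by_cases hA : ω ∈ arrivalEvent T r t
    swap
    · have h0 : ∀ s : Set Ω, ∀ k, s.indicator
          (fun ω => g ω * (risingIncrement (fun i => L i ω) p r n k : ℝ≥0∞)) ω = 0 := fun s k => by
        by_cases hs : ω ∈ s <;> simp [hs, hg0 ω hA]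
      simp [hg0 ω hA, h0]
    rw [risingDegree_succ]
    push_cast
    rw [mul_add, Finset.mul_sum]
    congr 1
    refine Finset.sum_congr rfl fun k hk => ?_
    have hk := Finset.mem_range.1 hk
    by_cases hl : L (n + 1) ω = k + 1
    -- An arrival at a time beyond t r carries a label beyond r, so the label k + 1 ≤ r excludes an
    -- arrival.
    · have : ω ∈ noArrival T (n + 1) := by
        intro i hi hTi
        have h1 := hlab i hi
        rw [hTi, hl] at h1
        have h2 : T r ω = t r := hA r hr le_rfl
        have h3 : T i ω ≤ T r ω := hmono.monotoneOn hi hr (by omega)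
        omega
      simp [this, hl]
    · simp [hl]
  rw [lintegral_congr_ae hpt, lintegral_add_left (hgm.fun_mul hXm),
    lintegral_finsetSum _ fun k _ => (hYm (k)).indicator (hset (k + 1))]
  have hterm : ∀ k ∈ Finset.range r,
      ∫⁻ ω, (noArrival T (n + 1) ∩ L (n + 1) ⁻¹' {k + 1}).indicator
            (fun ω => g ω * (risingIncrement (fun i => L i ω) p r n k : ℝ≥0∞)) ω ∂P
        = ∫⁻ ω, g ω * (noArrival T (n + 1)).indicator (fun _ => (p k : ℝ≥0∞) / n) ω
            * risingDegree (fun i => L i ω) p r n ∂P := by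
    intro k hk
    have hk := Finset.mem_range.1 hk
    rw [lintegral_indicator (hset _), hG.lintegral_label n (by omega) (hYH k),
      ← lintegral_indicator hgap]
    refine lintegral_congr fun ω => ?_
    by_cases hω : ω ∈ noArrival T (n + 1)
    · simp only [Set.indicator_of_mem hω]
      have h1 := degree_mul_risingIncrement (fun i => L i ω) p n hk
      have h2 : (degree (fun i => L i ω) (k + 1) n : ℝ≥0∞)
          * risingIncrement (fun i => L i ω) p r n k
          = p k * risingDegree (fun i => L i ω) p r n := by
        exact_mod_cast h1
      have hn0 : (0 : ℝ) < n := by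
        have := ht.one_le hr le_rfl
        exact_mod_cast this.trans hn
      rw [ENNReal.ofReal_div_of_pos hn0, ENNReal.ofReal_natCast, ENNReal.ofReal_natCast,
        div_eq_mul_inv, div_eq_mul_inv]
      calc _ = g ω * (n : ℝ≥0∞)⁻¹ * ((degree (fun i => L i ω) (k + 1) n : ℝ≥0∞)
          * risingIncrement (fun i => L i ω) p r n k) := by ring
        _ = _ := by rw [h2]; ring
    · simp [Set.indicator_of_notMem hω]
  rw [Finset.sum_congr rfl hterm]
  have hind : ∀ k, Measurable fun ω =>
      g ω * (noArrival T (n + 1)).indicator (fun _ => (p k : ℝ≥0∞) / n) ω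
            * risingDegree (fun i => L i ω) p r n := fun k =>
    (hgm.fun_mul (measurable_const.indicator hgap)).fun_mul hXm
  rw [← lintegral_finsetSum _ fun k _ => hind k, ← lintegral_add_left (hgm.fun_mul hXm)]
  refine lintegral_congr fun ω => ?_
  have : ∑ k ∈ Finset.range r, (noArrival T (n + 1)).indicator (fun _ => (p k : ℝ≥0∞) / n) ω
      = (noArrival T (n + 1)).indicator
        (fun _ => ((∑ k ∈ Finset.range r, p k : ℕ) : ℝ≥0∞) / n) ω := by
    by_cases hω : ω ∈ noArrival T (n + 1)
    · simp only [Set.indicator_of_mem hω]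
      push_cast
      simp_rw [div_eq_mul_inv, Finset.sum_mul]
    · simp [Set.indicator_of_notMem hω]
  rw [growth, ← this, ← Finset.sum_mul, ← Finset.mul_sum]
  ring

/-- Iterates the one-step identity; as g is arbitrary, each growth factor can be absorbed into it.
-/
theorem lintegral_risingDegree (hG : IsGraph 0 T L P) (ht : IsArrivalPrefix r t) (hr : 1 ≤ r)
    (p : ℕ → ℕ) {n : ℕ} (hn : t r ≤ n) {g : Ω → ℝ≥0∞} (hg : Measurable[arrivalSigma T] g)
    (hg0 : ∀ ω ∉ arrivalEvent T r t, g ω = 0) :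
    ∫⁻ ω, g ω * risingDegree (fun i => L i ω) p r n ∂P
      = ∫⁻ ω, (g ω * ∏ m ∈ Finset.Ico (t r) n, growth T (∑ k ∈ Finset.range r, p k) m ω)
          * risingDegree (fun i => L i ω) p r (t r) ∂P := by
  induction n, hn using Nat.le_induction generalizing g with
  | base => simp
  | succ n hn ih =>
    rw [hG.lintegral_risingDegree_succ ht hr p hn hg hg0,
      ih (hg.fun_mul (measurable_growth T _ n)) fun ω hω => by simp [hg0 ω hω]]
    simp_rw [Finset.prod_Ico_succ_top hn]
    refine lintegral_congr fun ω => ?_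
    ring

/-- Induction on the number of vertices. No arrival falls strictly between t r and t (r + 1), so on
the event where g lives all growth factors are deterministic and multiply as in
`arrivalMoment_succ`. -/
theorem lintegral_risingDegree_arrival (hG : IsGraph 0 T L P) (ht : IsArrivalPrefix r t)
    (hr : 1 ≤ r) (p : ℕ → ℕ) {g : Ω → ℝ≥0∞} (hg : Measurable[arrivalSigma T] g)
    (hg0 : ∀ ω ∉ arrivalEvent T r t, g ω = 0) :
    ∫⁻ ω, g ω * risingDegree (fun i => L i ω) p r (t r) ∂P
      = ENNReal.ofReal (arrivalMoment t p r) * ∫⁻ ω, g ω ∂P := by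
  have hgm : Measurable g := hg.mono hG.arrivalSigma_le le_rfl
  induction r, hr using Nat.le_induction generalizing g with
  | base =>
    rw [← lintegral_const_mul _ hgm]
    refine lintegral_congr_ae ?_
    filter_upwards [hG.label_arrival, hG.first_arrival] with ω hlab h1
    have hl : L 1 ω = 1 := by simpa [h1] using hlab 1 le_rfl
    rw [arrivalMoment_one ht.1, ht.1, risingDegree, Finset.prod_range_one, degree_succ,
      degree_zero, zero_add, if_pos hl, Nat.one_ascFactorial, ENNReal.ofReal_natCast, mul_comm]
  | succ r hr ih =>
    have hlt : t r < t (r + 1) := ht.2 ⟨hr, by omega⟩ ⟨by omega, le_rfl⟩ (by omega)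
    obtain ⟨N, hN⟩ : ∃ N, t (r + 1) = N + 1 := ⟨t (r + 1) - 1, by omega⟩
    have hN1 : t r ≤ N := by omega
    have ht' := ht.mono (Nat.le_succ r)
    have htr1 := ht'.one_le hr le_rfl
    have hg0' : ∀ ω ∉ arrivalEvent T r t, g ω = 0 := fun ω hω =>
      hg0 ω fun h => hω fun k h1 hk => h k h1 (by omega)
    set q := ∑ k ∈ Finset.range r, p k
    have hpt : ∀ᵐ ω ∂P, g ω * (risingDegree (fun i => L i ω) p (r + 1) (t (r + 1)) : ℝ≥0∞)
        = (p r)! * (g ω * risingDegree (fun i => L i ω) p r N) := by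
      filter_upwards [hG.label_arrival, hG.ae_degree_eq_zero] with ω hlab hdeg
      by_cases hA : ω ∈ arrivalEvent T (r + 1) t
      swap
      · simp [hg0 ω hA]
      have hT : T (r + 1) ω = N + 1 := (hA _ (by omega) le_rfl).trans hN
      have hl : L (N + 1) ω = r + 1 := hT ▸ hlab (r + 1) (by omega)
      have hd : degree (fun i => L i ω) (r + 1) N = 0 := hdeg N (r + 1) (by omega) (by omega)
      have : risingDegree (fun i => L i ω) p (r + 1) (N + 1)
          = risingDegree (fun i => L i ω) p r N * (p r)! := by
        rw [risingDegree, Finset.prod_range_succ, degree_succ _ (r + 1), hd, if_pos hl, zero_add,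
          Nat.one_ascFactorial, risingDegree]
        congr 1
        refine Finset.prod_congr rfl fun i hi => ?_
        have hi := Finset.mem_range.1 hi
        rw [degree_succ, if_neg (by omega), add_zero]
      rw [hN, this]
      push_cast
      ring
    have hm : Measurable fun ω => g ω * (risingDegree (fun i => L i ω) p r N : ℝ≥0∞) :=
      hgm.fun_mul ((measurable_from_top (f := fun d : ℕ => (d : ℝ≥0∞))).comp
        ((measurable_risingDegree T L p r N).mono (hG.history_le N) le_rfl))
    have hgrow : ∀ᵐ ω ∂P, g ω * ∏ m ∈ Finset.Ico (t r) N, growth T q m ω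
        = ENNReal.ofReal (∏ m ∈ Finset.Ico (t r) N, (1 + (q : ℝ) / m)) * g ω := by
      filter_upwards [hG.ae_strictMonoOn] with ω hmono
      by_cases hA : ω ∈ arrivalEvent T (r + 1) t
      swap
      · simp [hg0 ω hA]
      rw [mul_comm, ENNReal.ofReal_prod_of_nonneg fun m _ => by positivity]
      congr 1
      refine Finset.prod_congr rfl fun m hm => ?_
      have hm := Finset.mem_Ico.1 hm
      have hω : ω ∈ noArrival T (m + 1) := by
        intro i hi hTi
        have h1 : T r ω = t r := hA r hr (by omega)
        have h2 : T (r + 1) ω = N + 1 := (hA _ (by omega) le_rfl).trans hN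
        rcases Nat.lt_or_ge r i with h | h
        · have : T (r + 1) ω ≤ T i ω := hmono.monotoneOn (by simp) hi h
          omega
        · have : T i ω ≤ T r ω := hmono.monotoneOn hi hr h
          omega
      have hm0 : (0 : ℝ) < m := by exact_mod_cast htr1.trans hm.1
      rw [growth, Set.indicator_of_mem hω, ENNReal.ofReal_add zero_le_one (by positivity),
        ENNReal.ofReal_one, ENNReal.ofReal_div_of_pos hm0, ENNReal.ofReal_natCast,
        ENNReal.ofReal_natCast]
    rw [lintegral_congr_ae hpt, lintegral_const_mul _ hm,
      hG.lintegral_risingDegree ht' hr p hN1 hg hg0',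
      lintegral_congr_ae (hgrow.mono fun ω hω => by simp only [q] at hω; rw [hω]),
      ih ht' (hg.const_mul _) (fun ω hω => by simp [hg0' ω hω]) (hgm.const_mul _),
      lintegral_const_mul _ hgm, arrivalMoment_succ hr ht, hN, Nat.add_sub_cancel,
      ENNReal.ofReal_mul (by positivity), ENNReal.ofReal_mul (by positivity),
      ENNReal.ofReal_natCast]
    ring

end IsGraph

end

section

/-! ### The law of the arrival times -/

variable {Ω : Type*}

theorem arrivalEvent_update (T : ℕ → Ω → ℕ) (r n : ℕ) (t : ℕ → ℕ) :
    arrivalEvent T (r + 1) (Function.update t (r + 1) (n + 1))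
      = arrivalEvent T r t ∩ {ω | T (r + 1) ω = n + 1} := by
  ext ω
  constructor
  · intro h
    refine ⟨fun k h1 hk => ?_, ?_⟩
    · rw [h k h1 (by omega), Function.update_of_ne (by omega)]
    · have := h (r + 1) (by omega) le_rfl
      rwa [Function.update_self] at this
  · rintro ⟨h1, h2⟩ k hk1 hk
    rcases eq_or_ne k (r + 1) with rfl | hk2
    · rw [Function.update_self]; exact h2
    · rw [Function.update_of_ne hk2]; exact h1 k hk1 (by omega)

variable [mΩ : MeasurableSpace Ω] {P : Measure Ω} {T L : ℕ → Ω → ℕ} {r : ℕ} {t : ℕ → ℕ}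
  {β : ℝ}

theorem ae_mem_arrivalEvent_iff (hG : IsGraph 0 T L P) {s : ℕ} (ht : IsArrivalPrefix (s + 1) t) :
    ∀ᵐ ω ∂P, ω ∈ arrivalEvent T (s + 1) t
      ↔ ∀ k < s, T (k + 2) ω - T (k + 1) ω = t (k + 2) - t (k + 1) := by
  filter_upwards [hG.first_arrival, hG.arrival_lt] with ω h1 hlt
  constructor
  · intro h k hk
    rw [h (k + 2) (by omega) (by omega), h (k + 1) (by omega) (by omega)]
  · intro h k hk1 hks
    induction k, hk1 using Nat.le_induction with
    | base => rw [h1, ht.1]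
    | succ k hk1 ih =>
      obtain ⟨i, rfl⟩ : ∃ i, k = i + 1 := ⟨k - 1, by omega⟩
      have a1 := h i (by omega)
      have a2 := ih (by omega)
      have a3 := hlt (i + 1) (by omega)
      have a4 : t (i + 1) < t (i + 2) := ht.2 ⟨by omega, by omega⟩ ⟨by omega, hks⟩ (by omega)
      change T (i + 2) ω = t (i + 2)
      have a3 : T (i + 1) ω < T (i + 2) ω := a3
      omega

namespace GeometricInterarrivals

theorem measure_arrivalEvent (hT : GeometricInterarrivals β T P) (hG : IsGraph 0 T L P) {s : ℕ}
    (ht : IsArrivalPrefix (s + 1) t) :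
    P (arrivalEvent T (s + 1) t) = ∏ k ∈ Finset.range s,
      P ((fun ω => T (k + 2) ω - T (k + 1) ω) ⁻¹' {t (k + 2) - t (k + 1)}) := by
  rw [← hT.indep.measure_inter_preimage_eq_mul _ (sets := fun k => {t (k + 2) - t (k + 1)})
    fun _ _ => measurableSet_singleton _]
  refine measure_congr ?_
  filter_upwards [ae_mem_arrivalEvent_iff hG ht] with ω hω
  refine propext (hω.trans ?_)
  change _ ↔ ω ∈ ⋂ i ∈ Finset.range s, _
  simp

/-- Up to null sets the prefix of length s + 1 is determined by the gaps of index below s, and the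
gap of index s is independent of those. -/
theorem measure_arrivalEvent_inter (hT : GeometricInterarrivals β T P) (hG : IsGraph 0 T L P)
    {s : ℕ} (ht : IsArrivalPrefix (s + 1) t) (S : Set ℕ) :
    P (arrivalEvent T (s + 1) t ∩ (fun ω => T (s + 2) ω - T (s + 1) ω) ⁻¹' S)
      = P (arrivalEvent T (s + 1) t) * P ((fun ω => T (s + 2) ω - T (s + 1) ω) ⁻¹' S) := by
  have h := hT.indep.measure_inter_preimage_eq_mul (Finset.range (s + 1))
    (sets := fun k => if k = s then S else {t (k + 2) - t (k + 1)}) fun _ _ => .of_discrete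
  rw [hT.measure_arrivalEvent hG ht]
  have e : ∀ k ∈ Finset.range s,
      P ((fun ω => T (k + 2) ω - T (k + 1) ω) ⁻¹'
        (if k = s then S else {t (k + 2) - t (k + 1)}))
      = P ((fun ω => T (k + 2) ω - T (k + 1) ω) ⁻¹' {t (k + 2) - t (k + 1)}) := fun k hk => by
    rw [if_neg (by have := Finset.mem_range.1 hk; omega)]
  rw [Finset.prod_range_succ, Finset.prod_congr rfl e, if_pos rfl] at h
  rw [← h]
  refine measure_congr ?_
  filter_upwards [ae_mem_arrivalEvent_iff hG ht] with ω hω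
  refine propext ?_
  change (ω ∈ _ ∧ ω ∈ _) ↔ ω ∈ ⋂ i ∈ Finset.range (s + 1), _
  rw [hω]
  simp only [Set.mem_preimage, Set.mem_iInter, Finset.mem_range]
  constructor
  · rintro ⟨h1, h2⟩ k hk
    split_ifs with hks
    · subst hks; exact h2
    · exact h1 k (by omega)
  · intro h1
    refine ⟨fun k hk => ?_, ?_⟩
    · have := h1 k (by omega)
      rwa [if_neg (by omega)] at this
    · have := h1 s (by omega)
      rwa [if_pos rfl] at this

theorem measure_arrivalEvent_ne_zero (hT : GeometricInterarrivals β T P) (hG : IsGraph 0 T L P)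
    (h0 : 0 < β) (h1 : β < 1) (hr : 1 ≤ r) (ht : IsArrivalPrefix r t) :
    P (arrivalEvent T r t) ≠ 0 := by
  obtain ⟨s, rfl⟩ : ∃ s, r = s + 1 := ⟨r - 1, by omega⟩
  rw [hT.measure_arrivalEvent hG ht]
  refine Finset.prod_ne_zero_iff.2 fun k hk => ?_
  have hk := Finset.mem_range.1 hk
  have hlt : t (k + 1) < t (k + 2) := ht.2 ⟨by omega, by omega⟩ ⟨by omega, by omega⟩ (by omega)
  obtain ⟨m, hm⟩ : ∃ m, t (k + 2) - t (k + 1) = m + 1 := ⟨t (k + 2) - t (k + 1) - 1, by omega⟩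
  have := hT.law k m
  change P ((fun ω => T (k + 2) ω - T (k + 1) ω) ⁻¹' {m + 1}) = _ at this
  rw [hm, this]
  have : 0 < 1 - β := sub_pos.2 h1
  simpa using (by positivity : 0 < β * (1 - β) ^ m)

theorem measure_gap_gt [IsProbabilityMeasure P] (hT : GeometricInterarrivals β T P)
    (hG : IsGraph 0 T L P) (h0 : 0 < β) (h1 : β < 1) (k m : ℕ) :
    P ((fun ω => T (k + 2) ω - T (k + 1) ω) ⁻¹' Set.Ioi m) = ENNReal.ofReal ((1 - β) ^ m) := by
  have hm : Measurable fun ω => T (k + 2) ω - T (k + 1) ω :=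
    (hG.measurable_T _).sub (hG.measurable_T _)
  have hσ : 0 < 1 - β := sub_pos.2 h1
  induction m with
  | zero =>
    rw [pow_zero, ENNReal.ofReal_one, prob_compl_eq_zero_iff (hm measurableSet_Ioi) |>.symm,
      measure_eq_zero_iff_ae_notMem]
    filter_upwards [hG.arrival_lt] with ω hω
    have : T (k + 1) ω < T (k + 2) ω := hω (k + 1) (by omega)
    simpa using this
  | succ m ih =>
    have hdisj : Disjoint ((fun ω => T (k + 2) ω - T (k + 1) ω) ⁻¹' {m + 1})
        ((fun ω => T (k + 2) ω - T (k + 1) ω) ⁻¹' Set.Ioi (m + 1)) :=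
      Disjoint.preimage _ (by simp)
    have hun : (fun ω => T (k + 2) ω - T (k + 1) ω) ⁻¹' {m + 1}
        ∪ (fun ω => T (k + 2) ω - T (k + 1) ω) ⁻¹' Set.Ioi (m + 1)
        = (fun ω => T (k + 2) ω - T (k + 1) ω) ⁻¹' Set.Ioi m := by
      rw [← Set.preimage_union]
      congr 1
      ext x
      simp only [Set.mem_union, Set.mem_singleton_iff, Set.mem_Ioi]
      omega
    have hadd := measure_union (μ := P) hdisj (hm measurableSet_Ioi)
    have hl := hT.law k m
    change P ((fun ω => T (k + 2) ω - T (k + 1) ω) ⁻¹' {m + 1}) = _ at hl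
    rw [hun, ih, hl] at hadd
    have e : ENNReal.ofReal ((1 - β) ^ m)
        = ENNReal.ofReal (β * (1 - β) ^ m) + ENNReal.ofReal ((1 - β) ^ (m + 1)) := by
      rw [← ENNReal.ofReal_add (by positivity) (by positivity)]
      ring_nf
    exact (ENNReal.add_right_inj ENNReal.ofReal_ne_top).1 (hadd.symm.trans e)

theorem measure_arrivalEvent_inter_gt [IsProbabilityMeasure P]
    (hT : GeometricInterarrivals β T P) (hG : IsGraph 0 T L P) (h0 : 0 < β) (h1 : β < 1)
    (hr : 1 ≤ r) (ht : IsArrivalPrefix r t) {n : ℕ} (hn : t r ≤ n) :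
    P (arrivalEvent T r t ∩ {ω | n < T (r + 1) ω})
      = P (arrivalEvent T r t) * ENNReal.ofReal (1 - β) ^ (n - t r) := by
  obtain ⟨s, rfl⟩ : ∃ s, r = s + 1 := ⟨r - 1, by omega⟩
  rw [← ENNReal.ofReal_pow (sub_nonneg.2 h1.le), ← hT.measure_gap_gt hG h0 h1 s,
    ← hT.measure_arrivalEvent_inter hG ht]
  congr 1
  ext ω
  simp only [Set.mem_inter_iff, Set.mem_ofPred_eq, Set.mem_preimage, Set.mem_Ioi]
  refine and_congr_right fun hω => ?_
  rw [hω (s + 1) (by omega) le_rfl]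
  change n < T (s + 2) ω ↔ _
  omega

end GeometricInterarrivals

theorem IsArrivalPrefix.update (ht : IsArrivalPrefix r t) (hr : 1 ≤ r) {n : ℕ} (hn : t r ≤ n) :
    IsArrivalPrefix (r + 1) (Function.update t (r + 1) (n + 1)) := by
  refine ⟨by rw [Function.update_of_ne (by omega), ht.1], fun i hi j hj hij => ?_⟩
  have hi2 : i ≠ r + 1 := by have := hj.2; omega
  rw [Function.update_of_ne hi2]
  rcases eq_or_ne j (r + 1) with rfl | hj2
  · rw [Function.update_self]
    have : t i ≤ t r := ht.2.monotoneOn ⟨hi.1, by omega⟩ ⟨hr, le_rfl⟩ (by omega)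
    omega
  · rw [Function.update_of_ne hj2]
    exact ht.2 ⟨hi.1, by have := hi.2; omega⟩ ⟨hj.1, by have := hj.2; omega⟩ hij

namespace GeometricInterarrivals

theorem measure_arrivalEvent_update (hT : GeometricInterarrivals β T P)
    (hG : IsGraph 0 T L P) (h0 : 0 < β) (h1 : β < 1)
    (hr : 1 ≤ r) (ht : IsArrivalPrefix r t) {n : ℕ} (hn : t r ≤ n) :
    P (arrivalEvent T (r + 1) (Function.update t (r + 1) (n + 1)))
      = P (arrivalEvent T r t) * (ENNReal.ofReal β * ENNReal.ofReal (1 - β) ^ (n - t r)) := by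
  obtain ⟨s, rfl⟩ : ∃ s, r = s + 1 := ⟨r - 1, by omega⟩
  have hl := hT.law s (n - t (s + 1))
  change P ((fun ω => T (s + 2) ω - T (s + 1) ω) ⁻¹' {n - t (s + 1) + 1}) = _ at hl
  rw [← ENNReal.ofReal_pow (sub_nonneg.2 h1.le), ← ENNReal.ofReal_mul h0.le, ← hl,
    ← hT.measure_arrivalEvent_inter hG ht, arrivalEvent_update]
  congr 1
  ext ω
  simp only [Set.mem_inter_iff, Set.mem_ofPred_eq, Set.mem_preimage, Set.mem_singleton_iff]
  refine and_congr_right fun hω => ?_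
  rw [hω (s + 1) (by omega) le_rfl]
  change T (s + 2) ω = n + 1 ↔ _
  omega

open Classical in
/-- Given the first `r` arrival times, arrivals at later times are independent events of
probability `β`. -/
theorem lintegral_prod_arrival [IsProbabilityMeasure P]
    (hT : GeometricInterarrivals β T P) (hG : IsGraph 0 T L P) (h0 : 0 < β) (h1 : β < 1)
    (a b : ℕ → ℝ≥0∞) (N : ℕ) {n : ℕ} (hnN : n ≤ N) (hr : 1 ≤ r) (ht : IsArrivalPrefix r t)
    (hn : t r ≤ n) :
    ∫⁻ ω in arrivalEvent T r t ∩ {ω | n < T (r + 1) ω},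
        ∏ m ∈ Finset.Ico n N, (if ω ∈ noArrival T (m + 1) then b m else a m) ∂P
      = P (arrivalEvent T r t) * ENNReal.ofReal (1 - β) ^ (n - t r)
        * ∏ m ∈ Finset.Ico n N, (ENNReal.ofReal β * a m + ENNReal.ofReal (1 - β) * b m) := by
  have hA : ∀ r t, MeasurableSet (arrivalEvent T r t) := fun r t =>
    hG.arrivalSigma_le _ (measurableSet_arrivalEvent T r t)
  have hgt : ∀ r n, MeasurableSet {ω | n < T r ω} := fun r n =>
    hG.measurable_T r measurableSet_Ioi
  -- Backward induction in n, for all prefixes at once. If no further arrival has occurred up to n,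
  -- then time n + 1 either is arrival r + 1, which extends the prefix by n + 1 and has weight β, or
  -- is free, with weight 1 - β.
  induction hnN using Nat.decreasingInduction generalizing r t with
  | self => simp [hT.measure_arrivalEvent_inter_gt hG h0 h1 hr ht hn]
  | of_succ n hnN ih =>
    have hnN : n < N := hnN
    have hfm : ∀ n, Measurable fun ω => ∏ m ∈ Finset.Ico n N,
        (if ω ∈ noArrival T (m + 1) then b m else a m) := fun n =>
      Finset.measurable_fun_prod _ fun m _ => Measurable.ite
        (hG.arrivalSigma_le _ (measurableSet_noArrival T (m + 1))) measurable_const measurable_const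
    set t' := Function.update t (r + 1) (n + 1) with ht'
    have hp' : IsArrivalPrefix (r + 1) t' := ht.update hr hn
    have ht'r : t' (r + 1) = n + 1 := Function.update_self ..
    have hae : (arrivalEvent T r t ∩ {ω | n < T (r + 1) ω} : Set Ω) =ᵐ[P]
        ((arrivalEvent T (r + 1) t' ∩ {ω | n + 1 < T (r + 2) ω})
          ∪ (arrivalEvent T r t ∩ {ω | n + 1 < T (r + 1) ω}) : Set Ω) := by
      filter_upwards [hG.arrival_lt] with ω hω
      refine propext ?_
      change (ω ∈ arrivalEvent T r t ∧ n < T (r + 1) ω) ↔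
        ((ω ∈ arrivalEvent T (r + 1) t' ∧ n + 1 < T (r + 2) ω)
          ∨ (ω ∈ arrivalEvent T r t ∧ n + 1 < T (r + 1) ω))
      rw [ht', arrivalEvent_update]
      have hlt : T (r + 1) ω < T (r + 2) ω := hω (r + 1) (by omega)
      constructor
      · rintro ⟨h2, h3⟩
        rcases Nat.lt_or_ge (n + 1) (T (r + 1) ω) with h4 | h4
        · exact Or.inr ⟨h2, h4⟩
        · have h5 : T (r + 1) ω = n + 1 := by omega
          exact Or.inl ⟨⟨h2, h5⟩, by omega⟩
      · rintro (⟨⟨h2, h3⟩, h4⟩ | ⟨h2, h3⟩)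
        · have h3 : T (r + 1) ω = n + 1 := h3
          exact ⟨h2, by omega⟩
        · exact ⟨h2, by omega⟩
    have hdisj : Disjoint (arrivalEvent T (r + 1) t' ∩ {ω | n + 1 < T (r + 2) ω})
        (arrivalEvent T r t ∩ {ω | n + 1 < T (r + 1) ω}) := by
      rw [Set.disjoint_left]
      rintro ω ⟨h2, _⟩ ⟨_, h3⟩
      rw [ht', arrivalEvent_update] at h2
      have h4 : T (r + 1) ω = n + 1 := h2.2
      have h3 : n + 1 < T (r + 1) ω := h3
      omega
    rw [setLIntegral_congr hae, lintegral_union ((hA _ _).inter (hgt _ _)) hdisj]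
    have e1 : ∫⁻ ω in arrivalEvent T (r + 1) t' ∩ {ω | n + 1 < T (r + 2) ω},
        ∏ m ∈ Finset.Ico n N, (if ω ∈ noArrival T (m + 1) then b m else a m) ∂P
        = a n * ∫⁻ ω in arrivalEvent T (r + 1) t' ∩ {ω | n + 1 < T (r + 2) ω},
        ∏ m ∈ Finset.Ico (n + 1) N, (if ω ∈ noArrival T (m + 1) then b m else a m) ∂P := by
      rw [← lintegral_const_mul _ (hfm _)]
      refine setLIntegral_congr_fun ((hA _ _).inter (hgt _ _)) fun ω hω => ?_
      rw [Finset.prod_eq_prod_Ico_succ_bot hnN, if_neg]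
      intro h
      refine h (r + 1) (by omega) ?_
      rw [← ht'r]
      exact hω.1 _ (by omega) le_rfl
    have e2 : ∫⁻ ω in arrivalEvent T r t ∩ {ω | n + 1 < T (r + 1) ω},
        ∏ m ∈ Finset.Ico n N, (if ω ∈ noArrival T (m + 1) then b m else a m) ∂P
        = b n * ∫⁻ ω in arrivalEvent T r t ∩ {ω | n + 1 < T (r + 1) ω},
        ∏ m ∈ Finset.Ico (n + 1) N, (if ω ∈ noArrival T (m + 1) then b m else a m) ∂P := by
      rw [← lintegral_const_mul _ (hfm _)]
      refine setLIntegral_congr_fun_ae ((hA _ _).inter (hgt _ _)) ?_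
      filter_upwards [hG.ae_strictMonoOn] with ω hmono hω
      rw [Finset.prod_eq_prod_Ico_succ_bot hnN, if_pos]
      intro i hi hTi
      have h2 : T r ω = t r := hω.1 r hr le_rfl
      have h3 : n + 1 < T (r + 1) ω := hω.2
      rcases Nat.lt_or_ge r i with h | h
      · have : T (r + 1) ω ≤ T i ω := hmono.monotoneOn (by simp) hi h
        omega
      · have : T i ω ≤ T r ω := hmono.monotoneOn hi hr h
        omega
    rw [e1, e2, ih (by omega) hp' (by omega), ih hr ht (by omega), ht'r, Nat.sub_self, pow_zero,
      mul_one, hT.measure_arrivalEvent_update hG h0 h1 hr ht hn,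
      Finset.prod_eq_prod_Ico_succ_bot hnN, show n + 1 - t r = (n - t r) + 1 by omega, pow_succ]
    ring

end GeometricInterarrivals

end

section

/-! ### Almost sure convergence of the degrees -/

/-- Asymptotics of the products `∏ (1 + x / m)`. -/
theorem tendsto_rpow_neg_mul_prod {x : ℝ} (hx : 0 ≤ x) {a : ℕ} (ha : 1 ≤ a) :
    Tendsto (fun n : ℕ => (n : ℝ) ^ (-x) * ∏ m ∈ Finset.Ico a n, (1 + x / m)) atTop
      (𝓝 (Real.Gamma a / Real.Gamma (a + x))) := by
  have ha' : (0 : ℝ) < a := by exact_mod_cast ha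
  rcases hx.eq_or_lt with rfl | hx
  · simp [div_self (Real.Gamma_pos_of_pos ha').ne']
  have hΓ := Real.Gamma_pos_of_pos hx
  have hΓa := Real.Gamma_pos_of_pos (add_pos ha' hx)
  -- Euler's limit for Γ(x). Its product has one factor more than the range up to n - 1; the surplus
  -- (n + x) / n is removed by `hone`.
  have h := (Real.GammaSeq_tendsto_Gamma x).inv₀ hΓ.ne'
  have hone : Tendsto (fun n : ℕ => (1 + x / n : ℝ)⁻¹) atTop (𝓝 1) := by
    have := (tendsto_const_div_atTop_nhds_zero_nat x).const_add 1
    simpa using this.inv₀ (by simp)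
  have h2 := ((h.const_mul (Real.Gamma x * (Real.Gamma a / Real.Gamma (a + x))))).mul hone
  rw [mul_one] at h2
  have e : Real.Gamma x * (Real.Gamma a / Real.Gamma (a + x)) * (Real.Gamma x)⁻¹
      = Real.Gamma a / Real.Gamma (a + x) := by field_simp
  rw [e] at h2
  refine h2.congr' ?_
  filter_upwards [eventually_ge_atTop a] with n hn
  have hn1 : 1 ≤ n := ha.trans hn
  have hn' : (0 : ℝ) < n := by exact_mod_cast hn1
  have hp : ∀ k : ℕ, ∏ j ∈ Finset.range k, (x + j) = Real.Gamma (k + x) / Real.Gamma x := by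
    intro k
    induction k with
    | zero => simp [div_self hΓ.ne']
    | succ k ih =>
      rw [Finset.prod_range_succ, ih, Nat.cast_succ, show (k : ℝ) + 1 + x = (k + x) + 1 by ring,
        Real.Gamma_add_one (by positivity)]
      ring
  have hg := Real.Gamma_pos_of_pos (show 0 < (n : ℝ) + x by positivity)
  have hgn := Real.Gamma_pos_of_pos hn'
  rw [Real.GammaSeq, hp, prod_one_add_div hx.le ha hn, Nat.cast_succ,
    show (n : ℝ) + 1 + x = (n + x) + 1 by ring, Real.Gamma_add_one (by positivity),
    ← Real.Gamma_nat_eq_factorial, Real.Gamma_add_one hn'.ne', Real.rpow_neg hn'.le]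
  have := Real.rpow_pos_of_pos hn' x
  field_simp

theorem growth_ne_zero {Ω : Type*} (T : ℕ → Ω → ℕ) (q m : ℕ) (ω : Ω) : growth T q m ω ≠ 0 := by
  simp [growth]

/-- Stated at m + 1, because q / 0 = ∞ for q ≠ 0. -/
theorem growth_ne_top {Ω : Type*} (T : ℕ → Ω → ℕ) (q m : ℕ) (ω : Ω) :
    growth T q (m + 1) ω ≠ ∞ := by
  classical
  rw [growth, Set.indicator_apply]
  split_ifs
  · exact ENNReal.add_ne_top.2 ⟨by simp, ENNReal.div_ne_top (by simp) (by simp)⟩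
  · simp

variable {Ω : Type*} [mΩ : MeasurableSpace Ω] {P : Measure Ω} {T L : ℕ → Ω → ℕ} {β : ℝ}

/-- Doob's convergence theorem for nonnegative supermartingales. -/
theorem ae_tendsto_of_setLIntegral_succ_le [IsFiniteMeasure P] {ℱ : Filtration ℕ mΩ}
    {F : ℕ → Ω → ℝ≥0∞} (hF : ∀ n, Measurable[ℱ n] (F n)) (h0 : ∫⁻ ω, F 0 ω ∂P ≠ ∞)
    (hs : ∀ n s, MeasurableSet[ℱ n] s → ∫⁻ ω in s, F (n + 1) ω ∂P ≤ ∫⁻ ω in s, F n ω ∂P) :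
    ∀ᵐ ω ∂P, ∃ c : ℝ, Tendsto (fun n => (F n ω).toReal) atTop (𝓝 c) := by
  have hm : ∀ n, Measurable (F n) := fun n => (hF n).mono (ℱ.le n) le_rfl
  have hle : ∀ n, ∫⁻ ω, F n ω ∂P ≤ ∫⁻ ω, F 0 ω ∂P := by
    intro n
    induction n with
    | zero => exact le_rfl
    | succ n ih => exact le_trans (by simpa using hs n Set.univ .univ) ih
  have hfin : ∀ n, ∫⁻ ω, F n ω ∂P ≠ ∞ := fun n => ne_top_of_le_ne_top h0 (hle n)
  have hae : ∀ n, ∀ᵐ ω ∂P, F n ω < ∞ := fun n => ae_lt_top (hm n) (hfin n)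
  have hsup : Supermartingale (fun n ω => (F n ω).toReal) ℱ P := by
    refine supermartingale_of_setIntegral_succ_le
      (fun n => ((hF n).ennreal_toReal).stronglyMeasurable)
      (fun n => integrable_toReal_of_lintegral_ne_top (hm n).aemeasurable (hfin n))
      fun n s hsn => ?_
    rw [integral_toReal (hm _).aemeasurable (ae_restrict_of_ae (hae _)),
      integral_toReal (hm _).aemeasurable (ae_restrict_of_ae (hae _))]
    exact ENNReal.toReal_mono
      (ne_top_of_le_ne_top (hfin n) (setLIntegral_le_lintegral s _)) (hs n s hsn)
  have hb : ∀ n, eLpNorm ((-fun n ω => (F n ω).toReal : ℕ → Ω → ℝ) n) 1 P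
      ≤ ((∫⁻ ω, F 0 ω ∂P).toNNReal : ℝ≥0∞) := by
    intro n
    rw [ENNReal.coe_toNNReal h0, eLpNorm_one_eq_lintegral_enorm]
    refine le_trans (lintegral_mono fun ω => ?_) (hle n)
    rw [Pi.neg_apply, Pi.neg_apply, enorm_neg, Real.enorm_of_nonneg ENNReal.toReal_nonneg]
    exact ENNReal.ofReal_toReal_le
  filter_upwards [hsup.neg.exists_ae_tendsto_of_bdd hb] with ω ⟨c, hc⟩
  exact ⟨-c, by simpa using hc.neg⟩

namespace GeometricInterarrivals

variable [IsProbabilityMeasure P]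

/-- In `lintegral_prod_arrival`, weight 0 for arrivals at the selected times and 1 otherwise turns
the product into the indicator of the event. Time 1 is always an arrival, so the index i stands for
time i + 2. -/
theorem measure_biInter_noArrival (hT : GeometricInterarrivals β T P) (hG : IsGraph 0 T L P)
    (h0 : 0 < β) (h1 : β < 1) (s : Finset ℕ) :
    P (⋂ i ∈ s, noArrival T (i + 2)) = ENNReal.ofReal (1 - β) ^ s.card := by
  classical
  obtain ⟨K, hK⟩ := s.exists_nat_subset_range
  have hpre : IsArrivalPrefix 1 fun _ => 1 :=
    ⟨rfl, fun i hi j hj hij => by have := hi.1; have := hj.2; omega⟩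
  have h := hT.lintegral_prod_arrival hG h0 h1 (fun m => if m - 1 ∈ s then 0 else 1)
    (fun _ => 1) (K + 1) (n := 1) (by omega) le_rfl hpre le_rfl
  have hae : ∀ᵐ ω ∂P, ω ∈ arrivalEvent T 1 fun _ => 1 := by
    filter_upwards [hG.first_arrival] with ω hω k hk1 hk
    rw [show k = 1 by omega, hω]
  have hae2 : (arrivalEvent T 1 (fun _ => 1) ∩ {ω | 1 < T (1 + 1) ω} : Set Ω) =ᵐ[P] Set.univ := by
    filter_upwards [hae, hG.first_arrival, hG.arrival_lt] with ω hω hω1 hlt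
    refine propext (iff_of_true ⟨hω, ?_⟩ trivial)
    have := hlt 1 le_rfl
    rwa [hω1] at this
  have hset : MeasurableSet (⋂ i ∈ s, noArrival T (i + 2)) :=
    Finset.measurableSet_biInter _ fun i _ => hG.arrivalSigma_le _ (measurableSet_noArrival T _)
  have hP : P (arrivalEvent T 1 fun _ => 1) = 1 :=
    (measure_congr (eventuallyEq_univ.2 hae :
      (arrivalEvent T 1 fun _ => 1 : Set Ω) =ᵐ[P] Set.univ)).trans measure_univ
  rw [setLIntegral_congr hae2, Measure.restrict_univ, hP] at h
  simp only [Nat.sub_self, pow_zero, mul_one, one_mul, Finset.prod_Ico_eq_prod_range,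
    Nat.add_sub_cancel, Nat.add_sub_cancel_left] at h
  have e1 : ∀ ω, (∏ k ∈ Finset.range K, if ω ∈ noArrival T (1 + k + 1) then (1 : ℝ≥0∞)
      else if k ∈ s then 0 else 1) = (⋂ i ∈ s, noArrival T (i + 2)).indicator 1 ω := by
    intro ω
    by_cases hω : ω ∈ ⋂ i ∈ s, noArrival T (i + 2)
    · rw [Set.indicator_of_mem hω, Pi.one_apply]
      refine Finset.prod_eq_one fun k _ => ?_
      by_cases hk : k ∈ s
      · rw [if_pos (by rw [show 1 + k + 1 = k + 2 by ring]; exact Set.mem_iInter₂.1 hω k hk)]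
      · simp [hk]
    · rw [Set.indicator_of_notMem hω]
      simp only [Set.mem_iInter, not_forall] at hω
      obtain ⟨k, hk, hkω⟩ := hω
      refine Finset.prod_eq_zero (hK hk) ?_
      rw [if_neg (by rwa [show 1 + k + 1 = k + 2 by ring]), if_pos hk]
  have e2 : ∀ k ∈ Finset.range K, ENNReal.ofReal β * (if k ∈ s then 0 else 1)
      + ENNReal.ofReal (1 - β) = if k ∈ s then ENNReal.ofReal (1 - β) else 1 := by
    intro k _
    split_ifs
    · simp
    · rw [mul_one, ← ENNReal.ofReal_add h0.le (by linarith)]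
      simp
  rw [Finset.prod_congr rfl e2, Finset.prod_ite_mem, Finset.inter_eq_right.2 hK,
    Finset.prod_const] at h
  simp_rw [e1] at h
  rwa [lintegral_indicator_one hset] at h

/-- The events of no arrival are independent of probability 1 - β, so the normalised growth factors
are independent with mean one and their partial products form a nonnegative martingale. This allows
the random growth to be replaced by its mean. -/
theorem ae_tendsto_prod_growth (hT : GeometricInterarrivals β T P) (hG : IsGraph 0 T L P)
    (h0 : 0 < β) (h1 : β < 1) :
    ∀ᵐ ω ∂P, ∃ c : ℝ, Tendsto (fun n => (∏ m ∈ Finset.range (n + 1), growth T 1 (m + 1) ω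
      * (1 + ENNReal.ofReal (1 - β) / (m + 1 : ℕ))⁻¹).toReal) atTop (𝓝 c) := by
  have hgap : ∀ m, MeasurableSet (noArrival T m) := fun m =>
    hG.arrivalSigma_le _ (measurableSet_noArrival T m)
  have hind : iIndepSet (fun m => noArrival T (m + 2)) P := by
    rw [iIndepSet_iff_meas_biInter fun m => hgap _]
    intro s
    rw [hT.measure_biInter_noArrival hG h0 h1, ← Finset.prod_const]
    refine Finset.prod_congr rfl fun i _ => ?_
    simpa using (hT.measure_biInter_noArrival hG h0 h1 {i}).symm
  set Y : ℕ → Ω → ℝ≥0∞ := fun m ω => growth T 1 (m + 1) ω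
      * (1 + ENNReal.ofReal (1 - β) / (m + 1 : ℕ))⁻¹ with hY
  have hYm : ∀ m, Measurable (Y m) := fun m =>
    ((measurable_growth T 1 (m + 1)).mono hG.arrivalSigma_le le_rfl).mul_const _
  have hYi : iIndepFun Y P := by
    have h := (hind.iIndepFun_indicator (β := ℝ≥0∞)).comp
      (fun m x => (1 + x * ((1 : ℕ) / (m + 1 : ℕ))) * (1 + ENNReal.ofReal (1 - β) / (m + 1 : ℕ))⁻¹)
      fun m => by fun_prop
    convert h using 1
    ext m ω
    simp only [hY, growth, Function.comp_apply]
    by_cases hω : ω ∈ noArrival T (m + 2)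
    · rw [Set.indicator_of_mem hω, Set.indicator_of_mem hω, one_mul]
    · rw [Set.indicator_of_notMem hω, Set.indicator_of_notMem hω, zero_mul]
  have hY1 : ∀ m, ∫⁻ ω, Y m ω ∂P = 1 := by
    intro m
    have hP : P (noArrival T (m + 1 + 1)) = ENNReal.ofReal (1 - β) := by
      simpa using hT.measure_biInter_noArrival hG h0 h1 {m}
    simp only [hY, growth]
    rw [lintegral_mul_const _ (measurable_const.fun_add (measurable_const.indicator (hgap _))),
      lintegral_add_left measurable_const, lintegral_indicator_const (hgap _), hP, lintegral_const,
      measure_univ, Nat.cast_one, mul_one, one_div, mul_comm _ (ENNReal.ofReal (1 - β)),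
      ← div_eq_mul_inv]
    refine ENNReal.mul_inv_cancel (by simp) (ENNReal.add_ne_top.2 ⟨by simp, ?_⟩)
    exact ENNReal.div_ne_top ENNReal.ofReal_ne_top (by simp)
  have hYs : ∀ m, StronglyMeasurable (Y m) := fun m => (hYm m).stronglyMeasurable
  refine ae_tendsto_of_setLIntegral_succ_le (ℱ := Filtration.natural Y hYs)
    (F := fun n ω => ∏ m ∈ Finset.range (n + 1), Y m ω) (fun n => ?_) ?_ fun n s hs => ?_
  · refine Finset.measurable_fun_prod _ fun m hm => ?_
    have hm : m ≤ n := by have := Finset.mem_range.1 hm; omega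
    exact ((Filtration.stronglyAdapted_natural hYs m).measurable).mono
      ((Filtration.natural Y hYs).mono hm) le_rfl
  · simp [hY1]
  · refine le_of_eq ?_
    have hWm : Measurable[Filtration.natural Y hYs n]
        fun ω => ∏ m ∈ Finset.range (n + 1), Y m ω := by
      refine Finset.measurable_fun_prod _ fun m hm => ?_
      have hm : m ≤ n := by have := Finset.mem_range.1 hm; omega
      exact ((Filtration.stronglyAdapted_natural hYs m).measurable).mono
        ((Filtration.natural Y hYs).mono hm) le_rfl
    have hsm := (Filtration.natural Y hYs).le n s hs
    rw [← lintegral_indicator hsm, ← lintegral_indicator hsm]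
    have hindep : Indep (Filtration.natural Y hYs n)
        (MeasurableSpace.comap (Y (n + 1)) inferInstance) P := by
      suffices h : Indep (⨆ k ∈ {k | k ≤ n}, MeasurableSpace.comap (Y k) inferInstance)
          (⨆ k ∈ ({n + 1} : Set ℕ), MeasurableSpace.comap (Y k) inferInstance) P by
        rwa [iSup_singleton] at h
      exact indep_iSup_of_disjoint (fun k => (hYm k).comap_le) hYi (by simp)
    have h := lintegral_mul_eq_lintegral_mul_lintegral_of_independent_measurableSpace
      ((Filtration.natural Y hYs).le n) (hYm (n + 1)).comap_le
      hindep
      (hWm.indicator hs) (comap_measurable (Y (n + 1)))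
    rw [hY1, mul_one] at h
    rw [← h]
    refine lintegral_congr fun ω => ?_
    by_cases hω : ω ∈ s
    · simp only [Set.indicator_of_mem hω, Finset.prod_range_succ _ (n + 1)]
    · simp only [Set.indicator_of_notMem hω, zero_mul]

end GeometricInterarrivals

namespace IsGraph

variable [IsProbabilityMeasure P]

/-- The degree of vertex `j`, counted as `1` before the arrival of `j`, divided by the conditional
mean growth is a supermartingale. -/
theorem ae_tendsto_degree_div_growth (hG : IsGraph 0 T L P) {j : ℕ} (hj : 1 ≤ j) :
    ∀ᵐ ω ∂P, ∃ c : ℝ, Tendsto (fun n => (((degree (fun i => L i ω) j (n + 1) : ℝ≥0∞)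
      + {ω | n + 1 < T j ω}.indicator 1 ω)
        * (∏ m ∈ Finset.range n, growth T 1 (m + 1) ω)⁻¹).toReal) atTop (𝓝 c) := by
  have hcast : Measurable fun d : ℕ => (d : ℝ≥0∞) := measurable_from_top
  have hgt : ∀ n, MeasurableSet[arrivalSigma T] {ω | n + 1 < T j ω} := fun n =>
    measurable_arrival T hj measurableSet_Ioi
  have hbef : ∀ n, Measurable[history T L n] ({ω | n < T j ω}.indicator (1 : Ω → ℝ≥0∞)) :=
    fun n => measurable_const.indicator (arrivalSigma_le_history T L n _
      (measurable_arrival T hj measurableSet_Ioi))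
  have hD : ∀ n, Measurable[history T L n] fun ω => (degree (fun i => L i ω) j n : ℝ≥0∞)
      + {ω | n < T j ω}.indicator 1 ω := fun n =>
    (hcast.comp (measurable_degree T L j n)).fun_add (hbef n)
  have hgrow : ∀ n, Measurable[arrivalSigma T]
      fun ω => (∏ m ∈ Finset.range n, growth T 1 (m + 1) ω)⁻¹ := fun n =>
    (Finset.measurable_fun_prod _ fun m _ => measurable_growth T 1 (m + 1)).inv
  refine ae_tendsto_of_setLIntegral_succ_le
    (ℱ := ⟨fun n => history T L (n + 1), fun m n h => history_mono T L (by omega),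
      fun n => hG.history_le _⟩) (fun n => ?_) ?_ fun n s hs => ?_
  · exact (hD (n + 1)).fun_mul ((hgrow n).mono (arrivalSigma_le_history T L _) le_rfl)
  · refine ne_top_of_le_ne_top (b := 2) (by simp) ?_
    refine (lintegral_mono (g := fun _ => 2) fun ω => ?_).trans (by simp)
    have h1 : (degree (fun i => L i ω) j (0 + 1) : ℝ≥0∞) ≤ 1 := by
      exact_mod_cast degree_le _ _ _
    have h2 : {ω | 0 + 1 < T j ω}.indicator (1 : Ω → ℝ≥0∞) ω ≤ 1 :=
      Set.indicator_le_self' (by simp) ω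
    simp only [Finset.range_zero, Finset.prod_empty, inv_one, mul_one]
    exact (add_le_add h1 h2).trans (by norm_num)
  · have hs : MeasurableSet[history T L (n + 1)] s := hs
    have hsm := hG.history_le _ _ hs
    have hgap : MeasurableSet (noArrival T (n + 1 + 1)) :=
      hG.arrivalSigma_le _ (measurableSet_noArrival T _)
    have hLm : MeasurableSet (L (n + 1 + 1) ⁻¹' {j}) :=
      hG.measurable_L _ (measurableSet_singleton j)
    set R : Ω → ℝ≥0∞ := fun ω => (∏ m ∈ Finset.range (n + 1), growth T 1 (m + 1) ω)⁻¹ with hR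
    set D' : Ω → ℝ≥0∞ := fun ω => (degree (fun i => L i ω) j (n + 1) : ℝ≥0∞)
      + {ω | n + 1 < T j ω}.indicator 1 ω with hD'
    have hRH : Measurable[history T L (n + 1)] R :=
      (hgrow (n + 1)).mono (arrivalSigma_le_history T L _) le_rfl
    have hDH : Measurable[history T L (n + 1)] D' := hD (n + 1)
    have hDR := (hDH.fun_mul hRH).mono (hG.history_le _) le_rfl
    -- When j arrives, the indicator drops by 1 as the degree rises by 1. The sum therefore changes
    -- only when label j is drawn at a time without arrival.
    have hstep : ∀ᵐ ω ∂P, ((degree (fun i => L i ω) j (n + 1 + 1) : ℝ≥0∞)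
        + {ω | n + 1 + 1 < T j ω}.indicator 1 ω) * R ω
        = D' ω * R ω + (noArrival T (n + 1 + 1) ∩ L (n + 1 + 1) ⁻¹' {j}).indicator R ω := by
      filter_upwards [hG.label_arrival] with ω hlab
      by_cases hTj : T j ω = n + 2
      · have hl : L (n + 1 + 1) ω = j := by rw [← hlab j hj, hTj]
        have h1 : ω ∉ noArrival T (n + 1 + 1) := fun h => h j hj hTj
        have h2 : ω ∉ {ω | n + 1 + 1 < T j ω} := by simp [hTj]
        have h3 : ω ∈ {ω | n + 1 < T j ω} := by simp [hTj]
        have h4 : ω ∉ noArrival T (n + 1 + 1) ∩ L (n + 1 + 1) ⁻¹' {j} := fun h => h1 h.1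
        rw [Set.indicator_of_notMem h4, Set.indicator_of_notMem h2, add_zero,
          add_zero, degree_succ, if_pos hl, hD']
        simp only [Set.indicator_of_mem h3, Nat.cast_add, Nat.cast_one, Pi.one_apply]
      · have hiff : {ω | n + 1 + 1 < T j ω}.indicator (1 : Ω → ℝ≥0∞) ω
            = {ω | n + 1 < T j ω}.indicator 1 ω := by
          simp only [Set.indicator_apply, Set.mem_ofPred_eq]
          have : n + 1 + 1 < T j ω ↔ n + 1 < T j ω := by omega
          simp only [this]
        rw [hiff, degree_succ]
        by_cases hl : L (n + 1 + 1) ω = j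
        · have : ω ∈ noArrival T (n + 1 + 1) := by
            intro i hi hTi
            have h1 := hlab i hi
            rw [hTi, hl] at h1
            exact hTj (h1 ▸ hTi)
          have h4 : ω ∈ noArrival T (n + 1 + 1) ∩ L (n + 1 + 1) ⁻¹' {j} := ⟨this, hl⟩
          rw [if_pos hl, Set.indicator_of_mem h4, hD']
          push_cast
          ring
        · have h4 : ω ∉ noArrival T (n + 1 + 1) ∩ L (n + 1 + 1) ⁻¹' {j} := fun h => hl h.2
          rw [if_neg hl, Set.indicator_of_notMem h4, add_zero, add_zero]
    rw [setLIntegral_congr_fun_ae (g := fun ω => D' ω * R ω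
        + (noArrival T (n + 1 + 1) ∩ L (n + 1 + 1) ⁻¹' {j}).indicator R ω) hsm
        (hstep.mono fun ω h _ => h), lintegral_add_left hDR]
    have e1 : ∫⁻ ω in s, (noArrival T (n + 1 + 1) ∩ L (n + 1 + 1) ⁻¹' {j}).indicator R ω ∂P
        = ∫⁻ ω in s, (noArrival T (n + 1 + 1)).indicator (fun ω => ENNReal.ofReal
            ((degree (fun i => L i ω) j (n + 1) : ℝ) / (n + 1 : ℕ)) * R ω) ω ∂P := by
      rw [← lintegral_indicator hsm, ← lintegral_indicator hsm]
      have h := hG.lintegral_label (n + 1) hj (f := s.indicator R) (hRH.indicator hs)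
      rw [← lintegral_indicator (hgap.inter hLm), ← lintegral_indicator hgap] at h
      rw [Set.indicator_indicator, Set.inter_comm, ← Set.indicator_indicator, h]
      refine lintegral_congr fun ω => ?_
      by_cases h1 : ω ∈ s <;> by_cases h2 : ω ∈ noArrival T (n + 1 + 1) <;> simp [h1, h2]
    rw [e1, ← lintegral_add_left hDR]
    refine lintegral_mono fun ω => ?_
    have hRR : (∏ m ∈ Finset.range n, growth T 1 (m + 1) ω)⁻¹
        = growth T 1 (n + 1) ω * R ω := by
      simp only [hR]
      rw [Finset.prod_range_succ, ENNReal.mul_inv (Or.inr (growth_ne_top T 1 n ω))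
        (Or.inr (growth_ne_zero T 1 _ ω)), mul_comm,
        mul_assoc, ENNReal.inv_mul_cancel (growth_ne_zero T 1 _ ω) (growth_ne_top T 1 n ω), mul_one]
    rw [hRR, growth]
    by_cases h2 : ω ∈ noArrival T (n + 1 + 1)
    · rw [Set.indicator_of_mem h2, Set.indicator_of_mem h2,
        ENNReal.ofReal_div_of_pos (by positivity), ENNReal.ofReal_natCast, ENNReal.ofReal_natCast]
      -- Only an inequality: the 1 counted before the arrival of j is not reinforced, though the
      -- growth factor is divided out.
      have : (degree (fun i => L i ω) j (n + 1) : ℝ≥0∞) ≤ D' ω := le_self_add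
      calc D' ω * R ω + (degree (fun i => L i ω) j (n + 1) : ℝ≥0∞) / (n + 1 : ℕ) * R ω
          ≤ D' ω * R ω + D' ω / (n + 1 : ℕ) * R ω := by gcongr
        _ = D' ω * ((1 + (1 : ℕ) / (n + 1 : ℕ)) * R ω) := by
            rw [Nat.cast_one, one_div, div_eq_mul_inv]; ring
    · rw [Set.indicator_of_notMem h2, Set.indicator_of_notMem h2]
      simp [hD']

end IsGraph

/-- The scaled degrees converge almost surely. -/
theorem GeometricInterarrivals.ae_exists_tendsto_degree [IsProbabilityMeasure P]
    (hT : GeometricInterarrivals β T P) (hG : IsGraph 0 T L P) (h0 : 0 < β) (h1 : β < 1)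
    {j : ℕ} (hj : 1 ≤ j) :
    ∀ᵐ ω ∂P, ∃ c : ℝ, Tendsto (fun n : ℕ => (n : ℝ) ^ (-(1 - β))
      * (degree (fun i => L i ω) j n : ℝ)) atTop (𝓝 c) := by
  have hσ : 0 ≤ 1 - β := by linarith
  filter_upwards [hG.ae_tendsto_degree_div_growth hj, hT.ae_tendsto_prod_growth hG h0 h1]
    with ω ⟨c, hc⟩ ⟨d, hd⟩
  have h3 := tendsto_rpow_neg_mul_prod hσ (a := 1) le_rfl
  -- With A the growth product and B the product of its means, the scaled degree is (n ^ (-(1 - β))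
  -- B) · (D / A) · (A / B), and each of the three factors converges. The time is n + 2 because A
  -- and B then have the n + 1 factors belonging to m = 1, …, n + 1.
  refine ⟨Real.Gamma (1 : ℕ) / Real.Gamma ((1 : ℕ) + (1 - β)) * (c * d),
    (tendsto_add_atTop_iff_nat 2).1 ?_⟩
  have h4 := ((tendsto_add_atTop_iff_nat 2).2 h3).mul (((tendsto_add_atTop_iff_nat 1).2 hc).mul hd)
  refine h4.congr' ?_
  filter_upwards [eventually_ge_atTop (T j ω)] with n hn
  have h5 : ω ∉ {ω | n + 1 + 1 < T j ω} := by
    intro h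
    have h : n + 1 + 1 < T j ω := h
    omega
  have h6 : ∏ m ∈ Finset.Ico 1 (n + 2), (1 + (1 - β) / (m : ℝ))
      = (∏ m ∈ Finset.range (n + 1), (1 + ENNReal.ofReal (1 - β) / (m + 1 : ℕ))).toReal := by
    rw [Finset.prod_Ico_eq_prod_range, ENNReal.toReal_prod]
    refine Finset.prod_congr rfl fun m _ => ?_
    rw [ENNReal.toReal_add (by simp) (ENNReal.div_ne_top (by simp) (by simp)), ENNReal.toReal_div,
      ENNReal.toReal_ofReal hσ, ENNReal.toReal_natCast, add_comm 1 m]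
    simp
  have hq0 : ∀ m : ℕ, (1 + ENNReal.ofReal (1 - β) / (m + 1 : ℕ)) ≠ 0 := fun m => by simp
  have hqt : ∀ m : ℕ, (1 + ENNReal.ofReal (1 - β) / (m + 1 : ℕ)) ≠ ∞ := fun m =>
    ENNReal.add_ne_top.2 ⟨by simp, ENNReal.div_ne_top (by simp) (by simp)⟩
  rw [Set.indicator_of_notMem h5, add_zero, ← ENNReal.toReal_mul, h6, mul_assoc,
    ← ENNReal.toReal_mul, Finset.prod_mul_distrib]
  congr 1
  rw [← ENNReal.toReal_natCast (degree _ j (n + 2))]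
  congr 1
  set A := ∏ m ∈ Finset.range (n + 1), growth T 1 (m + 1) ω with hA
  set B := ∏ m ∈ Finset.range (n + 1), (1 + ENNReal.ofReal (1 - β) / (m + 1 : ℕ)) with hB
  have hA0 : A ≠ 0 := Finset.prod_ne_zero_iff.2 fun m _ => growth_ne_zero T 1 _ ω
  have hAt : A ≠ ∞ := ENNReal.prod_ne_top fun m _ => growth_ne_top T 1 m ω
  have hB0 : B ≠ 0 := Finset.prod_ne_zero_iff.2 fun m _ => hq0 _
  have hBt : B ≠ ∞ := ENNReal.prod_ne_top fun m _ => hqt m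
  have hBi : ∏ m ∈ Finset.range (n + 1), (1 + ENNReal.ofReal (1 - β) / (m + 1 : ℕ))⁻¹ = B⁻¹ := by
    rw [hB, ENNReal.prod_inv_distrib]
    exact fun i _ j _ _ => Or.inl (hq0 _)
  rw [hBi]
  calc B * ((degree (fun i => L i ω) j (n + 1 + 1) : ℝ≥0∞) * A⁻¹ * (A * B⁻¹))
      = (degree (fun i => L i ω) j (n + 1 + 1) : ℝ≥0∞) * (A⁻¹ * A) * (B * B⁻¹) := by ring
    _ = _ := by
      rw [ENNReal.inv_mul_cancel hA0 hAt, ENNReal.mul_inv_cancel hB0 hBt, mul_one, mul_one]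

end

section

/-! ### Moments of the limits -/

variable {Ω : Type*} [mΩ : MeasurableSpace Ω] {P : Measure Ω}

/-- Convergence of integrals under an `L²` bound. -/
theorem lintegral_eq_of_tendsto_of_sq_le [IsFiniteMeasure P] {X : ℕ → Ω → ℝ≥0∞} {Y : Ω → ℝ≥0∞}
    {m C : ℝ≥0∞} (hX : ∀ n, Measurable (X n))
    (hXY : ∀ᵐ ω ∂P, Tendsto (fun n => X n ω) atTop (𝓝 (Y ω)))
    (hm : Tendsto (fun n => ∫⁻ ω, X n ω ∂P) atTop (𝓝 m)) (hC : C ≠ ∞)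
    (hX2 : ∀ᶠ n in atTop, ∫⁻ ω, X n ω ^ 2 ∂P ≤ C) : ∫⁻ ω, Y ω ∂P = m := by
  -- Fatou gives one inequality. For the other, x ≤ min x K + x ² / K, with dominated convergence
  -- for the truncated part and then K → ∞.
  refine le_antisymm ?_ ?_
  · calc ∫⁻ ω, Y ω ∂P = ∫⁻ ω, liminf (fun n => X n ω) atTop ∂P :=
        lintegral_congr_ae (hXY.mono fun ω h => h.liminf_eq.symm)
      _ ≤ liminf (fun n => ∫⁻ ω, X n ω ∂P) atTop := lintegral_liminf_le hX
      _ = m := hm.liminf_eq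
  · have key : ∀ K : ℕ, 1 ≤ K → m ≤ ∫⁻ ω, Y ω ∂P + C / K := by
      intro K hK
      have hK0 : (K : ℝ≥0∞) ≠ 0 := by simpa using (by omega : K ≠ 0)
      have hlim : Tendsto (fun n => ∫⁻ ω, min (X n ω) K ∂P) atTop
          (𝓝 (∫⁻ ω, min (Y ω) K ∂P)) := by
        refine tendsto_lintegral_of_dominated_convergence (fun _ => (K : ℝ≥0∞))
          (fun n => (hX n).min measurable_const)
          (fun n => Eventually.of_forall fun ω => min_le_right _ _) ?_ ?_
        · rw [lintegral_const]
          exact ENNReal.mul_ne_top (by simp) (measure_ne_top _ _)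
        · exact hXY.mono fun ω h => h.min tendsto_const_nhds
      have hle : ∀ᶠ n in atTop, ∫⁻ ω, X n ω ∂P ≤ ∫⁻ ω, min (X n ω) K ∂P + C / K := by
        filter_upwards [hX2] with n hn
        have hpt : ∀ x : ℝ≥0∞, x ≤ min x K + x ^ 2 * (K : ℝ≥0∞)⁻¹ := by
          intro x
          rcases le_total x K with h | h
          · rw [min_eq_left h]; exact le_self_add
          · refine le_trans ?_ le_add_self
            rw [← div_eq_mul_inv, ENNReal.le_div_iff_mul_le (Or.inl hK0) (Or.inl (by simp)), sq]
            gcongr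
        calc ∫⁻ ω, X n ω ∂P ≤ ∫⁻ ω, (min (X n ω) K + X n ω ^ 2 * (K : ℝ≥0∞)⁻¹) ∂P :=
              lintegral_mono fun ω => hpt _
          _ = ∫⁻ ω, min (X n ω) K ∂P + (∫⁻ ω, X n ω ^ 2 ∂P) * (K : ℝ≥0∞)⁻¹ := by
              rw [lintegral_add_left ((hX n).min measurable_const),
                lintegral_mul_const _ ((hX n).pow_const 2)]
          _ ≤ _ := by rw [div_eq_mul_inv]; gcongr
      refine (le_of_tendsto_of_tendsto hm (hlim.add tendsto_const_nhds) hle).trans ?_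
      gcongr
      exact min_le_left _ _
    have hz : Tendsto (fun K : ℕ => ∫⁻ ω, Y ω ∂P + C / K) atTop (𝓝 (∫⁻ ω, Y ω ∂P + 0)) := by
      refine tendsto_const_nhds.add ?_
      have := ENNReal.Tendsto.const_mul ENNReal.tendsto_inv_nat_nhds_zero (Or.inr hC)
      simpa [div_eq_mul_inv] using this
    rw [add_zero] at hz
    exact ge_of_tendsto hz ((eventually_ge_atTop 1).mono fun K hK => key K hK)

/-- A rising factorial of order 2p at d is the product of those of order p at d and at d + p, the
second being the larger. Second moments are thereby bounded through the first-moment formula. -/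
theorem risingDegree_sq_le (l p : ℕ → ℕ) (r n : ℕ) :
    risingDegree l p r n ^ 2 ≤ risingDegree l (fun i => 2 * p i) r n := by
  rw [risingDegree, risingDegree, ← Finset.prod_pow]
  refine Finset.prod_le_prod' fun i _ => ?_
  rw [sq, two_mul, ← Nat.ascFactorial_mul_ascFactorial]
  refine Nat.mul_le_mul_left _ ?_
  rw [Nat.ascFactorial_eq_prod_range, Nat.ascFactorial_eq_prod_range]
  exact Finset.prod_le_prod' fun k _ => by omega

/-- Each factor D + k of a rising factorial is scaled by n ^ (-σ), so the bounded shift k disappears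
and powers of the limits remain. -/
theorem tendsto_rpow_neg_mul_risingDegree {σ : ℝ} (hσ : 0 < σ) {l : ℕ → ℕ} {ξ : ℕ → ℝ} {r : ℕ}
    (h : ∀ j, 1 ≤ j → Tendsto (fun n : ℕ => (n : ℝ) ^ (-σ) * (degree l j n : ℝ)) atTop (𝓝 (ξ j)))
    (p : ℕ → ℕ) :
    Tendsto (fun n : ℕ => (n : ℝ) ^ (-(σ * (∑ k ∈ Finset.range r, p k : ℕ)))
      * (risingDegree l p r n : ℝ)) atTop (𝓝 (∏ i ∈ Finset.range r, ξ (i + 1) ^ p i)) := by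
  have hz : Tendsto (fun n : ℕ => (n : ℝ) ^ (-σ)) atTop (𝓝 0) :=
    (tendsto_rpow_neg_atTop hσ).comp tendsto_natCast_atTop_atTop
  have h1 : Tendsto (fun n : ℕ => ∏ i ∈ Finset.range r, ∏ k ∈ Finset.range (p i),
      ((n : ℝ) ^ (-σ) * (degree l (i + 1) n : ℝ) + (n : ℝ) ^ (-σ) * k)) atTop
      (𝓝 (∏ i ∈ Finset.range r, ∏ _k ∈ Finset.range (p i), (ξ (i + 1) + 0 * _k))) :=
    tendsto_finsetProd _ fun i _ => tendsto_finsetProd _ fun k _ =>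
      (h (i + 1) (by omega)).add (hz.mul_const _)
  simp only [zero_mul, add_zero, Finset.prod_const, Finset.card_range] at h1
  refine h1.congr' ?_
  filter_upwards [eventually_ge_atTop 1] with n hn
  have hn' : (0 : ℝ) ≤ n := Nat.cast_nonneg n
  simp_rw [← mul_add, Finset.prod_mul_distrib, Finset.prod_const, Finset.card_range]
  rw [Finset.prod_pow_eq_pow_sum, ← neg_mul, Real.rpow_mul_natCast hn', risingDegree]
  congr 1
  push_cast
  refine Finset.prod_congr rfl fun i _ => ?_
  rw [Nat.ascFactorial_eq_prod_range]
  push_cast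
  rfl

variable {T L : ℕ → Ω → ℕ} {r : ℕ} {t : ℕ → ℕ} {β : ℝ}

namespace GeometricInterarrivals

variable [IsProbabilityMeasure P]

/-- The growth factors after t r are averaged by `lintegral_prod_arrival`, with weight 1 at
arrivals: β + (1 - β)(1 + q / m) = 1 + (1 - β) q / m. -/
theorem setLIntegral_risingDegree (hT : GeometricInterarrivals β T P) (hG : IsGraph 0 T L P)
    (h0 : 0 < β) (h1 : β < 1) (hr : 1 ≤ r) (ht : IsArrivalPrefix r t) (p : ℕ → ℕ) {n : ℕ}
    (hn : t r ≤ n) :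
    ∫⁻ ω in arrivalEvent T r t, risingDegree (fun i => L i ω) p r n ∂P
      = P (arrivalEvent T r t) * ENNReal.ofReal (arrivalMoment t p r
        * ∏ m ∈ Finset.Ico (t r) n, (1 + (1 - β) * (∑ k ∈ Finset.range r, p k : ℕ) / m)) := by
  classical
  set q := ∑ k ∈ Finset.range r, p k with hq
  have hA' := measurableSet_arrivalEvent T r t
  have hA := hG.arrivalSigma_le _ hA'
  have h0' : ∀ ω ∉ arrivalEvent T r t, (arrivalEvent T r t).indicator (1 : Ω → ℝ≥0∞) ω = 0 :=
    fun ω hω => Set.indicator_of_notMem hω _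
  have hg' : Measurable[arrivalSigma T] ((arrivalEvent T r t).indicator (1 : Ω → ℝ≥0∞)) :=
    measurable_const.indicator hA'
  have hgr : Measurable[arrivalSigma T] fun ω => (arrivalEvent T r t).indicator (1 : Ω → ℝ≥0∞) ω
      * ∏ m ∈ Finset.Ico (t r) n, growth T q m ω :=
    hg'.fun_mul (Finset.measurable_fun_prod _ fun m _ => measurable_growth T q m)
  have hind : ∀ f : Ω → ℝ≥0∞, ∫⁻ ω in arrivalEvent T r t, f ω ∂P
      = ∫⁻ ω, (arrivalEvent T r t).indicator (1 : Ω → ℝ≥0∞) ω * f ω ∂P := by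
    intro f
    rw [← lintegral_indicator hA]
    refine lintegral_congr fun ω => ?_
    by_cases hω : ω ∈ arrivalEvent T r t <;> simp [hω]
  rw [hind, hG.lintegral_risingDegree ht hr p hn hg' h0',
    hG.lintegral_risingDegree_arrival ht hr p hgr fun ω hω => by rw [h0' ω hω, zero_mul], ← hind]
  have hae : (arrivalEvent T r t : Set Ω) =ᵐ[P]
      (arrivalEvent T r t ∩ {ω | t r < T (r + 1) ω} : Set Ω) := by
    filter_upwards [hG.arrival_lt] with ω hω
    refine propext ⟨fun h => ⟨h, ?_⟩, fun h => h.1⟩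
    have h2 : T r ω = t r := h r hr le_rfl
    have := hω r hr
    rwa [h2] at this
  have hgrow : ∀ ω, ∏ m ∈ Finset.Ico (t r) n, growth T q m ω
      = ∏ m ∈ Finset.Ico (t r) n,
        (if ω ∈ noArrival T (m + 1) then 1 + (q : ℝ≥0∞) / m else 1) := by
    intro ω
    refine Finset.prod_congr rfl fun m _ => ?_
    rw [growth, Set.indicator_apply]
    split_ifs <;> simp
  simp_rw [hgrow]
  rw [setLIntegral_congr hae, hT.lintegral_prod_arrival hG h0 h1 (fun _ => 1)
    (fun m => 1 + (q : ℝ≥0∞) / m) n hn hr ht le_rfl, Nat.sub_self, pow_zero, mul_one,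
    ENNReal.ofReal_mul (arrivalMoment_nonneg ht p)]
  have e : ∀ m ∈ Finset.Ico (t r) n, ENNReal.ofReal β * 1
      + ENNReal.ofReal (1 - β) * (1 + (q : ℝ≥0∞) / m)
      = ENNReal.ofReal (1 + (1 - β) * q / m) := by
    intro m hm
    have hm1 : 1 ≤ m := (ht.one_le hr le_rfl).trans (Finset.mem_Ico.1 hm).1
    have hm0 : (0 : ℝ) < m := by exact_mod_cast hm1
    have hσ : 0 ≤ 1 - β := by linarith
    have e2 : 1 + (q : ℝ≥0∞) / m = ENNReal.ofReal (1 + q / m) := by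
      rw [ENNReal.ofReal_add zero_le_one (by positivity), ENNReal.ofReal_one,
        ENNReal.ofReal_div_of_pos hm0, ENNReal.ofReal_natCast, ENNReal.ofReal_natCast]
    rw [e2, mul_one, ← ENNReal.ofReal_mul hσ, ← ENNReal.ofReal_add h0.le (by positivity)]
    congr 1
    ring
  rw [Finset.prod_congr rfl e, ← ENNReal.ofReal_prod_of_nonneg fun m _ => by
    have : 0 ≤ 1 - β := by linarith
    positivity]
  ring

/-- Mixed moments of the limits of the scaled degrees. -/
theorem setLIntegral_limit (hT : GeometricInterarrivals β T P) (hG : IsGraph 0 T L P)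
    (h0 : 0 < β) (h1 : β < 1) {ξ : ℕ → Ω → ℝ}
    (hξ : ∀ᵐ ω ∂P, ∀ j, 1 ≤ j → Tendsto (fun n : ℕ => (n : ℝ) ^ (-(1 - β))
      * (degree (fun i => L i ω) j n : ℝ)) atTop (𝓝 (ξ j ω)))
    (hr : 1 ≤ r) (ht : IsArrivalPrefix r t) (p : ℕ → ℕ) :
    ∫⁻ ω in arrivalEvent T r t, ENNReal.ofReal (∏ i ∈ Finset.range r, ξ (i + 1) ω ^ p i) ∂P
      = P (arrivalEvent T r t) * ENNReal.ofReal (totalMellin β (t r) (∑ k ∈ Finset.range r, p k : ℕ)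
        * ∏ i ∈ Finset.range r,
          stickFactor ((t (i + 1) : ℝ) - 1) (p i) (∑ k ∈ Finset.range i, p k)) := by
  have hσ : 0 < 1 - β := by linarith
  have hcast : Measurable fun d : ℕ => (d : ℝ≥0∞) := measurable_from_top
  have ht1 := ht.one_le hr le_rfl
  have ht0 : (0 : ℝ) < t r := by exact_mod_cast ht1
  have hXm : ∀ p n, Measurable fun ω => (risingDegree (fun i => L i ω) p r n : ℝ≥0∞) :=
    fun p n => hcast.comp ((measurable_risingDegree T L p r n).mono (hG.history_le n) le_rfl)
  have hmom : ∀ p : ℕ → ℕ, Tendsto (fun n : ℕ => ∫⁻ ω in arrivalEvent T r t,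
      ENNReal.ofReal ((n : ℝ) ^ (-((1 - β) * (∑ k ∈ Finset.range r, p k : ℕ))))
        * risingDegree (fun i => L i ω) p r n ∂P) atTop
      (𝓝 (P (arrivalEvent T r t) * ENNReal.ofReal
        (totalMellin β (t r) (∑ k ∈ Finset.range r, p k : ℕ) * ∏ i ∈ Finset.range r,
          stickFactor ((t (i + 1) : ℝ) - 1) (p i) (∑ k ∈ Finset.range i, p k)))) := by
    intro p
    have hx : 0 ≤ (1 - β) * (∑ k ∈ Finset.range r, p k : ℕ) := by positivity
    have h := (tendsto_rpow_neg_mul_prod hx ht1).const_mul (arrivalMoment t p r)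
    have e : arrivalMoment t p r * (Real.Gamma (t r)
          / Real.Gamma (t r + (1 - β) * (∑ k ∈ Finset.range r, p k : ℕ)))
        = totalMellin β (t r) (∑ k ∈ Finset.range r, p k : ℕ) * ∏ i ∈ Finset.range r,
          stickFactor ((t (i + 1) : ℝ) - 1) (p i) (∑ k ∈ Finset.range i, p k) := by
      have := Real.Gamma_pos_of_pos ht0
      rw [arrivalMoment, totalMellin]
      field_simp
    rw [e] at h
    refine (ENNReal.Tendsto.const_mul (ENNReal.tendsto_ofReal h)
      (Or.inr (measure_ne_top P (arrivalEvent T r t)))).congr' ?_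
    filter_upwards [eventually_ge_atTop (t r)] with n hn
    rw [lintegral_const_mul _ (hXm p n), hT.setLIntegral_risingDegree hG h0 h1 hr ht p hn,
      mul_left_comm (ENNReal.ofReal _) (P _), ← ENNReal.ofReal_mul (by positivity)]
    congr 2
    ring
  have hfin : ∀ p : ℕ → ℕ, P (arrivalEvent T r t) * ENNReal.ofReal
        (totalMellin β (t r) (∑ k ∈ Finset.range r, p k : ℕ) * ∏ i ∈ Finset.range r,
          stickFactor ((t (i + 1) : ℝ) - 1) (p i) (∑ k ∈ Finset.range i, p k)) ≠ ∞ := fun p =>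
    ENNReal.mul_ne_top (measure_ne_top _ _) ENNReal.ofReal_ne_top
  -- The L² bound is the convergent moment with doubled orders; the added 1 makes its limit an
  -- eventual upper bound.
  refine lintegral_eq_of_tendsto_of_sq_le (fun n => (hXm p n).const_mul _) ?_ (hmom p)
    (ENNReal.add_ne_top.2 ⟨hfin fun i => 2 * p i, ENNReal.one_ne_top⟩) ?_
  · filter_upwards [ae_restrict_of_ae hξ] with ω hω
    have h := ENNReal.tendsto_ofReal (tendsto_rpow_neg_mul_risingDegree (r := r) hσ
      (ξ := fun j => ξ j ω) hω p)
    refine h.congr fun n => ?_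
    rw [ENNReal.ofReal_mul (by positivity), ENNReal.ofReal_natCast]
  · filter_upwards [(hmom fun i => 2 * p i).eventually_le_const
      (ENNReal.lt_add_right (hfin _) one_ne_zero)] with n hn
    refine le_trans (lintegral_mono fun ω => ?_) hn
    have h1 : (risingDegree (fun i => L i ω) p r n : ℝ≥0∞) ^ 2
        ≤ risingDegree (fun i => L i ω) (fun i => 2 * p i) r n := by
      exact_mod_cast risingDegree_sq_le _ p r n
    have h2 : ENNReal.ofReal ((n : ℝ) ^ (-((1 - β) * (∑ k ∈ Finset.range r, p k : ℕ)))) ^ 2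
        = ENNReal.ofReal ((n : ℝ) ^ (-((1 - β) * (∑ k ∈ Finset.range r, 2 * p k : ℕ)))) := by
      rw [← ENNReal.ofReal_pow (by positivity), ← Real.rpow_mul_natCast (Nat.cast_nonneg n),
        ← Finset.mul_sum]
      congr 2
      push_cast
      ring
    rw [mul_pow, h2]
    gcongr

end GeometricInterarrivals

/-! ### Conditional laws given the first arrival times -/

theorem lintegral_lawGiven {E : Type*} [MeasurableSpace E] {X : Ω → E} (hX : Measurable X)
    {f : E → ℝ≥0∞} (hf : Measurable f) :
    ∫⁻ x, f x ∂(lawGiven P T r t X)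
      = (P (arrivalEvent T r t))⁻¹ * ∫⁻ ω in arrivalEvent T r t, f (X ω) ∂P := by
  rw [lawGiven, lintegral_map hf hX, ProbabilityTheory.cond, lintegral_smul_measure, smul_eq_mul]
  rfl

theorem map_lawGiven {E F : Type*} [MeasurableSpace E] [MeasurableSpace F] {X : Ω → E}
    (hX : Measurable X) {f : E → F} (hf : Measurable f) :
    (lawGiven P T r t X).map f = lawGiven P T r t fun ω => f (X ω) := by
  rw [lawGiven, Measure.map_map hf hX, lawGiven]
  rfl

theorem isProbabilityMeasure_lawGiven [IsFiniteMeasure P] (hP : P (arrivalEvent T r t) ≠ 0)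
    {E : Type*} [MeasurableSpace E] {X : Ω → E} (hX : Measurable X) :
    IsProbabilityMeasure (lawGiven P T r t X) := by
  have : IsProbabilityMeasure
      (ProbabilityTheory.cond P {ω | ∀ k, 1 ≤ k → k ≤ r → T k ω = t k}) :=
    cond_isProbabilityMeasure hP
  exact Measure.isProbabilityMeasure_map hX.aemeasurable

theorem ae_lawGiven {E : Type*} [MeasurableSpace E] {X : Ω → E} (hX : Measurable X) {p : E → Prop}
    (hp : MeasurableSet {x | p x}) (h : ∀ᵐ ω ∂P, p (X ω)) : ∀ᵐ x ∂(lawGiven P T r t X), p x := by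
  rw [lawGiven, ae_map_iff hX.aemeasurable hp]
  exact cond_absolutelyContinuous.ae_le h

theorem ae_limit_nonneg {ξ : ℕ → Ω → ℝ}
    (hξ : ∀ᵐ ω ∂P, ∀ j, 1 ≤ j → Tendsto (fun n : ℕ => (n : ℝ) ^ (-(1 - β))
      * (degree (fun i => L i ω) j n : ℝ)) atTop (𝓝 (ξ j ω))) :
    ∀ᵐ ω ∂P, ∀ j, 1 ≤ j → 0 ≤ ξ j ω := by
  filter_upwards [hξ] with ω hω j hj
  exact ge_of_tendsto' (hω j hj) fun n => by positivity

namespace GeometricInterarrivals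

variable [IsProbabilityMeasure P] {ξ : ℕ → Ω → ℝ}

theorem lintegral_lawGiven_limit (hT : GeometricInterarrivals β T P) (hG : IsGraph 0 T L P)
    (h0 : 0 < β) (h1 : β < 1) (hξm : ∀ j, Measurable (ξ j))
    (hξ : ∀ᵐ ω ∂P, ∀ j, 1 ≤ j → Tendsto (fun n : ℕ => (n : ℝ) ^ (-(1 - β))
      * (degree (fun i => L i ω) j n : ℝ)) atTop (𝓝 (ξ j ω)))
    (hr : 1 ≤ r) (ht : IsArrivalPrefix r t) (p : ℕ → ℕ) :
    ∫⁻ x, ENNReal.ofReal (∏ i : Fin r, x i ^ p i)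
        ∂(lawGiven P T r t fun ω (j : Fin r) => ξ (j.val + 1) ω)
      = ENNReal.ofReal (totalMellin β (t r) (∑ k ∈ Finset.range r, p k : ℕ)
        * ∏ i ∈ Finset.range r,
          stickFactor ((t (i + 1) : ℝ) - 1) (p i) (∑ k ∈ Finset.range i, p k)) := by
  rw [lintegral_lawGiven (measurable_pi_lambda _ fun j => hξm _) (by fun_prop)]
  have e : ∀ ω, ∏ i : Fin r, ξ (i.val + 1) ω ^ p i = ∏ i ∈ Finset.range r, ξ (i + 1) ω ^ p i :=
    fun ω => Fin.prod_univ_eq_prod_range (fun i => ξ (i + 1) ω ^ p i) r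
  simp_rw [e]
  rw [hT.setLIntegral_limit hG h0 h1 hξ hr ht, ← mul_assoc, ENNReal.inv_mul_cancel
    (hT.measure_arrivalEvent_ne_zero hG h0 h1 hr ht) (measure_ne_top _ _), one_mul]

/-- The limits of the degrees provide a positive stable law. -/
theorem exists_isPositiveStable (hT : GeometricInterarrivals β T P) (hG : IsGraph 0 T L P)
    (h0 : 0 < β) (h1 : β < 1) (hξm : ∀ j, Measurable (ξ j))
    (hξ : ∀ᵐ ω ∂P, ∀ j, 1 ≤ j → Tendsto (fun n : ℕ => (n : ℝ) ^ (-(1 - β))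
      * (degree (fun i => L i ω) j n : ℝ)) atTop (𝓝 (ξ j ω))) :
    ∃ ν, IsPositiveStable (1 - β) ν := by
  have hpre : IsArrivalPrefix 1 fun _ => 1 :=
    ⟨rfl, fun i hi j hj hij => by have := hi.1; have := hj.2; omega⟩
  have hP := hT.measure_arrivalEvent_ne_zero hG h0 h1 le_rfl hpre
  have := isProbabilityMeasure_lawGiven hP (hξm 1)
  refine YuleSimon.exists_isPositiveStable (μ := lawGiven P T 1 (fun _ => 1) (ξ 1)) (by linarith)
    (ae_lawGiven (hξm 1) measurableSet_Ici ((ae_limit_nonneg hξ).mono fun ω h => h 1 le_rfl))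
    fun p => ?_
  -- For a single vertex arriving at time 1 the stick factor is 1, and `totalMellin` is p! / Γ(1 +
  -- (1 - β) p), the moment required of the power of a stable variable.
  have h := hT.lintegral_lawGiven_limit hG h0 h1 hξm hξ le_rfl hpre fun _ => p
  rw [lintegral_lawGiven (measurable_pi_lambda _ fun j => hξm _) (by fun_prop)] at h
  rw [lintegral_lawGiven (hξm 1) (by fun_prop)]
  simpa [totalMellin, stickFactor, add_comm (1 : ℝ), Real.Gamma_nat_eq_factorial] using h

theorem lawGiven_limit (hT : GeometricInterarrivals β T P) (hG : IsGraph 0 T L P)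
    (h0 : 0 < β) (h1 : β < 1) (hξm : ∀ j, Measurable (ξ j))
    (hξ : ∀ᵐ ω ∂P, ∀ j, 1 ≤ j → Tendsto (fun n : ℕ => (n : ℝ) ^ (-(1 - β))
      * (degree (fun i => L i ω) j n : ℝ)) atTop (𝓝 (ξ j ω)))
    (hr : 1 ≤ r) (ht : IsArrivalPrefix r t) :
    lawGiven P T r t (fun ω (j : Fin r) => ξ (j.val + 1) ω)
      = scaleLaw (genMittagLeffler (1 - β) ((t r : ℝ) - 1) ∗ₘ
          betaLaw (t r) (((t r : ℝ) - 1) * (β / (1 - β)))) (stickLaw r t) := by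
  have hm : Measurable fun ω (j : Fin r) => ξ (j.val + 1) ω := measurable_pi_lambda _ fun j => hξm _
  have := isProbabilityMeasure_lawGiven (hT.measure_arrivalEvent_ne_zero hG h0 h1 hr ht) hm
  refine eq_scaleLaw_stickLaw h0 h1 (hT.exists_isPositiveStable hG h0 h1 hξm hξ) hr ht
    (ae_lawGiven hm ?_ ((ae_limit_nonneg hξ).mono fun ω h i => h _ (by omega)))
    (hT.lintegral_lawGiven_limit hG h0 h1 hξm hξ hr ht)
  rw [show {x : Fin r → ℝ | ∀ i, 0 ≤ x i} = ⋂ i, {x | 0 ≤ x i} by ext; simp]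
  exact MeasurableSet.iInter fun i => measurableSet_le measurable_const (measurable_pi_apply i)

/-- Vertex j is the last of the first j, so its limit is the last coordinate of the scaled
stick-breaking vector: the total times one beta variable. -/
theorem hasMellin_lawGiven_limit (hT : GeometricInterarrivals β T P) (hG : IsGraph 0 T L P)
    (h0 : 0 < β) (h1 : β < 1) (hξm : ∀ j, Measurable (ξ j))
    (hξ : ∀ᵐ ω ∂P, ∀ j, 1 ≤ j → Tendsto (fun n : ℕ => (n : ℝ) ^ (-(1 - β))
      * (degree (fun i => L i ω) j n : ℝ)) atTop (𝓝 (ξ j ω)))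
    {j : ℕ} (hj : 1 ≤ j) (ht : IsArrivalPrefix j t) :
    HasMellin (lawGiven P T j t (ξ j)) (degreeMellin β (t j)) := by
  obtain ⟨r, rfl⟩ : ∃ r, j = r + 1 := ⟨j - 1, by omega⟩
  have ht1 : (1 : ℝ) ≤ t (r + 1) := by exact_mod_cast ht.one_le hj le_rfl
  have hst := hT.exists_isPositiveStable hG h0 h1 hξm hξ
  have hlaw := hT.lawGiven_limit hG h0 h1 hξm hξ hj ht
  have := (hasMellin_total h0 h1 hst ht1).prob
  have := isProbabilityMeasure_stickLaw ht
  have h := congrArg (Measure.map fun x => x (Fin.last r)) hlaw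
  rw [map_eval_scaleLaw, map_last_stickLaw ht, map_lawGiven
    (measurable_pi_lambda _ fun j => hξm _) (measurable_pi_apply _)] at h
  have h' : lawGiven P T (r + 1) t (ξ (r + 1)) = _ := h
  rw [h']
  exact hasMellin_total_mconv_beta h0 h1 hst ht1

end GeometricInterarrivals

end

end YuleSimon

end

/-! ### Assembly of the limits, their conditional laws and the recursions -/

open YuleSimon in
theorem proposition18 {Ω : Type*} [MeasurableSpace Ω] (P : Measure Ω) [IsProbabilityMeasure P]
    (β : ℝ) (hβ0 : 0 < β) (hβ1 : β < 1) (T L : ℕ → Ω → ℕ)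
    (hG : IsGraph 0 T L P) (hT : GeometricInterarrivals β T P) :
    ∃ ξ : ℕ → Ω → ℝ,
      (∀ j, Measurable (ξ j)) ∧
      -- almost sure convergence of the scaled degrees, after `n` edge ends and after `n` edges
      (∀ᵐ ω ∂P, ∀ j, 1 ≤ j →
        Tendsto (fun n : ℕ => (n : ℝ) ^ (-(1 - β)) * (degree (fun i => L i ω) j n : ℝ))
          atTop (𝓝 (ξ j ω))) ∧
      (∀ᵐ ω ∂P, ∀ j, 1 ≤ j →
        Tendsto (fun n : ℕ => (2 * n : ℝ) ^ (-(1 - β)) * (degree (fun i => L i ω) j (2 * n) : ℝ))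
          atTop (𝓝 (ξ j ω))) ∧
      -- joint laws given the first `r` arrival times
      (∀ (r : ℕ) (t : ℕ → ℕ), 1 ≤ r → IsArrivalPrefix r t →
        lawGiven P T r t (fun ω (j : Fin r) => ξ (j.val + 1) ω)
          = scaleLaw (genMittagLeffler (1 - β) ((t r : ℝ) - 1) ∗ₘ
              betaLaw (t r) (((t r : ℝ) - 1) * (β / (1 - β)))) (stickLaw r t) ∧
        scaleLaw (powLaw (gammaLaw (t r)) (1 - β))
            (lawGiven P T r t (fun ω (j : Fin r) => ξ (j.val + 1) ω))
          = scaleLaw (gammaLaw (t r)) (stickLaw r t)) ∧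
      -- laws of `ξ j` given the first `j` arrival times
      (∀ (j : ℕ) (t : ℕ → ℕ), 1 < j → IsArrivalPrefix j t →
        lawGiven P T j t (ξ j)
          = mittagLeffler (1 - β) ∗ₘ powLaw (betaLaw 1 ((t j : ℝ) - 1)) (1 - β) ∧
        lawGiven P T j t (ξ j)
          = (genMittagLeffler (1 - β) ((t j : ℝ) - 1) ∗ₘ
              betaLaw (t j) (((t j : ℝ) - 1) * (β / (1 - β)))) ∗ₘ
              betaLaw 1 ((t j : ℝ) - 1) ∧
        lawGiven P T j t (ξ j)
          = genMittagLeffler (1 - β) ((t j : ℝ) - 1) ∗ₘ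
              betaLaw 1 (((t j : ℝ) - 1) / (1 - β)) ∧
        lawGiven P T j t (ξ j)
          = genMittagLeffler (1 - β) (t j) ∗ₘ
              betaLaw 1 (((t j : ℝ) - 1 + β) / (1 - β)) ∧
        lawGiven P T j t (ξ j) ∗ₘ powLaw (gammaLaw (t j)) (1 - β) = gammaLaw 1) ∧
      -- recursions in `j`, the gap `d` being the value of the interarrival time `Δ (j + 1)`
      (∀ (j d : ℕ) (t : ℕ → ℕ), 1 < j → IsArrivalPrefix (j + 1) t → t (j + 1) = t j + d →
        lawGiven P T (j + 1) t (ξ (j + 1))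
          = lawGiven P T j t (ξ j) ∗ₘ powLaw (betaLaw (t j) d) (1 - β) ∧
        lawGiven P T (j + 1) t (ξ (j + 1)) ∗ₘ
            prodLaw (fun i : Fin d =>
              betaLaw (((t j : ℝ) + ((i.val : ℝ) + 1) - β) / (1 - β)) (β / (1 - β)))
          = lawGiven P T j t (ξ j) ∗ₘ betaLaw ((t j : ℝ) / (1 - β)) ((d : ℝ) / (1 - β)) ∧
        lawGiven P T (j + 1) t (ξ (j + 1)) ∗ₘ
            prodLaw (fun i : Fin d =>
              betaLaw (((t j : ℝ) - 1 + ((i.val : ℝ) + 1) - β) / (1 - β)) (β / (1 - β)))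
          = lawGiven P T j t (ξ j) ∗ₘ
              betaLaw (((t j : ℝ) - β) / (1 - β)) ((d : ℝ) / (1 - β))) := by
  have hσ : 0 < 1 - β := by linarith
  have hconv := ae_all_iff.2 fun j : ℕ =>
    hT.ae_exists_tendsto_degree hG hβ0 hβ1 (Nat.le_add_left 1 j)
  have hlim : ∀ j, ∃ f : Ω → ℝ, Measurable f ∧ ∀ᵐ ω ∂P, Tendsto (fun n : ℕ => (n : ℝ) ^ (-(1 - β))
      * (degree (fun i => L i ω) (j + 1) n : ℝ)) atTop (𝓝 (f ω)) := fun j =>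
    measurable_limit_of_tendsto_metrizable_ae (fun n => ((measurable_from_top (f := fun d : ℕ =>
      (n : ℝ) ^ (-(1 - β)) * (d : ℝ))).comp ((measurable_degree T L (j + 1) n).mono
      (hG.history_le n) le_rfl)).aemeasurable) (ae_all_iff.1 hconv j)
  choose f hfm hf using hlim
  obtain ⟨ξ, hξm, hξ⟩ : ∃ ξ : ℕ → Ω → ℝ, (∀ j, Measurable (ξ j)) ∧ ∀ᵐ ω ∂P, ∀ j, 1 ≤ j →
      Tendsto (fun n : ℕ => (n : ℝ) ^ (-(1 - β)) * (degree (fun i => L i ω) j n : ℝ)) atTop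
        (𝓝 (ξ j ω)) := by
    refine ⟨fun j => f (j - 1), fun j => hfm _, ?_⟩
    filter_upwards [ae_all_iff.2 hf] with ω hω j hj
    simpa [Nat.sub_add_cancel hj] using hω (j - 1)
  have hst := hT.exists_isPositiveStable hG hβ0 hβ1 hξm hξ
  have hmel := fun {j : ℕ} {t : ℕ → ℕ} => hT.hasMellin_lawGiven_limit hG hβ0 hβ1 hξm hξ
    (j := j) (t := t)
  -- Laws of a single limit are compared through `degreeMellin`; the constants C = Γ(t) t and K = 2
  -- are those of `degreeMellin_le`.
  have hext : ∀ {μ ν : Measure ℝ} {m : ℝ → ℝ} {t : ℝ}, 1 ≤ t → HasMellin μ (degreeMellin β t) →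
      HasMellin ν m → (∀ s, 0 ≤ s → m s = degreeMellin β t s) → μ = ν := fun ht h h' hm =>
    h.ext (h'.congr hm) (C := Real.Gamma _ * _) (K := 2)
      (mul_nonneg (Real.Gamma_nonneg_of_nonneg (by linarith)) (by linarith)) two_pos
      (degreeMellin_le hβ0 hβ1 ht) fun p => rfl
  refine ⟨ξ, hξm, hξ, ?_, fun r t hr ht => ?_, fun j t hj ht => ?_, fun j d t hj ht hd => ?_⟩
  · filter_upwards [hξ] with ω hω j hj
    have := (hω j hj).comp (tendsto_id.const_mul_atTop' (r := 2) two_pos)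
    simpa [Function.comp_def] using this
  · have hlaw := hT.lawGiven_limit hG hβ0 hβ1 hξm hξ hr ht
    refine ⟨hlaw, ?_⟩
    have htr := ht.one_le hr le_rfl
    have ht1 : (1 : ℝ) ≤ t r := by exact_mod_cast htr
    have := (hasMellin_total hβ0 hβ1 hst ht1).prob
    have := ((hasMellin_gammaLaw (show (0 : ℝ) < t r by linarith)).powLaw hσ.le).prob
    have := isProbabilityMeasure_stickLaw ht
    rw [hlaw, scaleLaw_scaleLaw, powLaw_gammaLaw_mconv_total hβ0 hβ1 hst htr]
  · have ht1 : (1 : ℝ) ≤ t j := by exact_mod_cast ht.one_le hj.le le_rfl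
    have h := hmel hj.le ht
    refine ⟨hext ht1 h (hasMellin_mittagLeffler_mconv hβ1 hst ht1) fun _ _ => rfl,
      hext ht1 h (hasMellin_total_mconv_beta hβ0 hβ1 hst ht1) fun _ _ => rfl,
      hext ht1 h (hasMellin_genMittagLeffler_mconv hβ1 hst ht1) fun _ _ => rfl,
      hext ht1 h (hasMellin_genMittagLeffler_mconv' hβ0 hβ1 hst ht1) fun _ _ => rfl, ?_⟩
    have hg := (hasMellin_gammaLaw (show (0 : ℝ) < t j by linarith)).powLaw hσ.le
    refine (h.mconv hg).ext (hasMellin_gammaLaw one_pos) (C := 1) (K := 1) zero_le_one one_pos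
      (fun p => ?_) fun p => ?_
    · simp [add_comm (1 : ℝ), Real.Gamma_nat_eq_factorial]
    · rw [degreeMellin_mul_gamma hβ1 ht1 p.cast_nonneg, Real.Gamma_one, div_one]
  · have ht' := ht.mono (Nat.le_succ j)
    have ht1 : (1 : ℝ) ≤ t j := by exact_mod_cast ht'.one_le hj.le le_rfl
    have ht2 : (1 : ℝ) < t j := by exact_mod_cast ht'.one_lt hj le_rfl
    have h := hmel hj.le ht'
    have h' := hmel (Nat.le_add_left 1 j) ht
    have htd : (t (j + 1) : ℝ) = t j + d := by rw [hd]; push_cast; rfl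
    rw [htd] at h'
    have hd0 : (0 : ℝ) ≤ d := d.cast_nonneg
    have ht0 : (0 : ℝ) < t j := by linarith
    -- A beta factor does not increase moments, so the constants for the degree also serve the
    -- right-hand sides of the last two recursions.
    have hb : ∀ {a b : ℝ}, 0 < a → 0 ≤ b → ∀ p : ℕ,
        degreeMellin β (t j) p * betaMellin a b p
          ≤ Real.Gamma (t j) * t j * 2 ^ p * Nat.factorial p :=
      fun ha hb p => (mul_le_of_le_one_right (h.nonneg p p.cast_nonneg)
        (betaMellin_le_one ha hb p.cast_nonneg)).trans (degreeMellin_le hβ0 hβ1 ht1 p)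
    have hC : 0 ≤ Real.Gamma (t j) * t j :=
      mul_nonneg (Real.Gamma_nonneg_of_nonneg ht0.le) ht0.le
    refine ⟨?_, ?_, ?_⟩
    · exact (hext (by linarith) h' (h.mconv ((hasMellin_betaLaw ht0 hd0).powLaw hσ.le))
        fun s hs => (degreeMellin_add hβ1 ht1 hd0 hs).symm)
    · refine (h'.mconv (hasMellin_prodLaw fun i : Fin d => hasMellin_betaLaw (div_pos
        (by have : (0 : ℝ) ≤ i.val := i.val.cast_nonneg; linarith) hσ)
        (div_nonneg hβ0.le hσ.le))).ext (h.mconv (hasMellin_betaLaw (div_pos ht0 hσ)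
        (div_nonneg hd0 hσ.le))) hC two_pos (hb (div_pos ht0 hσ) (div_nonneg hd0 hσ.le))
        fun p => degreeMellin_mul_prod hβ1 ht1 p.cast_nonneg d
    · have hpos : 0 < ((t j : ℝ) - β) / (1 - β) := div_pos (by linarith) hσ
      refine (h'.mconv (hasMellin_prodLaw fun i : Fin d => hasMellin_betaLaw (div_pos
        (by have : (0 : ℝ) ≤ i.val := i.val.cast_nonneg; linarith) hσ)
        (div_nonneg hβ0.le hσ.le))).ext (h.mconv (hasMellin_betaLaw hpos
        (div_nonneg hd0 hσ.le))) hC two_pos (hb hpos (div_nonneg hd0 hσ.le))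
        fun p => degreeMellin_mul_prod' hβ1 ht2 p.cast_nonneg d
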